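/- Throughout, points and varieties are over $\mathbb{C}$. **Conventions.** Let $V=\mathbb{C}^{d+1}$ with its standard basis. In the Grassmann–Cayley algebra, i.e. the exterior algebra $\Lambda(V)$, the join $\vee$ is the exterior product, $v_1\cdots v_k$ denotes $v_1\vee\cdots\vee v_k$, and $[v_1\cdots v_{d+1}]$ is the determinant. For $j+k\ge d+1$ the meet of $a_1\cdots a_j$ and $b_1\cdots b_k$ is $$(a_1\cdots a_j)\wedge(b_1\cdots b_k)=\sum_\sigma \operatorname{sign}(\sigma)\,[a_{\sigma(1)}\cdots a_{\sigma(d+1-k)}\,b_1\cdots b_k]\;a_{\sigma(d+2-k)}\cdots a_{\sigma(j)},$$ the sum being over the permutations $\sigma$ of $\{1,\dots,j\}$ with $\sigma(1)<\cdots<\sigma(d+1-k)$ and $\sigma(d+2-k)<\cdots<\sigma(j)$; it is extended bilinearly. A rational normal curve in $\mathbb{P}^d$ is the image of $\{(s^d:s^{d-1}t:\cdots:t^d)\mid (s:t)\in\mathbb{P}^1\}$ under a projective linear automorphism of $\mathbb{P}^d$. The variety $V_{d,n}\subseteq(\mathbb{P}^d)^n$ is the Zariski closure of the set of $n$-tuples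 of distinct points lying on a rational normal curve. A quasi-Veronese curve in $\mathbb{P}^d$ is a connected (reduced) projective curve of degree $d$ in $\mathbb{P}^d$ not contained in a hyperplane. **Theorem.** Let $d\ge 3$, and let $P_1,\dots,P_{d+4}$ be points of $\mathbb{P}^d$ that do not all lie on one hyperplane. Then the following are equivalent: 1. $(P_1,\dots,P_{d+4})\in V_{d,d+4}$; 2. there is a quasi-Veronese curve in $\mathbb{P}^d$ which contains $P_1,\dots,P_{d+4}$; 3. for every $I=\{i_1<\cdots<i_6\}\subseteq\{1,\dots,d+4\}$ with complement $\{j_1<\cdots<j_{d-2}\}$, $$(P_{i_1}P_{i_2}\wedge P_{i_4}P_{i_5}P_{j_1}\cdots P_{j_{d-2}})\vee(P_{i_2}P_{i_3}\wedge P_{i_5}P_{i_6}P_{j_1}\cdots P_{j_{d-2}})\vee(P_{i_3}P_{i_4}\wedge P_{i_6}P_{i_1}P_{j_1}\cdots P_{j_{d-2}})\vee P_{j_1}\cdots P_{j_{d-2}}=0$$ in the Grassmann–Cayley algebra, where each $P_a$ stands for an arbitrary vector of homogeneous coordinates of the point $P_a$. -/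

import Mathlib

noncomputable section

namespace PascalRNC

open scoped TensorProduct LinearAlgebra.Projectivization Topology

/-! ### The Grassmann–Cayley algebra of `ℂ ^ N` -/

/-- The underlying vector space `Λ(ℂ ^ N)` of the Grassmann–Cayley algebra. The join `A ∨ B` of two
elements is their product `A * B` in the exterior algebra. -/
abbrev GCAlgebra (N : ℕ) : Type := ExteriorAlgebra ℂ (Fin N → ℂ)

/-- A vector, as an extensor of step `1`. -/
abbrev pt {N : ℕ} (v : Fin N → ℂ) : GCAlgebra N := ExteriorAlgebra.ι ℂ v

/-- The extensor `v₁ ∨ ⋯ ∨ v_k` of step `k`. -/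
abbrev extensor {N k : ℕ} (v : Fin k → (Fin N → ℂ)) : GCAlgebra N := ExteriorAlgebra.ιMulti ℂ k v

/-- The bracket: the linear form on `Λ(ℂ ^ N)` which takes `v₁ ∨ ⋯ ∨ v_N` to the determinant
`[v₁ ⋯ v_N]` with respect to the standard basis, and is `0` on all the extensors of step `≠ N`. -/
def bracket (N : ℕ) : GCAlgebra N →ₗ[ℂ] ℂ :=
  ExteriorAlgebra.liftAlternating
    (Pi.single N (Matrix.detRowAlternating : (Fin N → ℂ) [⋀^Fin N]→ₗ[ℂ] ℂ))

theorem bracket_extensor {N : ℕ} (v : Fin N → (Fin N → ℂ)) :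
    bracket N (extensor v) = Matrix.det (Matrix.of v) := by
  simp [bracket, extensor, Matrix.detRowAlternating]
  rfl

theorem bracket_extensor_of_ne {N k : ℕ} (h : k ≠ N) (v : Fin k → (Fin N → ℂ)) :
    bracket N (extensor v) = 0 := by
  simp [bracket, extensor, Pi.single_eq_of_ne h]

/-- The grading of the Grassmann–Cayley algebra by the step. -/
abbrev step (N : ℕ) : ℕ → Submodule ℂ (GCAlgebra N) := fun i => ⋀[ℂ]^i (Fin N → ℂ)

theorem pt_mem_step {N : ℕ} (v : Fin N → ℂ) : pt v ∈ step N 1 := by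
  simp [step]

/-- Splitting a vector: `v ↦ v ⊗ 1 + 1 ⊗ v`. -/
def splitVector (N : ℕ) : (Fin N → ℂ) →ₗ[ℂ] (step N ᵍ⊗[ℂ] step N) :=
  (GradedTensorProduct.includeLeft (step N) (step N)).toLinearMap ∘ₗ ExteriorAlgebra.ι ℂ +
    (GradedTensorProduct.includeRight (step N) (step N)).toLinearMap ∘ₗ ExteriorAlgebra.ι ℂ

theorem splitVector_mul (N : ℕ) (v w : Fin N → ℂ) :
    splitVector N v * splitVector N w =
      (pt v * pt w) ᵍ⊗ₜ[ℂ] 1 + pt v ᵍ⊗ₜ[ℂ] pt w - pt w ᵍ⊗ₜ[ℂ] pt v + 1 ᵍ⊗ₜ[ℂ] (pt v * pt w) := by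
  have h1 : (pt v ᵍ⊗ₜ[ℂ] (1 : GCAlgebra N) * pt w ᵍ⊗ₜ[ℂ] (1 : GCAlgebra N) :
      step N ᵍ⊗[ℂ] step N) = (pt v * pt w) ᵍ⊗ₜ[ℂ] 1 :=
    GradedTensorProduct.tmul_one_mul_coe_tmul (step N) (step N) (pt v) ⟨pt w, pt_mem_step w⟩ 1
  have h2 : (pt v ᵍ⊗ₜ[ℂ] (1 : GCAlgebra N) * (1 : GCAlgebra N) ᵍ⊗ₜ[ℂ] pt w :
      step N ᵍ⊗[ℂ] step N) = pt v ᵍ⊗ₜ[ℂ] pt w :=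
    GradedTensorProduct.tmul_one_mul_one_tmul (step N) (step N) (pt v) (pt w)
  have h3 : ((1 : GCAlgebra N) ᵍ⊗ₜ[ℂ] pt v * pt w ᵍ⊗ₜ[ℂ] (1 : GCAlgebra N) :
      step N ᵍ⊗[ℂ] step N) = - pt w ᵍ⊗ₜ[ℂ] pt v := by
    have := GradedTensorProduct.tmul_coe_mul_coe_tmul (R := ℂ) (step N) (step N) 1
      ⟨pt v, pt_mem_step v⟩ ⟨pt w, pt_mem_step w⟩ 1
    simpa using this
  have h4 : ((1 : GCAlgebra N) ᵍ⊗ₜ[ℂ] pt v * (1 : GCAlgebra N) ᵍ⊗ₜ[ℂ] pt w :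
      step N ᵍ⊗[ℂ] step N) = 1 ᵍ⊗ₜ[ℂ] (pt v * pt w) :=
    GradedTensorProduct.tmul_coe_mul_one_tmul (step N) (step N) 1 ⟨pt v, pt_mem_step v⟩ (pt w)
  have e (u : Fin N → ℂ) : splitVector N u =
      pt u ᵍ⊗ₜ[ℂ] (1 : GCAlgebra N) + (1 : GCAlgebra N) ᵍ⊗ₜ[ℂ] pt u := rfl
  rw [e, e, add_mul, mul_add, mul_add, h1, h2, h3, h4]
  abel

theorem splitVector_mul_self (N : ℕ) (v : Fin N → ℂ) :
    splitVector N v * splitVector N v = 0 := by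
  rw [splitVector_mul]
  simp [pt, GradedTensorProduct.tmul]

/-- The shuffle coproduct of `Λ(ℂ ^ N)`: the algebra homomorphism to the graded tensor square with
`v ↦ v ⊗ 1 + 1 ⊗ v`. It sends `a₁ ⋯ a_j` to the sum, over all `p` and all permutations `σ` with
`σ(1) < ⋯ < σ(p)` and `σ(p+1) < ⋯ < σ(j)`, of
`sign(σ) • a_{σ(1)} ⋯ a_{σ(p)} ⊗ a_{σ(p+1)} ⋯ a_{σ(j)}`. -/
def split (N : ℕ) : GCAlgebra N →ₐ[ℂ] (step N ᵍ⊗[ℂ] step N) :=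
  ExteriorAlgebra.lift ℂ ⟨splitVector N, splitVector_mul_self N⟩

/-- The meet `A ∧ B`, bilinear in `A` and `B`: split `A` into `∑ A' ⊗ A''` and take
`∑ [A' B] A''`. As `[A' B]` vanishes unless the steps of `A'` and `B` add up to `N`, on extensors
this is `∑ sign(σ) [a_{σ(1)} ⋯ a_{σ(N-k)} b₁ ⋯ b_k] a_{σ(N-k+1)} ⋯ a_{σ(j)}`, the sum over
the `σ` with `σ(1) < ⋯ < σ(N-k)` and `σ(N-k+1) < ⋯ < σ(j)`. -/
def meet {N : ℕ} (A B : GCAlgebra N) : GCAlgebra N :=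
  TensorProduct.lid ℂ (GCAlgebra N)
    (TensorProduct.map (bracket N ∘ₗ LinearMap.mulRight ℂ B) LinearMap.id
      ((GradedTensorProduct.of ℂ (step N) (step N)).symm (split N A)))

/-- The meet of a line `a ∨ b` and a hyperplane. -/
theorem meet_pt_mul_pt {d : ℕ} (a b : Fin (d + 1) → ℂ) (h : Fin d → (Fin (d + 1) → ℂ)) :
    meet (pt a * pt b) (extensor h) =
      bracket (d + 1) (pt a * extensor h) • pt b - bracket (d + 1) (pt b * extensor h) • pt a := by
  have hs : split (d + 1) (pt a * pt b) = splitVector (d + 1) a * splitVector (d + 1) b := by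
    simp [split, pt]
  have h2 : bracket (d + 1) (pt a * pt b * extensor h) = 0 := by
    have : pt a * pt b * extensor h = extensor (Matrix.vecCons a (Matrix.vecCons b h)) := by
      simp [pt, extensor, ExteriorAlgebra.ιMulti_succ_apply, mul_assoc, Matrix.vecTail,
        Function.comp_def]
    rw [this, bracket_extensor_of_ne (by omega)]
  have h0 : bracket (d + 1) (extensor h) = 0 := bracket_extensor_of_ne (by omega) h
  rw [meet, hs, splitVector_mul]
  simp only [GradedTensorProduct.tmul, map_add, map_sub]
  simp [h2, h0]

/-- The expression
`(P₁P₂ ∧ P₄P₅J) ∨ (P₂P₃ ∧ P₅P₆J) ∨ (P₃P₄ ∧ P₆P₁J) ∨ J` in the Grassmann–Cayley algebra, for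
vectors `P₁, …, P₆` (here `p 0, …, p 5`) and the extensor `J` of further vectors `q`. -/
def pascalExpr {N k : ℕ} (p : Fin 6 → (Fin N → ℂ)) (q : Fin k → (Fin N → ℂ)) : GCAlgebra N :=
  meet (pt (p 0) * pt (p 1)) (pt (p 3) * pt (p 4) * extensor q) *
    meet (pt (p 1) * pt (p 2)) (pt (p 4) * pt (p 5) * extensor q) *
    meet (pt (p 2) * pt (p 3)) (pt (p 5) * pt (p 0) * extensor q) *
    extensor q

/-! ### Projective space, its Zariski topology, and hyperplanes -/

/-- Complex projective space `ℙ^d`. -/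
abbrev PSpace (d : ℕ) : Type := ℙ ℂ (Fin (d + 1) → ℂ)

/-- The Zariski topology of `ℙ^d`: the sets `{f ≠ 0}`, `f` a homogeneous polynomial, form a basis
of open sets. -/
@[reducible] def zariski (d : ℕ) : TopologicalSpace (PSpace d) :=
  TopologicalSpace.generateFrom
    {U | ∃ (m : ℕ) (f : MvPolynomial (Fin (d + 1)) ℂ), f.IsHomogeneous m ∧
      U = {p | MvPolynomial.eval p.rep f ≠ 0}}

/-- The Zariski topology of `(ℙ^d)^n`: the sets `{f ≠ 0}`, `f` a polynomial in the variables
`x (i, k)` (the `k`-th coordinate of the `i`-th point) which is homogeneous of some degree `e i` in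
the coordinates of the `i`-th point, for every `i`, form a basis of open sets. -/
@[reducible] def multiZariski (d n : ℕ) : TopologicalSpace (Fin n → PSpace d) :=
  TopologicalSpace.generateFrom
    {U | ∃ (e : Fin n → ℕ) (f : MvPolynomial (Fin n × Fin (d + 1)) ℂ),
      f.IsWeightedHomogeneous (fun x => Pi.single x.1 (1 : ℕ)) e ∧
      U = {P | MvPolynomial.eval (fun x => (P x.1).rep x.2) f ≠ 0}}

/-- The set `S` is contained in a hyperplane of `ℙ^d`. -/
def OnHyperplane {d : ℕ} (S : Set (PSpace d)) : Prop :=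
  ∃ φ : Module.Dual ℂ (Fin (d + 1) → ℂ), φ ≠ 0 ∧ ∀ p ∈ S, φ p.rep = 0

/-! ### Rational normal curves and the Veronese compactification -/

/-- The standard rational normal curve `{(s ^ d : s ^ (d-1) t : ⋯ : t ^ d) | (s : t) ∈ ℙ^1}`
(for `d ≥ 1` this vector is nonzero exactly when `(s, t) ≠ (0, 0)`). -/
def standardRNC (d : ℕ) : Set (PSpace d) :=
  {p | ∃ (s t : ℂ) (h : (fun k : Fin (d + 1) => s ^ (d - (k : ℕ)) * t ^ (k : ℕ)) ≠ 0),
    p = Projectivization.mk ℂ _ h}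

/-- The rational normal curves in `ℙ^d`: the images of the standard one under the projective linear
automorphisms. -/
def IsRationalNormalCurve {d : ℕ} (R : Set (PSpace d)) : Prop :=
  ∃ g : (Fin (d + 1) → ℂ) ≃ₗ[ℂ] (Fin (d + 1) → ℂ),
    R = Projectivization.map g.toLinearMap g.injective '' standardRNC d

/-- The Veronese compactification `V_{d,n}`: the Zariski closure in `(ℙ^d)^n` of the set of the
`n`-tuples of distinct points which lie on a rational normal curve. -/
def veroneseCompactification (d n : ℕ) : Set (Fin n → PSpace d) :=
  closure[multiZariski d n]
    {P | Function.Injective P ∧ ∃ R, IsRationalNormalCurve R ∧ ∀ i, P i ∈ R}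

/-! ### Quasi-Veronese curves -/

/-- The forms of degree `m` which vanish on `C`. -/
def vanishingForms {d : ℕ} (C : Set (PSpace d)) (m : ℕ) :
    Submodule ℂ (MvPolynomial.homogeneousSubmodule (Fin (d + 1)) ℂ m) :=
  ⨅ p ∈ C, LinearMap.ker ((MvPolynomial.aeval p.rep).toLinearMap ∘ₗ
    (MvPolynomial.homogeneousSubmodule (Fin (d + 1)) ℂ m).subtype)

/-- The Hilbert function of `C`: the dimension of the degree `m` part of its homogeneous coordinate
ring. -/
def hilbertFunction {d : ℕ} (C : Set (PSpace d)) (m : ℕ) : ℕ :=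
  Module.finrank ℂ (MvPolynomial.homogeneousSubmodule (Fin (d + 1)) ℂ m ⧸ vanishingForms C m)

/-- A quasi-Veronese curve in `ℙ^d`, `d ≥ 1`: a connected (reduced) projective curve of degree `d`
which is not contained in a hyperplane. The last field says that `C` has dimension one and degree
`d`; an isolated point is excluded by connectedness, so that all components of `C` are curves. -/
structure IsQuasiVeronese {d : ℕ} (C : Set (PSpace d)) : Prop where
  isClosed : IsClosed[zariski d] C
  isConnected : @IsConnected _ (zariski d) C
  not_onHyperplane : ¬ OnHyperplane C
  hilbertPolynomial : ∃ c : ℤ, ∀ᶠ m : ℕ in Filter.atTop, (hilbertFunction C m : ℤ) = d * m + c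

end PascalRNC

end

noncomputable section

namespace PascalRNC

open scoped TensorProduct LinearAlgebra.Projectivization Topology

/-! ### The Pascal expression in terms of brackets -/

/-! The first two conditions are each compared with the third, which is read through projection from
J. The expression attached to I and J is a polynomial in the brackets [a b c J]. Modulo the span of
J these brackets are 3×3 determinants, so if J is independent the expression vanishes exactly when
the projections of the six points of I from J lie on a conic (`pascalExpr_eq_zero_iff`,
`pascalBracket_tri_basis`); in the plane this is Pascal's theorem with its converse,
`pascalBracket_det3_eq_zero_iff`. If J is dependent, all the brackets are zero.

From 1 to 3: on a rational normal curve the brackets are Vandermonde products and the expression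
vanishes identically. It is multihomogeneous, so the vanishing passes to the Zariski closure.

From 2 to 3: a quasi-Veronese curve is projected from the points of J, one at a time. The growth
rate of the Hilbert function plus the number of disjoint pieces of the curve drops by at least one
each time (`exists_finrank_pow_add_le_of_chain`); connectedness says that there is only one piece at
the start. The plane image then grows so slowly that it lies on a conic (`exists_conic`). Pieces are
recorded by characteristic functions acting on forms of large degree (`IsSeparated`), without
irreducible components or multiplicities.

From 3 to 1 and 2: choose a basis among the points. The three remaining points have coordinates
which form one triple for each basis vector, a Gale dual configuration. The conditions in which I
consists of three basis points and the three others say that any three triples lie on a conic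
through the vertices of the coordinate triangle, and this forces all triples onto one such conic
(`exists_triangleForm_of_pascalExpr`). If the conic is smooth and the triples are pairwise
non-proportional and away from the vertices, an explicit Lagrange parametrization (`lagrangeVec`) is
a rational normal curve through all the points. For 1, the general case is a Euclidean limit of this
one (`mem_closure_generalTriples`). For 2, degenerate positions are handled by attaching lines and
by gluing two curves at a point, under which the Hilbert function stays minimal (`hilb_union`,
`exists_isMinimalCone`). -/

/-- The bracket expression of the join of the three meets in the Pascal expression, where
`T a b c` plays the role of the bracket `[a b c J]`. -/
def pascalBracket {V R : Type*} [CommRing R] (T : V → V → V → R) (p : Fin 6 → V) : R :=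
  T (p 0) (p 3) (p 4) * T (p 1) (p 4) (p 5) * T (p 2) (p 5) (p 0) * T (p 1) (p 2) (p 3)
    - T (p 1) (p 3) (p 4) * T (p 1) (p 4) (p 5) * T (p 2) (p 5) (p 0) * T (p 0) (p 2) (p 3)
    + T (p 1) (p 3) (p 4) * T (p 2) (p 4) (p 5) * T (p 2) (p 5) (p 0) * T (p 0) (p 1) (p 3)
    - T (p 1) (p 3) (p 4) * T (p 2) (p 4) (p 5) * T (p 3) (p 5) (p 0) * T (p 0) (p 1) (p 2)

/-- The bracket `[a b c J]`, where `J` is the extensor of the vectors `q`. -/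
def tri {k : ℕ} (q : Fin k → (Fin (k + 3) → ℂ)) (a b c : Fin (k + 3) → ℂ) : ℂ :=
  Matrix.det (Matrix.of (Matrix.vecCons a (Matrix.vecCons b (Matrix.vecCons c q))))

theorem extensor_vecCons {N k : ℕ} (a : Fin N → ℂ) (q : Fin k → (Fin N → ℂ)) :
    extensor (Matrix.vecCons a q) = pt a * extensor q := by
  simp only [extensor]
  rw [ExteriorAlgebra.ιMulti_succ_apply]
  rfl

theorem extensor_eq_zero_iff {N : ℕ} (v : Fin N → (Fin N → ℂ)) :
    extensor v = 0 ↔ Matrix.det (Matrix.of v) = 0 := by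
  constructor
  · intro h
    rw [← bracket_extensor, h, map_zero]
  · intro h
    exact AlternatingMap.map_linearDependent _ _ fun hli =>
      (Matrix.linearIndependent_rows_iff_isUnit.1
        (show LinearIndependent ℂ (Matrix.of v).row from hli) |> (Matrix.isUnit_iff_isUnit_det _).1
        |>.ne_zero) h

theorem meet_line {k : ℕ} (q : Fin k → (Fin (k + 3) → ℂ)) (a b c e : Fin (k + 3) → ℂ) :
    meet (pt a * pt b) (pt c * pt e * extensor q) = pt (tri q a c e • b - tri q b c e • a) := by
  have h : pt c * pt e * extensor q = extensor (Matrix.vecCons c (Matrix.vecCons e q)) := by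
    rw [extensor_vecCons, extensor_vecCons, mul_assoc]
  rw [h, meet_pt_mul_pt]
  simp only [← extensor_vecCons, bracket_extensor]
  simp [tri, pt]

theorem tri_eq_bracket {k : ℕ} (q : Fin k → (Fin (k + 3) → ℂ)) (a b c : Fin (k + 3) → ℂ) :
    tri q a b c = bracket (k + 3) (pt a * pt b * pt c * extensor q) := by
  simp only [mul_assoc, ← extensor_vecCons, bracket_extensor]
  rfl

theorem tri_self_left {k : ℕ} (q : Fin k → (Fin (k + 3) → ℂ)) (a b : Fin (k + 3) → ℂ) :
    tri q a a b = 0 := by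
  simp [tri_eq_bracket, pt]

theorem tri_self_right {k : ℕ} (q : Fin k → (Fin (k + 3) → ℂ)) (a b : Fin (k + 3) → ℂ) :
    tri q a b b = 0 := by
  simp [tri_eq_bracket, pt, mul_assoc (ExteriorAlgebra.ι ℂ a)]

/-- The bracket `[a b c J]` as an alternating map of `a, b, c`. -/
def triAlternating {k : ℕ} (q : Fin k → (Fin (k + 3) → ℂ)) :
    (Fin (k + 3) → ℂ) [⋀^Fin 3]→ₗ[ℂ] ℂ :=
  (bracket (k + 3) ∘ₗ LinearMap.mulRight ℂ (extensor q)).compAlternatingMap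
    (ExteriorAlgebra.ιMulti ℂ 3)

theorem triAlternating_apply {k : ℕ} (q : Fin k → (Fin (k + 3) → ℂ))
    (w : Fin 3 → (Fin (k + 3) → ℂ)) : triAlternating q w = tri q (w 0) (w 1) (w 2) := by
  rw [tri_eq_bracket]
  simp [triAlternating, ExteriorAlgebra.ιMulti_apply, mul_assoc]
  rfl

theorem tri_swap_left {k : ℕ} (q : Fin k → (Fin (k + 3) → ℂ)) (a b c : Fin (k + 3) → ℂ) :
    tri q b a c = - tri q a b c := by
  have h := (triAlternating q).map_swap ![a, b, c] (i := 0) (j := 1) (by decide)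
  rw [triAlternating_apply, triAlternating_apply] at h
  simpa [Equiv.swap_apply_def] using h

theorem tri_swap_right {k : ℕ} (q : Fin k → (Fin (k + 3) → ℂ)) (a b c : Fin (k + 3) → ℂ) :
    tri q a c b = - tri q a b c := by
  have h := (triAlternating q).map_swap ![a, b, c] (i := 1) (j := 2) (by decide)
  rw [triAlternating_apply, triAlternating_apply] at h
  simpa [Equiv.swap_apply_def] using h

/-- The Pascal expression vanishes if and only if its bracket expression does. -/
theorem pascalExpr_eq_zero_iff {k : ℕ} (p : Fin 6 → (Fin (k + 3) → ℂ))
    (q : Fin k → (Fin (k + 3) → ℂ)) :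
    pascalExpr p q = 0 ↔ pascalBracket (tri q) p = 0 := by
  rw [pascalExpr, meet_line, meet_line, meet_line, mul_assoc, mul_assoc, ← extensor_vecCons,
    ← extensor_vecCons, ← extensor_vecCons, extensor_eq_zero_iff]
  change tri q _ _ _ = 0 ↔ _
  rw [tri_eq_bracket]
  -- Of the eight terms of the trilinear expansion, four contain a repeated vector; the other four
  -- are the terms of `pascalBracket`.
  simp only [sub_mul, mul_sub, smul_mul_assoc, mul_smul_comm, map_sub, map_smul,
    ← tri_eq_bracket, tri_self_left, tri_self_right, smul_eq_mul, pascalBracket]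
  constructor <;> intro h <;> linear_combination h

/-! ### Six points on a conic -/

/-- The determinant of three vectors of `ℂ ^ 3`. -/
def det3 (a b c : Fin 3 → ℂ) : ℂ := Matrix.det (Matrix.of ![a, b, c])

theorem det3_eq (a b c : Fin 3 → ℂ) : det3 a b c =
    a 0 * (b 1 * c 2 - b 2 * c 1) - a 1 * (b 0 * c 2 - b 2 * c 0)
      + a 2 * (b 0 * c 1 - b 1 * c 0) := by
  simp [det3, Matrix.det_fin_three]
  ring

theorem det3_vecMul (M : Matrix (Fin 3) (Fin 3) ℂ) (a b c : Fin 3 → ℂ) :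
    det3 (Matrix.vecMul a M) (Matrix.vecMul b M) (Matrix.vecMul c M) = M.det * det3 a b c := by
  have : Matrix.of ![Matrix.vecMul a M, Matrix.vecMul b M, Matrix.vecMul c M] =
      Matrix.of ![a, b, c] * M := by
    ext i j
    fin_cases i <;> rfl
  rw [det3, this, Matrix.det_mul, det3, mul_comm]

/-- There is a nonzero quadratic form which vanishes at all the vectors `p i`. -/
def OnConic {ι : Type*} (p : ι → (Fin 3 → ℂ)) : Prop :=
  ∃ Q : QuadraticForm ℂ (Fin 3 → ℂ), Q ≠ 0 ∧ ∀ i, Q (p i) = 0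

/-- The quadratic form `a y z + b x z + c x y`. -/
def triangleForm (a b c : ℂ) : QuadraticForm ℂ (Fin 3 → ℂ) :=
  a • QuadraticMap.linMulLin (LinearMap.proj 1) (LinearMap.proj 2) +
    b • QuadraticMap.linMulLin (LinearMap.proj 0) (LinearMap.proj 2) +
    c • QuadraticMap.linMulLin (LinearMap.proj 0) (LinearMap.proj 1)

theorem triangleForm_apply (a b c : ℂ) (w : Fin 3 → ℂ) :
    triangleForm a b c w = a * (w 1 * w 2) + b * (w 0 * w 2) + c * (w 0 * w 1) := by
  simp [triangleForm]

theorem triangleForm_ne_zero {a b c : ℂ} (h : ¬ (a = 0 ∧ b = 0 ∧ c = 0)) :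
    triangleForm a b c ≠ 0 := by
  intro h0
  refine h ⟨?_, ?_, ?_⟩
  · simpa [triangleForm_apply] using congr($h0 ![0, 1, 1])
  · simpa [triangleForm_apply] using congr($h0 ![1, 0, 1])
  · simpa [triangleForm_apply] using congr($h0 ![1, 1, 0])

theorem eq_triangleForm (Q : QuadraticForm ℂ (Fin 3 → ℂ))
    (h : ∀ i, Q (Pi.single i 1) = 0) : ∃ a b c, Q = triangleForm a b c := by
  refine ⟨QuadraticMap.polar Q (Pi.single 1 1) (Pi.single 2 1),
    QuadraticMap.polar Q (Pi.single 0 1) (Pi.single 2 1),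
    QuadraticMap.polar Q (Pi.single 0 1) (Pi.single 1 1), ?_⟩
  ext w
  have hw : w = w 0 • Pi.single 0 1 + w 1 • Pi.single 1 1 + w 2 • Pi.single 2 1 := by
    ext i
    fin_cases i <;> simp
  conv_lhs => rw [hw]
  rw [QuadraticMap.map_add Q, QuadraticMap.map_add Q]
  simp only [QuadraticMap.map_smul, h, QuadraticMap.polar_add_left, QuadraticMap.polar_smul_left,
    QuadraticMap.polar_smul_right, triangleForm_apply, smul_eq_mul]
  ring

/-- The determinant with rows `(y z, x z, x y)`. -/
def triangleDet (u v w : Fin 3 → ℂ) : ℂ :=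
  det3 ![u 1 * u 2, u 0 * u 2, u 0 * u 1] ![v 1 * v 2, v 0 * v 2, v 0 * v 1]
    ![w 1 * w 2, w 0 * w 2, w 0 * w 1]

theorem exists_triangleForm_iff (u v w : Fin 3 → ℂ) :
    (∃ a b c, triangleForm a b c ≠ 0 ∧ triangleForm a b c u = 0 ∧ triangleForm a b c v = 0 ∧
      triangleForm a b c w = 0) ↔ triangleDet u v w = 0 := by
  rw [triangleDet, det3, ← Matrix.exists_mulVec_eq_zero_iff]
  constructor
  · rintro ⟨a, b, c, h0, hu, hv, hw⟩
    refine ⟨![a, b, c], ?_, ?_⟩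
    · intro h
      have h1 : a = 0 := congr_fun h 0
      have h2 : b = 0 := congr_fun h 1
      have h3 : c = 0 := congr_fun h 2
      exact h0 (by simp [triangleForm, h1, h2, h3])
    · rw [triangleForm_apply] at hu hv hw
      ext i
      fin_cases i <;> simp [Matrix.mulVec, dotProduct, Fin.sum_univ_three]
      · linear_combination hu
      · linear_combination hv
      · linear_combination hw
  · rintro ⟨e, h0, he⟩
    have h := fun i => congr_fun he i
    simp only [Matrix.mulVec, dotProduct, Fin.sum_univ_three] at h
    refine ⟨e 0, e 1, e 2, triangleForm_ne_zero ?_, ?_, ?_, ?_⟩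
    · rintro ⟨h1, h2, h3⟩
      exact h0 (by ext i; fin_cases i <;> assumption)
    · rw [triangleForm_apply]; have := h 0; simp at this; linear_combination this
    · rw [triangleForm_apply]; have := h 1; simp at this; linear_combination this
    · rw [triangleForm_apply]; have := h 2; simp at this; linear_combination this

theorem OnConic.vecMul {ι : Type*} {p : ι → (Fin 3 → ℂ)} {M : Matrix (Fin 3) (Fin 3) ℂ}
    (hM : IsUnit M.det) (h : OnConic p) : OnConic fun i => Matrix.vecMul (p i) M := by
  obtain ⟨Q, hQ, hp⟩ := h
  refine ⟨Q.comp (Matrix.toLin' M⁻¹.transpose), ?_, ?_⟩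
  · intro h
    apply hQ
    ext w
    have := congr($h (Matrix.vecMul w M))
    simpa [Matrix.mulVec_transpose, Matrix.vecMul_vecMul, Matrix.mul_nonsing_inv _ hM] using this
  · intro i
    simp [Matrix.mulVec_transpose, Matrix.vecMul_vecMul, Matrix.mul_nonsing_inv _ hM, hp]

theorem pascalBracket_vecMul (M : Matrix (Fin 3) (Fin 3) ℂ) (p : Fin 6 → (Fin 3 → ℂ)) :
    pascalBracket det3 (fun i => Matrix.vecMul (p i) M) = M.det ^ 4 * pascalBracket det3 p := by
  simp only [pascalBracket, det3_vecMul]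
  ring

/-- The Pascal bracket expression in coordinates where three of the first four vectors, those
other than the `i`-th one, are the standard basis. -/
theorem pascalBracket_of_single (p : Fin 6 → (Fin 3 → ℂ)) (i : Fin 4)
    (h : ∀ j, p (Fin.castLE (by omega) (i.succAbove j)) = Pi.single j 1) :
    pascalBracket det3 p =
      (-1) ^ (i : ℕ) * triangleDet (p (Fin.castLE (by omega) i)) (p 4) (p 5) := by
  have h0 := h 0
  have h1 := h 1
  have h2 := h 2
  fin_cases i
  · change p 1 = _ at h0
    change p 2 = _ at h1
    change p 3 = _ at h2
    simp [pascalBracket, triangleDet, det3_eq, h0, h1, h2]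
    ring
  · change p 0 = _ at h0
    change p 2 = _ at h1
    change p 3 = _ at h2
    simp [pascalBracket, triangleDet, det3_eq, h0, h1, h2]
    ring
  · change p 0 = _ at h0
    change p 1 = _ at h1
    change p 3 = _ at h2
    simp [pascalBracket, triangleDet, det3_eq, h0, h1, h2]
    ring
  · change p 0 = _ at h0
    change p 1 = _ at h1
    change p 2 = _ at h2
    simp [pascalBracket, triangleDet, det3_eq, h0, h1, h2]
    ring

theorem exists_orderEmbedding_linearIndependent {N m : ℕ} (v : Fin m → (Fin N → ℂ))
    (hv : Submodule.span ℂ (Set.range v) = ⊤) :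
    ∃ f : Fin N ↪o Fin m, LinearIndependent ℂ (v ∘ f) := by
  classical
  obtain ⟨κ, a, ha, hspan, hli⟩ := exists_linearIndependent' ℂ v
  have : Finite κ := Finite.of_injective a ha
  have : Fintype κ := Fintype.ofFinite κ
  have hcard : Fintype.card κ = N := by
    have h1 := finrank_span_eq_card hli
    rw [hspan, hv] at h1
    simpa using h1.symm
  have hs : (Finset.univ.map ⟨a, ha⟩).card = N := by simp [hcard]
  refine ⟨Finset.orderEmbOfFin _ hs, ?_⟩
  have hmem : ∀ i, ∃ k, a k = Finset.orderEmbOfFin _ hs i := fun i => by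
    have := Finset.orderEmbOfFin_mem _ hs i
    simpa only [Finset.mem_map, Finset.mem_univ, true_and, Function.Embedding.coeFn_mk] using this
  choose g hg using hmem
  have hinj : Function.Injective g := fun i j hij => by
    have : Finset.orderEmbOfFin _ hs i = Finset.orderEmbOfFin _ hs j := by rw [← hg, ← hg, hij]
    simpa using this
  have : v ∘ Finset.orderEmbOfFin _ hs = (v ∘ a) ∘ g := by
    ext i
    simp [hg]
  rw [this]
  exact hli.comp g hinj

theorem det3_ne_zero_iff (w : Fin 3 → (Fin 3 → ℂ)) :
    det3 (w 0) (w 1) (w 2) ≠ 0 ↔ LinearIndependent ℂ w := by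
  have : ![w 0, w 1, w 2] = w := by ext i; fin_cases i <;> rfl
  rw [det3, this, ← isUnit_iff_ne_zero, ← Matrix.isUnit_iff_isUnit_det,
    ← Matrix.linearIndependent_rows_iff_isUnit]
  rfl

/-- A family of vectors in `ℂ ^ N` which does not span lies in a hyperplane. -/
theorem exists_dual_of_span_ne_top {N : ℕ} {ι : Type*} (v : ι → (Fin N → ℂ))
    (hv : Submodule.span ℂ (Set.range v) ≠ ⊤) :
    ∃ φ : Module.Dual ℂ (Fin N → ℂ), φ ≠ 0 ∧ ∀ i, φ (v i) = 0 := by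
  obtain ⟨φ, h0, h⟩ := Submodule.exists_le_ker_of_lt_top _ (lt_top_iff_ne_top.2 hv)
  exact ⟨φ, h0, fun i => h (Submodule.subset_span ⟨i, rfl⟩)⟩

theorem linMulLin_ne_zero {f g : (Fin 3 → ℂ) →ₗ[ℂ] ℂ} (hf : f ≠ 0) (hg : g ≠ 0) :
    QuadraticMap.linMulLin f g ≠ 0 := by
  intro h
  obtain ⟨u, hu⟩ := DFunLike.ne_iff.1 hf
  obtain ⟨w, hw⟩ := DFunLike.ne_iff.1 hg
  have e : ∀ x, f x * g x = 0 := fun x => by simpa using congr($h x)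
  simp only [LinearMap.zero_apply] at hu hw
  have h1 : g u = 0 := by simpa [hu] using e u
  have h2 : f w = 0 := by simpa [hw] using e w
  have h3 := e (u + w)
  simp [h1, h2, hu, hw] at h3

/-- **Pascal's theorem and its converse**, also for degenerate conics. -/
theorem pascalBracket_det3_eq_zero_iff (p : Fin 6 → (Fin 3 → ℂ)) :
    pascalBracket det3 p = 0 ↔ OnConic p := by
  -- Each term of the expression has a factor that is a bracket of three of the first four points.
  -- Either three of these points can be moved to the standard basis, where conics through them are
  -- triangle forms, or the four points are collinear and every term vanishes.
  by_cases hspan : Submodule.span ℂ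
      (Set.range fun j : Fin 4 => p (Fin.castLE (by omega) j)) = ⊤
  · obtain ⟨f, hf⟩ := exists_orderEmbedding_linearIndependent _ hspan
    obtain ⟨i, hi⟩ : ∃ i : Fin 4, ∀ j, f j = i.succAbove j := by
      have key : ∀ a b c : Fin 4, a < b → b < c → ∃ i : Fin 4,
          a = i.succAbove 0 ∧ b = i.succAbove 1 ∧ c = i.succAbove 2 := by decide
      obtain ⟨i, h0, h1, h2⟩ := key (f 0) (f 1) (f 2) (by simp) (by simp)
      exact ⟨i, fun j => by fin_cases j <;> assumption⟩
    set M : Matrix (Fin 3) (Fin 3) ℂ :=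
      Matrix.of fun j => p (Fin.castLE (by omega) (i.succAbove j)) with hM
    have hdet : IsUnit M.det := by
      rw [← Matrix.isUnit_iff_isUnit_det, ← Matrix.linearIndependent_rows_iff_isUnit]
      have : M.row = (fun j : Fin 4 => p (Fin.castLE (by omega) j)) ∘ f := by
        ext j k
        simp [hM, hi]
      rw [this]
      exact hf
    have hdet' : IsUnit (M⁻¹).det := by simpa [Matrix.det_nonsing_inv] using hdet
    set c : Fin 6 → (Fin 3 → ℂ) := fun j => Matrix.vecMul (p j) M⁻¹ with hc
    have hpc : p = fun j => Matrix.vecMul (c j) M := by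
      ext1 j
      simp [hc, Matrix.vecMul_vecMul, Matrix.nonsing_inv_mul _ hdet]
    have hsingle : ∀ j, c (Fin.castLE (by omega) (i.succAbove j)) = Pi.single j 1 := by
      intro j
      have : p (Fin.castLE (by omega) (i.succAbove j)) = Matrix.vecMul (Pi.single j 1) M := by
        ext k
        simp [hM]
      rw [hc]
      dsimp only
      rw [this, Matrix.vecMul_vecMul, Matrix.mul_nonsing_inv _ hdet, Matrix.vecMul_one]
    have hall : ∀ {P : Fin 6 → Prop}, (∀ j, P j) ↔ (∀ j, P (Fin.castLE (by omega)
        (i.succAbove j))) ∧ P (Fin.castLE (by omega) i) ∧ P 4 ∧ P 5 := by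
      intro P
      refine ⟨fun h => ⟨fun j => h _, h _, h _, h _⟩, ?_⟩
      rintro ⟨h, h1, h2, h3⟩ j
      by_cases h4 : (j : ℕ) < 4
      · rcases Fin.eq_self_or_eq_succAbove i ⟨j, h4⟩ with h5 | ⟨l, h5⟩
        · rw [← h5] at h1; exact h1
        · have := h l; rw [← h5] at this; exact this
      · have : j = 4 ∨ j = 5 := by omega
        rcases this with rfl | rfl <;> assumption
    have h1 : OnConic p ↔ OnConic c := by
      refine ⟨fun h => h.vecMul hdet', fun h => ?_⟩
      rw [hpc]
      exact h.vecMul hdet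
    rw [h1]
    conv_lhs => rw [hpc]
    rw [pascalBracket_vecMul, pascalBracket_of_single c i hsingle, mul_eq_zero, mul_eq_zero,
      or_iff_right (pow_ne_zero _ hdet.ne_zero), or_iff_right (pow_ne_zero _ (by simp)),
      ← exists_triangleForm_iff]
    constructor
    · rintro ⟨a, b, e, h0, h⟩
      refine ⟨_, h0, hall.2 ⟨fun j => ?_, h⟩⟩
      rw [hsingle, triangleForm_apply]
      fin_cases j <;> simp
    · rintro ⟨Q, h0, h⟩
      rw [hall] at h
      simp only [hsingle] at h
      obtain ⟨a, b, e, rfl⟩ := eq_triangleForm Q h.1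
      exact ⟨a, b, e, h0, h.2⟩
  · obtain ⟨f, hf0, hf⟩ := exists_dual_of_span_ne_top _ hspan
    have hdep : ∀ a b c : Fin 4, det3 (p (Fin.castLE (by omega) a)) (p (Fin.castLE (by omega) b))
        (p (Fin.castLE (by omega) c)) = 0 := by
      intro a b c
      by_contra h
      have h := (det3_ne_zero_iff ![p (Fin.castLE (by omega) a), p (Fin.castLE (by omega) b),
        p (Fin.castLE (by omega) c)]).1 h
      have h2 := h.span_eq_top_of_card_eq_finrank (by simp)
      refine hspan (top_le_iff.1 (h2 ▸ Submodule.span_mono ?_))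
      rintro _ ⟨j, rfl⟩
      fin_cases j
      exacts [⟨a, rfl⟩, ⟨b, rfl⟩, ⟨c, rfl⟩]
    have h0 := hdep 0 1 2
    have h1 := hdep 0 1 3
    have h2 := hdep 0 2 3
    have h3 := hdep 1 2 3
    change det3 (p 0) (p 1) (p 2) = 0 at h0
    change det3 (p 0) (p 1) (p 3) = 0 at h1
    change det3 (p 0) (p 2) (p 3) = 0 at h2
    change det3 (p 1) (p 2) (p 3) = 0 at h3
    refine ⟨fun _ => ?_, fun _ => by simp [pascalBracket, h0, h1, h2, h3]⟩
    obtain ⟨g, hg0, hg⟩ := exists_dual_of_span_ne_top ![p 4, p 5] (fun h => by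
      have h1 := finrank_range_le_card (R := ℂ) ![p 4, p 5]
      rw [Set.finrank, h] at h1
      simp at h1)
    -- The conic is a pair of lines: one through the first four points, one through the last two.
    refine ⟨QuadraticMap.linMulLin f g, linMulLin_ne_zero hf0 hg0, fun j => ?_⟩
    rw [QuadraticMap.linMulLin_apply, mul_eq_zero]
    by_cases h4 : (j : ℕ) < 4
    · exact Or.inl (hf ⟨j, h4⟩)
    · have : j = 4 ∨ j = 5 := by omega
      rcases this with rfl | rfl
      · exact Or.inr (hg 0)
      · exact Or.inr (hg 1)

/-! ### Brackets in coordinates -/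

theorem tri_add_right {k : ℕ} (q : Fin k → (Fin (k + 3) → ℂ)) (a b c s : Fin (k + 3) → ℂ)
    (hs : s ∈ Submodule.span ℂ (Set.range q)) : tri q a b (c + s) = tri q a b c := by
  have h0 : pt s * extensor q = 0 := by
    induction hs using Submodule.span_induction with
    | mem x hx =>
      obtain ⟨i, rfl⟩ := hx
      rw [← extensor_vecCons]
      exact AlternatingMap.map_eq_zero_of_eq _ _ (i := 0) (j := i.succ) (by simp)
        (Fin.succ_ne_zero i).symm
    | zero => simp
    | add x y _ _ hx hy => rw [pt, map_add, add_mul, hx, hy, add_zero]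
    | smul r x _ hx => rw [pt, map_smul, smul_mul_assoc, hx, smul_zero]
  have h1 : pt (c + s) * extensor q = pt c * extensor q := by
    rw [pt, map_add, add_mul, h0, add_zero]
  simp only [tri_eq_bracket, mul_assoc, h1]

theorem tri_add_middle {k : ℕ} (q : Fin k → (Fin (k + 3) → ℂ)) (a b c s : Fin (k + 3) → ℂ)
    (hs : s ∈ Submodule.span ℂ (Set.range q)) : tri q a (b + s) c = tri q a b c := by
  rw [tri_swap_right, tri_add_right q a c b s hs, tri_swap_right, neg_neg]

theorem tri_add_left {k : ℕ} (q : Fin k → (Fin (k + 3) → ℂ)) (a b c s : Fin (k + 3) → ℂ)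
    (hs : s ∈ Submodule.span ℂ (Set.range q)) : tri q (a + s) b c = tri q a b c := by
  rw [tri_swap_left, tri_add_middle q b a c s hs, tri_swap_left, neg_neg]

/-- The bracket `[a b c J]` is a determinant of order three in coordinates modulo the span of
`J`. -/
theorem tri_eq_mul_det3 {k : ℕ} (q : Fin k → (Fin (k + 3) → ℂ))
    (w : (Fin (k + 3) → ℂ) → (Fin 3 → ℂ)) (σ : (Fin 3 → ℂ) →ₗ[ℂ] (Fin (k + 3) → ℂ))
    (h : ∀ u, u - σ (w u) ∈ Submodule.span ℂ (Set.range q)) (a b c : Fin (k + 3) → ℂ) :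
    tri q a b c = tri q (σ (Pi.single 0 1)) (σ (Pi.single 1 1)) (σ (Pi.single 2 1)) *
      det3 (w a) (w b) (w c) := by
  have e : ∀ u, u = σ (w u) + (u - σ (w u)) := fun u => by abel
  have h1 : tri q a b c = tri q (σ (w a)) (σ (w b)) (σ (w c)) := by
    conv_lhs => rw [e a, e b, e c]
    rw [tri_add_right _ _ _ _ _ (h c), tri_add_middle _ _ _ _ _ (h b),
      tri_add_left _ _ _ _ _ (h a)]
  -- An alternating trilinear form on `ℂ ^ 3` is its value at the standard basis times the
  -- determinant.
  have h2 := congr($(AlternatingMap.eq_smul_basis_det (Pi.basisFun ℂ (Fin 3))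
    ((triAlternating q).compLinearMap σ)) ![w a, w b, w c])
  rw [h1]
  simp [triAlternating_apply] at h2
  exact h2

/-- Each of the six points occurs exactly twice in every term, and every term has four brackets.
This one homogeneity covers changes of basis, of projective coordinates and of parametrization. -/
theorem pascalBracket_congr {V W R : Type*} [CommRing R] {T : V → V → V → R} {T' : W → W → W → R}
    {p : Fin 6 → V} {p' : Fin 6 → W} (r : R) (κ : Fin 6 → R)
    (h : ∀ i j l, T (p i) (p j) (p l) = κ i * κ j * κ l * r * T' (p' i) (p' j) (p' l)) :
    pascalBracket T p = (∏ i, κ i) ^ 2 * r ^ 4 * pascalBracket T' p' := by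
  simp only [pascalBracket, h, Fin.prod_univ_six]
  ring

/-- The Pascal bracket expression, in the coordinates of a basis which contains `J`. -/
theorem pascalBracket_tri_basis {k : ℕ} (q : Fin k → (Fin (k + 3) → ℂ))
    (B : Module.Basis (Fin 3 ⊕ Fin k) ℂ (Fin (k + 3) → ℂ)) (hB : ∀ i, B (Sum.inr i) = q i)
    (p : Fin 6 → (Fin (k + 3) → ℂ)) :
    pascalBracket (tri q) p = 0 ↔ OnConic fun i l => B.repr (p i) (Sum.inl l) := by
  set σ : (Fin 3 → ℂ) →ₗ[ℂ] (Fin (k + 3) → ℂ) :=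
    Fintype.linearCombination ℂ fun i => B (Sum.inl i) with hσ
  have key := tri_eq_mul_det3 q (fun u l => B.repr u (Sum.inl l)) σ (fun u => by
    have hu := B.sum_repr u
    rw [Fintype.sum_sum_type] at hu
    simp only [hσ, Fintype.linearCombination_apply]
    rw [← eq_sub_iff_add_eq'.2 hu]
    simp only [hB]
    exact Submodule.sum_mem _ fun i _ =>
      Submodule.smul_mem _ _ (Submodule.subset_span ⟨i, rfl⟩))
  have h0 : tri q (σ (Pi.single 0 1)) (σ (Pi.single 1 1)) (σ (Pi.single 2 1)) ≠ 0 := by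
    simp only [hσ, Fintype.linearCombination_apply_single, one_smul, tri]
    have hf : Function.Injective (Matrix.vecCons (Sum.inl 0) (Matrix.vecCons (Sum.inl 1)
        (Matrix.vecCons (Sum.inl 2) Sum.inr)) : Fin (k + 3) → Fin 3 ⊕ Fin k) := by
      simp [Matrix.vecCons, Fin.cons_injective_iff, Sum.inr_injective]
    have hli := B.linearIndependent.comp _ hf
    have e : B ∘ (Matrix.vecCons (Sum.inl 0) (Matrix.vecCons (Sum.inl 1)
        (Matrix.vecCons (Sum.inl 2) Sum.inr)) : Fin (k + 3) → Fin 3 ⊕ Fin k) =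
        Matrix.vecCons (B (Sum.inl 0)) (Matrix.vecCons (B (Sum.inl 1))
          (Matrix.vecCons (B (Sum.inl 2)) q)) := by
      ext l : 1
      refine Fin.cases rfl (fun l => ?_) l
      refine Fin.cases rfl (fun l => ?_) l
      exact Fin.cases rfl (fun l => hB l) l
    rw [e] at hli
    have := Matrix.linearIndependent_rows_iff_isUnit (A := Matrix.of (Matrix.vecCons
      (B (Sum.inl 0)) (Matrix.vecCons (B (Sum.inl 1))
          (Matrix.vecCons (B (Sum.inl 2)) q)))) |>.1 hli
    exact ((Matrix.isUnit_iff_isUnit_det _).1 this).ne_zero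
  rw [pascalBracket_congr (T' := det3) (p' := fun i l => B.repr (p i) (Sum.inl l)) _ (fun _ => 1)
    (fun i j l => by rw [one_mul, one_mul, one_mul]; exact key _ _ _)]
  simp [h0, pascalBracket_det3_eq_zero_iff]

/-! ### Points on a rational normal curve satisfy the Pascal conditions -/

/-- The bracket of the members of a family of vectors with the indices `r`. -/
def brk {R ι : Type*} [CommRing R] {k : ℕ} (v : ι → (Fin (k + 3) → R)) (j : Fin k → ι)
    (a b c : ι) : R :=
  Matrix.det (Matrix.of fun l => v (Matrix.vecCons (α := ι) a (Matrix.vecCons b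
    (Matrix.vecCons c j)) l))

theorem tri_comp {ι : Type*} {k : ℕ} (v : ι → (Fin (k + 3) → ℂ)) (j : Fin k → ι) (a b c : ι) :
    tri (fun l => v (j l)) (v a) (v b) (v c) = brk v j a b c := by
  rw [tri, brk]
  congr 2
  ext l : 1
  refine Fin.cases rfl (fun l => ?_) l
  refine Fin.cases rfl (fun l => ?_) l
  refine Fin.cases rfl (fun l => rfl) l

theorem brk_smul {R ι : Type*} [CommRing R] {k : ℕ} (v : ι → (Fin (k + 3) → R)) (κ : ι → R)
    (j : Fin k → ι) (a b c : ι) :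
    brk (fun i => κ i • v i) j a b c =
      κ a * κ b * κ c * (∏ l, κ (j l)) * brk v j a b c := by
  rw [brk, brk]
  have := Matrix.det_mul_column (fun l => κ (Matrix.vecCons (α := ι) a (Matrix.vecCons b
    (Matrix.vecCons c j)) l)) (Matrix.of fun l => v (Matrix.vecCons (α := ι) a (Matrix.vecCons b
    (Matrix.vecCons c j)) l))
  rw [Fin.prod_univ_succ, Fin.prod_univ_succ, Fin.prod_univ_succ] at this
  simp only [Matrix.cons_val_zero, Matrix.cons_val_succ] at this
  refine this.trans ?_
  ring

theorem brk_map {ι : Type*} {k : ℕ} (v : ι → (Fin (k + 3) → ℂ))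
    (g : (Fin (k + 3) → ℂ) →ₗ[ℂ] (Fin (k + 3) → ℂ)) (j : Fin k → ι) (a b c : ι) :
    brk (fun i => g (v i)) j a b c = LinearMap.det g * brk v j a b c := by
  rw [brk, brk, ← LinearMap.det_toMatrix', ← Matrix.det_transpose (LinearMap.toMatrix' g), mul_comm,
    ← Matrix.det_mul]
  congr 1
  ext l m
  simp only [Matrix.of_apply, Matrix.mul_apply, Matrix.transpose_apply]
  conv_lhs => rw [← LinearMap.toMatrix'_mulVec g]
  simp [Matrix.mulVec, dotProduct, mul_comm]

/-- The point of the affine cone over the standard rational normal curve with parameters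
`(s, t)`. -/
def monomialVec (d : ℕ) (x : ℂ × ℂ) : Fin (d + 1) → ℂ :=
  fun k => x.1 ^ (d - (k : ℕ)) * x.2 ^ (k : ℕ)

/-- A homogeneous Vandermonde determinant. The differences between one of `a`, `b`, `c` and a point
of J go into `κ`, those inside J into `r`, and only the three mutual differences of `a`, `b`, `c`
remain. -/
theorem brk_monomialVec {ι : Type*} {k : ℕ} (x : ι → ℂ × ℂ) (j : Fin k → ι) :
    ∃ r : ℂ, ∃ κ : ι → ℂ, ∀ a b c : ι, brk (fun i => monomialVec (k + 2) (x i)) j a b c =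
      κ a * κ b * κ c * r * (((x b).2 * (x a).1 - (x a).2 * (x b).1) *
        ((x c).2 * (x a).1 - (x a).2 * (x c).1) * ((x c).2 * (x b).1 - (x b).2 * (x c).1)) := by
  refine ⟨∏ l : Fin k, ∏ m ∈ Finset.Ioi l,
    ((x (j m)).2 * (x (j l)).1 - (x (j l)).2 * (x (j m)).1),
    fun a => ∏ l : Fin k, ((x (j l)).2 * (x a).1 - (x a).2 * (x (j l)).1), fun a b c => ?_⟩
  have h := Matrix.det_projVandermonde
    (fun l => (x (Matrix.vecCons (α := ι) a (Matrix.vecCons b (Matrix.vecCons c j)) l)).2)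
    (fun l => (x (Matrix.vecCons (α := ι) a (Matrix.vecCons b (Matrix.vecCons c j)) l)).1)
  rw [Fin.prod_univ_succ, Fin.prod_univ_succ, Fin.prod_univ_succ] at h
  simp only [Fin.prod_Ioi_zero, Fin.prod_Ioi_succ, Fin.prod_univ_succ (n := k + 1),
    Fin.prod_univ_succ (n := k)] at h
  simp only [Matrix.cons_val_zero, Matrix.cons_val_succ] at h
  rw [brk]
  have e : (Matrix.of fun l => monomialVec (k + 2) (x (Matrix.vecCons (α := ι) a
      (Matrix.vecCons b (Matrix.vecCons c j)) l))) = Matrix.projVandermonde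
      (fun l => (x (Matrix.vecCons (α := ι) a (Matrix.vecCons b (Matrix.vecCons c j)) l)).2)
      (fun l => (x (Matrix.vecCons (α := ι) a (Matrix.vecCons b (Matrix.vecCons c j)) l)).1) := by
    ext l m
    simp [Matrix.projVandermonde_apply, monomialVec, Fin.val_rev, mul_comm]
  rw [e, h]
  ring

/-- After the common factors are removed, the brackets are those of points on the standard conic, so
what remains is Pascal's theorem as a polynomial identity. -/
theorem pascalBracket_brk_monomialVec {ι : Type*} {k : ℕ} (x : ι → ℂ × ℂ) (i : Fin 6 → ι)
    (j : Fin k → ι) : pascalBracket (brk (fun i => monomialVec (k + 2) (x i)) j) i = 0 := by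
  obtain ⟨r, κ, h⟩ := brk_monomialVec x j
  rw [pascalBracket_congr (p' := i) (T' := fun a b c => ((x b).2 * (x a).1 - (x a).2 * (x b).1) *
    ((x c).2 * (x a).1 - (x a).2 * (x c).1) * ((x c).2 * (x b).1 - (x b).2 * (x c).1)) r
    (fun a => κ (i a)) (fun a b c => h _ _ _)]
  refine mul_eq_zero_of_right _ ?_
  simp only [pascalBracket]
  ring

/-- The bracket as a polynomial in the coordinates of the points. -/
def brkPoly {n k : ℕ} (j : Fin k → Fin n) (a b c : Fin n) :
    MvPolynomial (Fin n × Fin (k + 3)) ℂ :=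
  brk (fun i m => MvPolynomial.X (i, m)) j a b c

theorem eval_brkPoly {n k : ℕ} (v : Fin n → (Fin (k + 3) → ℂ)) (j : Fin k → Fin n)
    (a b c : Fin n) : MvPolynomial.eval (fun x => v x.1 x.2) (brkPoly j a b c) = brk v j a b c := by
  rw [brkPoly, brk, RingHom.map_det]
  congr 1
  ext l m
  simp

theorem brkPoly_isWeightedHomogeneous {n k : ℕ} (j : Fin k → Fin n) (a b c : Fin n) :
    (brkPoly j a b c).IsWeightedHomogeneous
      (fun x : Fin n × Fin (k + 3) => (Pi.single x.1 1 : Fin n → ℕ))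
      (Pi.single a 1 + Pi.single b 1 + Pi.single c 1 + ∑ l, Pi.single (j l) 1) := by
  rw [brkPoly, brk, Matrix.det_apply, ← MvPolynomial.mem_weightedHomogeneousSubmodule]
  refine Submodule.sum_mem _ fun σ _ => ?_
  rw [Units.smul_def]
  refine zsmul_mem ?_ _
  rw [MvPolynomial.mem_weightedHomogeneousSubmodule]
  have := MvPolynomial.IsWeightedHomogeneous.prod (w :=
    (fun x : Fin n × Fin (k + 3) => (Pi.single x.1 1 : Fin n → ℕ))) Finset.univ
    (fun l => MvPolynomial.X (R := ℂ) ((Matrix.vecCons (α := Fin n) a (Matrix.vecCons b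
      (Matrix.vecCons c j)) (σ l)), l)) _ (fun l _ => MvPolynomial.isWeightedHomogeneous_X _ _ _)
  convert this using 1
  · rfl
  rw [Equiv.sum_comp σ fun l => (Pi.single (Matrix.vecCons (α := Fin n) a (Matrix.vecCons b
      (Matrix.vecCons c j)) l) 1 : Fin n → ℕ), Fin.sum_univ_succ, Fin.sum_univ_succ,
      Fin.sum_univ_succ]
  simp only [Matrix.cons_val_zero, Matrix.cons_val_succ]
  abel

theorem pascalBracket_brkPoly_isWeightedHomogeneous {n k : ℕ} (i : Fin 6 → Fin n)
    (j : Fin k → Fin n) : ∃ e : Fin n → ℕ,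
      (pascalBracket (brkPoly j) i).IsWeightedHomogeneous
        (fun x : Fin n × Fin (k + 3) => (Pi.single x.1 1 : Fin n → ℕ)) e := by
  have key : ∀ a b c a' b' c' a'' b'' c'' a₃ b₃ c₃ : Fin n, _ :=
    fun a b c a' b' c' a'' b'' c'' a₃ b₃ c₃ =>
    (((brkPoly_isWeightedHomogeneous (k := k) j a b c).mul
      (brkPoly_isWeightedHomogeneous j a' b' c')).mul
      (brkPoly_isWeightedHomogeneous j a'' b'' c'')).mul
      (brkPoly_isWeightedHomogeneous j a₃ b₃ c₃)
  -- The multidegree is two for each of the six points and four for each point of J.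
  refine ⟨∑ l, (Pi.single (i l) 1 + Pi.single (i l) 1) + (∑ l, Pi.single (j l) 1 +
    ∑ l, Pi.single (j l) 1 + ∑ l, Pi.single (j l) 1 + ∑ l, Pi.single (j l) 1), ?_⟩
  rw [← MvPolynomial.mem_weightedHomogeneousSubmodule, Fin.sum_univ_six]
  refine Submodule.sub_mem _ (Submodule.add_mem _ (Submodule.sub_mem _ ?_ ?_) ?_) ?_
  all_goals
    rw [MvPolynomial.mem_weightedHomogeneousSubmodule]
    convert key _ _ _ _ _ _ _ _ _ _ _ _ using 1
    abel

/-- The Pascal conditions hold on the Veronese compactification. -/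
theorem pascalExpr_eq_zero_of_mem_veroneseCompactification {k n : ℕ} (P : Fin n → PSpace (k + 2))
    (hP : P ∈ veroneseCompactification (k + 2) n) (v : Fin n → (Fin (k + 3) → ℂ))
    (hv : ∀ a, v a ≠ 0) (hPv : ∀ a, P a = Projectivization.mk ℂ (v a) (hv a))
    (i : Fin 6 → Fin n) (j : Fin k → Fin n) :
    pascalExpr (fun l => v (i l)) (fun l => v (j l)) = 0 := by
  have tri_brk : ∀ v : Fin n → (Fin (k + 3) → ℂ), pascalBracket (tri fun l => v (j l))
      (fun l => v (i l)) = pascalBracket (brk v j) i := fun v => by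
    simp only [pascalBracket, tri_comp]
  have scale : ∀ (v : Fin n → (Fin (k + 3) → ℂ)) (κ : Fin n → ℂ),
      pascalBracket (brk v j) i = 0 → pascalBracket (brk (fun a => κ a • v a) j) i = 0 := by
    intro v κ h
    rw [pascalBracket_congr (p' := i) (T' := brk v j) (∏ l, κ (j l)) (fun a => κ (i a))
      (fun a b c => brk_smul _ _ _ _ _ _), h, mul_zero]
  have hrep : ∀ a, ∃ c : ℂ, c • (P a).rep = v a := fun a => by
    have := Projectivization.mk_rep (P a)
    rw [hPv a, Projectivization.mk_eq_mk_iff'] at this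
    obtain ⟨c, hc⟩ := this
    have hc0 : c ≠ 0 := by
      rintro rfl
      exact Projectivization.rep_nonzero _ (by rw [← hc, zero_smul])
    exact ⟨c⁻¹, by rw [hPv a, ← hc, smul_smul, inv_mul_cancel₀ hc0, one_smul]⟩
  choose κ hκ using hrep
  rw [pascalExpr_eq_zero_iff, tri_brk, ← funext hκ]
  refine scale _ _ ?_
  obtain ⟨e, he⟩ := pascalBracket_brkPoly_isWeightedHomogeneous i j
  have heval : ∀ w : Fin n → (Fin (k + 3) → ℂ), MvPolynomial.eval (fun x => w x.1 x.2)
      (pascalBracket (brkPoly j) i) = pascalBracket (brk w j) i := fun w => by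
    simp only [pascalBracket, map_sub, map_add, map_mul, eval_brkPoly]
  let := multiZariski (k + 2) n
  have hopen : IsOpen {Q : Fin n → PSpace (k + 2) | MvPolynomial.eval
      (fun x => (Q x.1).rep x.2) (pascalBracket (brkPoly j) i) ≠ 0} :=
    TopologicalSpace.isOpen_generateFrom_of_mem ⟨e, _, he, rfl⟩
  -- The zero locus is closed, so only tuples on a rational normal curve need checking; there all
  -- representatives are multiples of `g (monomialVec _ x)`.
  have hclosed := hopen.isClosed_compl
  rw [← heval fun a => (P a).rep]
  by_contra hne
  refine (closure_minimal ?_ hclosed hP) hne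
  rintro Q ⟨-, R, ⟨g, rfl⟩, hQ⟩
  have : ∀ a, ∃ (x : ℂ × ℂ) (c : ℂ), (Q a).rep = c • g (monomialVec (k + 2) x) := by
    intro a
    obtain ⟨_, ⟨s, t, h, rfl⟩, hQa⟩ := hQ a
    rw [Projectivization.map_mk] at hQa
    have h2 := Projectivization.mk_rep (Q a)
    rw [← hQa, Projectivization.mk_eq_mk_iff'] at h2
    obtain ⟨c, hc⟩ := h2
    exact ⟨(s, t), c, by rw [← hQa, ← hc]; rfl⟩
  choose x c hx using this
  simp only [Set.mem_compl_iff, Set.mem_ofPred_eq, not_not]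
  rw [heval fun a => (Q a).rep, funext hx]
  refine scale (fun a => g (monomialVec (k + 2) (x a))) _ ?_
  rw [pascalBracket_congr (p' := i) (T' := brk (fun a => monomialVec (k + 2) (x a)) j)
    (LinearMap.det g.toLinearMap) (fun a => 1) (fun a b c => by
      rw [one_mul, one_mul, one_mul]
      exact brk_map (fun a => monomialVec (k + 2) (x a)) g.toLinearMap _ _ _ _),
    pascalBracket_brk_monomialVec, mul_zero]

/-! ### The Gale dual form of the Pascal conditions -/

/-- Where no entry is zero, `triangleDet` is the product of all nine entries times the determinant
of their reciprocals, which is symmetric under transposition. This is what exchanges the three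
projected points with the triples of coordinates. -/
theorem triangleDet_transpose (u v w : Fin 3 → ℂ) :
    triangleDet u v w = triangleDet ![u 0, v 0, w 0] ![u 1, v 1, w 1] ![u 2, v 2, w 2] := by
  simp [triangleDet, det3_eq]
  ring

theorem exists_orderEmbedding_range {n m : ℕ} (s : Set (Fin n)) (hs : s.ncard = m) :
    ∃ f : Fin m ↪o Fin n, Set.range f = s := by
  classical
  refine ⟨Finset.orderEmbOfFin s.toFinset (by rw [← hs, Set.ncard_eq_toFinset_card']), ?_⟩
  rw [Finset.range_orderEmbOfFin, Set.coe_toFinset]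

/-- If all the Pascal expressions vanish, then the `d + 1` triples of coordinates of the three
vectors outside of a basis lie on a conic through the vertices of the standard triangle. -/
theorem exists_triangleForm_of_pascalExpr {k : ℕ} (v : Fin (k + 6) → (Fin (k + 3) → ℂ))
    (h : ∀ (i : Fin 6 ↪o Fin (k + 6)) (j : Fin k ↪o Fin (k + 6)), Set.range j = (Set.range i)ᶜ →
      pascalExpr (fun l => v (i l)) (fun l => v (j l)) = 0)
    (f : Fin (k + 3) → Fin (k + 6)) (hf : Function.Injective f)
    (E : Module.Basis (Fin (k + 3)) ℂ (Fin (k + 3) → ℂ)) (hE : ∀ a, E a = v (f a))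
    (g : Fin 3 → Fin (k + 6)) (hg : Function.Injective g) (hgf : Set.range g = (Set.range f)ᶜ) :
    ∃ α β γ : ℂ, ¬ (α = 0 ∧ β = 0 ∧ γ = 0) ∧
      ∀ a, triangleForm α β γ (fun m => E.repr (v (g m)) a) = 0 := by
  -- I consists of the three basis indices `f ∘ a` and the range of `g`, so J is the rest of the
  -- basis. Projection from J takes the points `f ∘ a` to the vertices of the triangle, so the conic
  -- is a triangle form through the projections of the other three points; transposition turns this
  -- into a condition on the triples indexed by `a`.
  have hdet : ∀ a : Fin 3 → Fin (k + 3), Function.Injective a →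
      triangleDet (fun m => E.repr (v (g m)) (a 0)) (fun m => E.repr (v (g m)) (a 1))
        (fun m => E.repr (v (g m)) (a 2)) = 0 := by
    intro a ha
    have hdisj : Disjoint (Set.range (f ∘ a)) (Set.range g) := by
      rw [hgf, Set.disjoint_compl_right_iff_subset]
      exact Set.range_comp_subset_range _ _
    have hs : (Set.range (f ∘ a) ∪ Set.range g).ncard = 6 := by
      rw [Set.ncard_union_eq hdisj, Set.ncard_range_of_injective (hf.comp ha),
        Set.ncard_range_of_injective hg]
      simp
    have hs' : (Set.range (f ∘ a) ∪ Set.range g)ᶜ.ncard = k := by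
      have := Set.ncard_add_ncard_compl (Set.range (f ∘ a) ∪ Set.range g)
      rw [hs, Nat.card_eq_fintype_card, Fintype.card_fin] at this
      omega
    obtain ⟨i, hi⟩ := exists_orderEmbedding_range _ hs
    obtain ⟨j, hj⟩ := exists_orderEmbedding_range _ hs'
    have hij : Set.range j = (Set.range i)ᶜ := by rw [hi, hj]
    have hj' : ∀ l, ∃ b, f b = j l := by
      intro l
      have h1 : j l ∈ (Set.range (f ∘ a) ∪ Set.range g)ᶜ := hj ▸ ⟨l, rfl⟩
      rw [Set.compl_union, hgf, compl_compl] at h1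
      exact h1.2
    choose j' hj' using hj'
    have hinj : Function.Injective (Sum.elim a j') := by
      refine ha.sumElim (fun l m hlm => ?_) (fun l m hlm => ?_)
      · apply j.injective
        rw [← hj', ← hj', hlm]
      · have h1 : j m ∈ (Set.range (f ∘ a) ∪ Set.range g)ᶜ := hj ▸ ⟨m, rfl⟩
        exact h1 (Or.inl ⟨l, by rw [← hj', ← hlm]; rfl⟩)
    have hbij : Function.Bijective (Sum.elim a j') :=
      (Fintype.bijective_iff_injective_and_card _).2 ⟨hinj, by simp; omega⟩
    set B := E.reindex (Equiv.ofBijective _ hbij).symm with hB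
    have hBrepr : ∀ u l, B.repr u (Sum.inl l) = E.repr u (a l) := by
      intro u l
      simp [hB]
    have hconic := (pascalBracket_tri_basis (fun l => v (j l)) B (by
      intro l
      simp [hB, hE, hj']) (fun l => v (i l))).1 ((pascalExpr_eq_zero_iff _ _).1 (h i j hij))
    obtain ⟨Q, hQ0, hQ⟩ := hconic
    simp only [hBrepr] at hQ
    have hQ' : ∀ b ∈ Set.range (f ∘ a) ∪ Set.range g, Q (fun l => E.repr (v b) (a l)) = 0 := by
      intro b hb
      rw [← hi] at hb
      obtain ⟨l, rfl⟩ := hb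
      exact hQ l
    obtain ⟨α, β, γ, rfl⟩ := eq_triangleForm Q (fun l => by
      rw [← hQ' (f (a l)) (Or.inl ⟨l, rfl⟩)]
      congr 1
      ext m
      rw [← hE, E.repr_self, Finsupp.single_apply, Pi.single_apply]
      simp [ha.eq_iff, eq_comm])
    have hd := (exists_triangleForm_iff _ _ _).1 ⟨α, β, γ, hQ0, hQ' _ (Or.inr ⟨0, rfl⟩),
      hQ' _ (Or.inr ⟨1, rfl⟩), hQ' _ (Or.inr ⟨2, rfl⟩)⟩
    rw [triangleDet_transpose] at hd
    convert hd using 2 <;> (ext m; fin_cases m <;> rfl)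
  set u : Fin (k + 3) → (Fin 3 → ℂ) := fun a =>
    ![E.repr (v (g 1)) a * E.repr (v (g 2)) a, E.repr (v (g 0)) a * E.repr (v (g 2)) a,
      E.repr (v (g 0)) a * E.repr (v (g 1)) a] with hu
  -- Any three of the vectors `u a` are dependent, so they all lie in a plane; the coefficients of
  -- its equation are those of the common conic.
  obtain ⟨φ, hφ0, hφ⟩ := exists_dual_of_span_ne_top u (fun hspan => by
    obtain ⟨a, ha⟩ := exists_orderEmbedding_linearIndependent u hspan
    exact (det3_ne_zero_iff (u ∘ a)).2 ha (hdet a a.injective))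
  have hφu : ∀ w, φ w = φ (Pi.single 0 1) * w 0 + φ (Pi.single 1 1) * w 1 +
      φ (Pi.single 2 1) * w 2 := fun w => by
    conv_lhs => rw [pi_eq_sum_univ' w]
    simp [Fin.sum_univ_three, mul_comm]
  refine ⟨φ (Pi.single 0 1), φ (Pi.single 1 1), φ (Pi.single 2 1), ?_, fun a => ?_⟩
  · rintro ⟨h0, h1, h2⟩
    refine hφ0 (LinearMap.ext fun w => ?_)
    rw [hφu, h0, h1, h2]
    simp
  · rw [triangleForm_apply, ← hφ a, hφu (u a)]
    rfl

/-! ### Rational normal curves through the vertices of a simplex -/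

/-- A product of `d` linear forms in `(S, T)` is a linear form in the monomials of degree `d`. -/
theorem exists_dual_monomialVec (l : List (ℂ × ℂ)) :
    ∃ φ : Module.Dual ℂ (Fin (l.length + 1) → ℂ), ∀ x : ℂ × ℂ,
      φ (monomialVec l.length x) = (l.map fun y => x.1 * y.2 - x.2 * y.1).prod := by
  induction l with
  | nil => exact ⟨LinearMap.proj 0, fun x => by simp [monomialVec]⟩
  | cons y l ih =>
    obtain ⟨φ, hφ⟩ := ih
    -- Omitting the last monomial leaves `x.1` times the vector of lower degree, omitting the first
    -- leaves `x.2` times it. Their combination supplies one more linear factor.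
    refine ⟨y.2 • φ ∘ₗ LinearMap.funLeft ℂ ℂ Fin.castSucc -
      y.1 • φ ∘ₗ LinearMap.funLeft ℂ ℂ Fin.succ, fun x => ?_⟩
    have h1 : LinearMap.funLeft ℂ ℂ Fin.castSucc (monomialVec (y :: l).length x) =
        x.1 • monomialVec l.length x := by
      ext k
      have hk : (k : ℕ) < l.length + 1 := k.isLt
      have : l.length + 1 - (k : ℕ) = (l.length - k) + 1 := by omega
      simp [LinearMap.funLeft, monomialVec, this, pow_succ]
      ring
    have h2 : LinearMap.funLeft ℂ ℂ Fin.succ (monomialVec (y :: l).length x) =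
        x.2 • monomialVec l.length x := by
      ext k
      have : l.length + 1 - ((k : ℕ) + 1) = l.length - k := by omega
      simp [LinearMap.funLeft, monomialVec, this, pow_succ]
      ring
    simp only [LinearMap.sub_apply, LinearMap.smul_apply, LinearMap.comp_apply, h1, h2, map_smul,
      hφ, smul_eq_mul, List.map_cons, List.prod_cons]
    ring

theorem exists_dual_monomialVec_prod {ι : Type*} (s : Finset ι) {d : ℕ} (hd : s.card = d)
    (x : ι → ℂ × ℂ) : ∃ φ : Module.Dual ℂ (Fin (d + 1) → ℂ), ∀ y : ℂ × ℂ,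
      φ (monomialVec d y) = ∏ i ∈ s, (y.1 * (x i).2 - y.2 * (x i).1) := by
  subst hd
  have := exists_dual_monomialVec (s.toList.map x)
  rw [List.length_map, Finset.length_toList] at this
  obtain ⟨φ, hφ⟩ := this
  refine ⟨φ, fun y => ?_⟩
  rw [hφ, List.map_map, ← Finset.prod_map_toList]
  rfl

/-- The parametrization `x ↦ ∑ a, c a * ∏ b ≠ a, (x, x b) • e a` of a rational normal curve. -/
def lagrangeVec {ι V : Type*} [Fintype ι] [DecidableEq ι] [AddCommGroup V] [Module ℂ V]
    (x : ι → ℂ × ℂ) (c : ι → ℂ) (e : ι → V) (y : ℂ × ℂ) : V :=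
  ∑ a, (c a * ∏ b ∈ Finset.univ.erase a, (y.1 * (x b).2 - y.2 * (x b).1)) • e a

theorem lagrangeVec_node {ι V : Type*} [Fintype ι] [DecidableEq ι] [AddCommGroup V] [Module ℂ V]
    (x : ι → ℂ × ℂ) (c : ι → ℂ) (e : ι → V) (a : ι) :
    lagrangeVec x c e (x a) = (c a * ∏ b ∈ Finset.univ.erase a,
      ((x a).1 * (x b).2 - (x a).2 * (x b).1)) • e a := by
  refine Finset.sum_eq_single_of_mem a (Finset.mem_univ a) fun b _ hb => ?_
  rw [Finset.prod_eq_zero (i := a) (by simpa using hb.symm) (by ring), mul_zero, zero_smul]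

/-- The coordinates of the curve at `y` are proportional to `c a` divided by the pairing of `y` with
`x a`. So a further point can be prescribed on the curve by the choice of the weights `c`. -/
theorem lagrangeVec_eq_smul {ι V : Type*} [Fintype ι] [DecidableEq ι] [AddCommGroup V]
    [Module ℂ V] (x : ι → ℂ × ℂ) (c : ι → ℂ) (e : ι → V) (y : ℂ × ℂ) (r : ι → ℂ)
    (hr : ∀ a, c a = r a * (y.1 * (x a).2 - y.2 * (x a).1)) :
    lagrangeVec x c e y = (∏ b, (y.1 * (x b).2 - y.2 * (x b).1)) • ∑ a, r a • e a := by
  rw [lagrangeVec, Finset.smul_sum]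
  refine Finset.sum_congr rfl fun a _ => ?_
  rw [smul_smul, hr, mul_assoc, Finset.mul_prod_erase Finset.univ
    (fun b => y.1 * (x b).2 - y.2 * (x b).1) (Finset.mem_univ a), mul_comm]

/-- The coordinates of `lagrangeVec` are forms of degree `d` in the parameters, hence linear in the
monomials. The linear map is onto because each node goes to a nonzero multiple of a basis vector. -/
theorem exists_linearEquiv_monomialVec {d : ℕ} {V : Type*} [AddCommGroup V] [Module ℂ V]
    (E : Module.Basis (Fin (d + 1)) ℂ V) (x : Fin (d + 1) → ℂ × ℂ)
    (hx : ∀ a b, a ≠ b → (x a).1 * (x b).2 - (x a).2 * (x b).1 ≠ 0)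
    (c : Fin (d + 1) → ℂ) (hc : ∀ a, c a ≠ 0) :
    ∃ g : (Fin (d + 1) → ℂ) ≃ₗ[ℂ] V, ∀ y, g (monomialVec d y) = lagrangeVec x c E y := by
  have := fun a : Fin (d + 1) =>
    exists_dual_monomialVec_prod (Finset.univ.erase a) (d := d) (by simp) x
  choose φ hφ using this
  set g : (Fin (d + 1) → ℂ) →ₗ[ℂ] V := ∑ a, (c a • φ a).smulRight (E a) with hg
  have hgy : ∀ y, g (monomialVec d y) = lagrangeVec x c E y := by
    intro y
    simp [hg, lagrangeVec, hφ, LinearMap.sum_apply]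
  have hfin : Module.finrank ℂ (Fin (d + 1) → ℂ) = Module.finrank ℂ V := by
    rw [Module.finrank_eq_card_basis E]
    simp
  have : Module.Finite ℂ V := Module.Finite.of_basis E
  have hsurj : Function.Surjective g := by
    rw [← LinearMap.range_eq_top, ← top_le_iff, ← E.span_eq, Submodule.span_le]
    rintro _ ⟨a, rfl⟩
    have h0 : c a * ∏ b ∈ Finset.univ.erase a, ((x a).1 * (x b).2 - (x a).2 * (x b).1) ≠ 0 :=
      mul_ne_zero (hc a) (Finset.prod_ne_zero_iff.2 fun b hb => hx a b (Finset.ne_of_mem_erase hb).symm)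
    refine ⟨(c a * ∏ b ∈ Finset.univ.erase a, ((x a).1 * (x b).2 - (x a).2 * (x b).1))⁻¹ •
      monomialVec d (x a), ?_⟩
    rw [map_smul, hgy, lagrangeVec_node, smul_smul, inv_mul_cancel₀ h0, one_smul]
  exact ⟨LinearEquiv.ofBijective g
    ⟨(LinearMap.injective_iff_surjective_of_finrank_eq_finrank hfin).2 hsurj, hsurj⟩, hgy⟩

/-- Points with pairwise different parameters on a rational normal curve. -/
theorem mem_of_parameters {d n : ℕ} (hn : 2 ≤ n) (g : (Fin (d + 1) → ℂ) ≃ₗ[ℂ] (Fin (d + 1) → ℂ))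
    (hd : 1 ≤ d) (x : Fin n → ℂ × ℂ) (hx : ∀ a b, a ≠ b → (x a).1 * (x b).2 - (x a).2 * (x b).1 ≠ 0)
    (u : Fin n → (Fin (d + 1) → ℂ)) (κ : Fin n → ℂ) (h : ∀ a, g (monomialVec d (x a)) = κ a • u a) :
    ∃ hu : ∀ a, u a ≠ 0, (fun a => Projectivization.mk ℂ (u a) (hu a)) ∈
      {P : Fin n → PSpace d | Function.Injective P ∧
        ∃ R, IsRationalNormalCurve R ∧ ∀ i, P i ∈ R} := by
  -- The `d`-th power of the linear form with zero `x b` is linear in the monomials. It shows both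
  -- that the vectors are nonzero and that different parameters give different points.
  have hsep : ∀ b : Fin n, ∃ φ : Module.Dual ℂ (Fin (d + 1) → ℂ), ∀ y : ℂ × ℂ,
      φ (monomialVec d y) = (y.1 * (x b).2 - y.2 * (x b).1) ^ d := fun b => by
    obtain ⟨φ, hφ⟩ := exists_dual_monomialVec_prod (Finset.univ : Finset (Fin d)) (d := d)
      (by simp) (fun _ => x b)
    exact ⟨φ, fun y => by rw [hφ]; simp⟩
  have hne : ∀ a, monomialVec d (x a) ≠ 0 := fun a h0 => by
    obtain ⟨b, hb⟩ : ∃ b : Fin n, a ≠ b := by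
      have : Nontrivial (Fin n) := Fin.nontrivial_iff_two_le.2 hn
      obtain ⟨b, hb⟩ := exists_ne a
      exact ⟨b, hb.symm⟩
    obtain ⟨φ, hφ⟩ := hsep b
    have := hφ (x a)
    rw [h0, map_zero] at this
    exact pow_ne_zero d (hx a b hb) this.symm
  have hκu : ∀ a, κ a • u a ≠ 0 := fun a => by
    rw [← h a]
    exact (LinearEquiv.map_ne_zero_iff g).2 (hne a)
  have hu : ∀ a, u a ≠ 0 := fun a h0 => hκu a (by rw [h0, smul_zero])
  have hκ : ∀ a, κ a ≠ 0 := fun a h0 => hκu a (by rw [h0, zero_smul])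
  have hmk : ∀ a, Projectivization.mk ℂ (u a) (hu a) =
      Projectivization.map g.toLinearMap g.injective (Projectivization.mk ℂ _ (hne a)) := by
    intro a
    rw [Projectivization.map_mk, eq_comm, Projectivization.mk_eq_mk_iff']
    exact ⟨κ a, (h a).symm⟩
  refine ⟨hu, ?_, _, ⟨g, rfl⟩, fun a => ⟨_, ⟨(x a).1, (x a).2, hne a, rfl⟩, (hmk a).symm⟩⟩
  intro a b hab
  by_contra hne'
  dsimp only at hab
  rw [hmk, hmk] at hab
  have hab := Projectivization.map_injective _ _ hab
  rw [Projectivization.mk_eq_mk_iff'] at hab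
  obtain ⟨r, hr⟩ := hab
  obtain ⟨φ, hφ⟩ := hsep b
  have h1 := hφ (x a)
  rw [← hr, map_smul, hφ, show (x b).1 * (x b).2 - (x b).2 * (x b).1 = 0 by ring,
    zero_pow (by omega), smul_zero] at h1
  exact pow_ne_zero d (hx a b hne') h1.symm

/-! ### The ordinary topology is finer than the Zariski topology -/

theorem eval_smul_of_isWeightedHomogeneous {n N : ℕ} {f : MvPolynomial (Fin n × Fin N) ℂ}
    {e : Fin n → ℕ} (hf : f.IsWeightedHomogeneous (fun x => Pi.single x.1 (1 : ℕ)) e)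
    (κ : Fin n → ℂ) (v : Fin n → (Fin N → ℂ)) :
    MvPolynomial.eval (fun x => κ x.1 * v x.1 x.2) f =
      (∏ i, κ i ^ e i) * MvPolynomial.eval (fun x => v x.1 x.2) f := by
  rw [MvPolynomial.eval_eq, MvPolynomial.eval_eq, Finset.mul_sum]
  refine Finset.sum_congr rfl fun m hm => ?_
  have hw := hf (MvPolynomial.mem_support_iff.1 hm)
  have : ∏ i, κ i ^ e i = ∏ x ∈ m.support, κ x.1 ^ m x := by
    rw [← hw, Finsupp.weight_apply, Finsupp.sum]
    simp only [Finset.sum_apply, Pi.smul_apply, ← Finset.prod_pow_eq_pow_sum]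
    rw [Finset.prod_comm]
    refine Finset.prod_congr rfl fun x _ => ?_
    rw [Finset.prod_eq_single x.1]
    · simp
    · intro i _ hi
      simp [hi]
    · simp
  rw [this]
  simp only [mul_pow, Finset.prod_mul_distrib]
  ring

/-- Changing representatives multiplies a multihomogeneous polynomial by a nonzero factor, so its
nonvanishing can be tested on any coordinates, where it is an open condition. -/
theorem continuous_mk_multiZariski (d n : ℕ) :
    @Continuous {v : Fin n → (Fin (d + 1) → ℂ) // ∀ a, v a ≠ 0} (Fin n → PSpace d) _
      (multiZariski d n) fun v a => Projectivization.mk ℂ (v.1 a) (v.2 a) := by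
  rw [continuous_generateFrom_iff]
  rintro _ ⟨e, f, hf, rfl⟩
  have : (fun (v : {v : Fin n → (Fin (d + 1) → ℂ) // ∀ a, v a ≠ 0}) a =>
      Projectivization.mk ℂ (v.1 a) (v.2 a)) ⁻¹'
      {P : Fin n → PSpace d | MvPolynomial.eval (fun x => (P x.1).rep x.2) f ≠ 0} =
      {v | MvPolynomial.eval (fun x => v.1 x.1 x.2) f ≠ 0} := by
    ext ⟨v, hv⟩
    simp only [Set.mem_preimage, Set.mem_ofPred_eq]
    choose κ hκ using fun a => Projectivization.exists_smul_eq_mk_rep ℂ (v a) (hv a)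
    have h1 : (fun x : Fin n × Fin (d + 1) => (Projectivization.mk ℂ (v x.1) (hv x.1)).rep x.2) =
        fun x => (κ x.1 : ℂ) * v x.1 x.2 := by
      ext x
      rw [← hκ]
      rfl
    rw [h1, eval_smul_of_isWeightedHomogeneous hf (fun i => (κ i : ℂ)), mul_ne_zero_iff, and_iff_right]
    exact Finset.prod_ne_zero_iff.2 fun i _ => pow_ne_zero _ (κ i).ne_zero
  rw [this]
  have hc : Continuous fun v : {v : Fin n → (Fin (d + 1) → ℂ) // ∀ a, v a ≠ 0} =>
      MvPolynomial.eval (fun x => v.1 x.1 x.2) f :=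
    (MvPolynomial.continuous_eval f).comp (continuous_pi fun x =>
      (continuous_apply x.2).comp ((continuous_apply x.1).comp continuous_subtype_val))
  exact isOpen_ne_fun hc continuous_const

/-- Allows Euclidean limits of coordinate vectors in place of Zariski closure. -/
theorem mem_veroneseCompactification_of_mem_closure {d n : ℕ} (v : Fin n → (Fin (d + 1) → ℂ))
    (hv : ∀ a, v a ≠ 0)
    (h : v ∈ closure {u | ∃ hu : ∀ a, u a ≠ 0, (fun a => Projectivization.mk ℂ (u a) (hu a)) ∈
      {P : Fin n → PSpace d | Function.Injective P ∧
        ∃ R, IsRationalNormalCurve R ∧ ∀ i, P i ∈ R}}) :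
    (fun a => Projectivization.mk ℂ (v a) (hv a)) ∈ veroneseCompactification d n := by
  let := multiZariski d n
  have h1 : (⟨v, hv⟩ : {v : Fin n → (Fin (d + 1) → ℂ) // ∀ a, v a ≠ 0}) ∈ closure
      ((fun v a => Projectivization.mk ℂ (v.1 a) (v.2 a)) ⁻¹' {P : Fin n → PSpace d |
        Function.Injective P ∧ ∃ R, IsRationalNormalCurve R ∧ ∀ i, P i ∈ R}) := by
    rw [closure_subtype]
    refine closure_mono ?_ h
    rintro u ⟨hu, hu'⟩
    exact ⟨⟨u, hu⟩, hu', rfl⟩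
  exact map_mem_closure (continuous_mk_multiZariski d n) h1 fun _ => id

/-! ### Perturbation to general position -/

theorem eventually_eval_ne_zero {p : Polynomial ℂ} (hp : p ≠ 0) :
    ∀ᶠ ε in 𝓝[≠] (0 : ℂ), p.eval ε ≠ 0 := by
  have hfin : {ε : ℂ | p.eval ε = 0}.Finite :=
    (Polynomial.rootSet_finite p ℂ).subset fun ε hε => by
      rw [Polynomial.mem_rootSet]
      exact ⟨hp, by simpa using hε⟩
  have h1 : ({ε : ℂ | p.eval ε = 0} \ {0})ᶜ ∈ 𝓝 (0 : ℂ) :=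
    (hfin.subset Set.sdiff_subset).isClosed.isOpen_compl.mem_nhds (by simp)
  filter_upwards [nhdsWithin_le_nhds h1, self_mem_nhdsWithin] with ε h2 h3 h4
  exact h2 ⟨h4, h3⟩

theorem eventually_quadratic_ne_zero (a b : ℂ) {c : ℂ} (hc : c ≠ 0) :
    ∀ᶠ ε in 𝓝[≠] (0 : ℂ), a + b * ε + c * ε ^ 2 ≠ 0 := by
  have hp : (Polynomial.C a + Polynomial.C b * Polynomial.X +
      Polynomial.C c * Polynomial.X ^ 2) ≠ 0 := fun h => hc (by
    simpa [Polynomial.coeff_X, Polynomial.coeff_C] using congr(Polynomial.coeff $h 2))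
  filter_upwards [eventually_eval_ne_zero hp] with ε h
  simpa using h

theorem eventually_linear_ne_zero (a : ℂ) {b : ℂ} (hb : b ≠ 0) :
    ∀ᶠ ε in 𝓝[≠] (0 : ℂ), a + b * ε ≠ 0 := by
  have hp : (Polynomial.C a + Polynomial.C b * Polynomial.X) ≠ 0 := fun h => hb (by
    simpa [Polynomial.coeff_X, Polynomial.coeff_C] using congr(Polynomial.coeff $h 1))
  filter_upwards [eventually_eval_ne_zero hp] with ε h
  simpa using h

/-- The two roots have product `c / a`, so the smaller one satisfies the bound. -/
theorem exists_quadratic_root_norm_le {a : ℂ} (ha : a ≠ 0) (b c : ℂ) :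
    ∃ τ : ℂ, a * τ ^ 2 + b * τ + c = 0 ∧ ‖τ‖ ^ 2 ≤ ‖c / a‖ := by
  obtain ⟨τ, hτ⟩ := exists_quadratic_eq_zero (b := b) (c := c) ha (IsAlgClosed.exists_pow_nat_eq
    (discrim a b c) (n := 2) (by norm_num) |>.imp fun z hz => by rw [← hz, sq])
  have hτ' : a * τ ^ 2 + b * τ + c = 0 := by linear_combination hτ
  by_cases h : ‖τ‖ ^ 2 ≤ ‖c / a‖
  · exact ⟨τ, hτ', h⟩
  · have hb : -b / a * a = -b := div_mul_cancel₀ _ ha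
    have hprod : τ * (-b / a - τ) = c / a := by
      rw [eq_div_iff ha]
      linear_combination τ * hb - hτ'
    refine ⟨-b / a - τ, by linear_combination hτ' + (-b / a - 2 * τ) * hb, ?_⟩
    rw [← hprod, norm_mul] at h ⊢
    rw [sq]
    refine mul_le_mul_of_nonneg_right (not_lt.1 fun hlt => h ?_) (norm_nonneg _)
    rw [sq]
    exact mul_le_mul_of_nonneg_left hlt.le (norm_nonneg _)

/-- Every point of a conic is near to a point of any nearby conic. -/
theorem eventually_exists_near_triangleForm {α β γ : ℂ} (h0 : ¬ (α = 0 ∧ β = 0 ∧ γ = 0))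
    {w : Fin 3 → ℂ} (hw : triangleForm α β γ w = 0) {δ : ℝ} (hδ : 0 < δ) :
    ∀ᶠ ε in 𝓝[≠] (0 : ℂ), ∃ w', triangleForm (α + ε) (β + ε) (γ + ε) w' = 0 ∧ dist w w' < δ := by
  -- The point `w` is moved in a direction `u` off the conic. The perturbed form at `w + τ • u` is
  -- quadratic in `τ`; its constant term tends to zero and its leading coefficient does not, so it
  -- has a small root.
  obtain ⟨u, hu⟩ := DFunLike.ne_iff.1 (triangleForm_ne_zero h0)
  simp only [zero_apply] at hu
  have hcont : ∀ x : Fin 3 → ℂ,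
      Continuous fun ε : ℂ => triangleForm (α + ε) (β + ε) (γ + ε) x := fun x => by
    simp only [triangleForm_apply]
    fun_prop
  have hlim : Filter.Tendsto (fun ε : ℂ => ‖triangleForm (α + ε) (β + ε) (γ + ε) w /
      triangleForm (α + ε) (β + ε) (γ + ε) u‖) (𝓝 0) (𝓝 0) := by
    have h1 := (((hcont w).tendsto 0).div ((hcont u).tendsto 0) (by simpa using hu)).norm
    simpa [hw] using h1
  have hη : 0 < δ / (‖u‖ + 1) := by positivity
  have h1 := hlim.eventually_lt_const (show (0 : ℝ) < (δ / (‖u‖ + 1)) ^ 2 by positivity)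
  have h2 := ((hcont u).tendsto 0).eventually_ne (by simpa using hu : _ ≠ (0 : ℂ))
  refine nhdsWithin_le_nhds ?_
  filter_upwards [h1, h2] with ε h3 h4
  obtain ⟨τ, hτ, hτ'⟩ := exists_quadratic_root_norm_le h4
    (QuadraticMap.polar (triangleForm (α + ε) (β + ε) (γ + ε)) w u)
    (triangleForm (α + ε) (β + ε) (γ + ε) w)
  refine ⟨w + τ • u, ?_, ?_⟩
  · rw [QuadraticMap.map_add (triangleForm (α + ε) (β + ε) (γ + ε)), QuadraticMap.map_smul,
      QuadraticMap.polar_smul_right, smul_eq_mul, smul_eq_mul]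
    linear_combination hτ
  · rw [dist_eq_norm, sub_add_cancel_left, norm_neg, norm_smul]
    have h5 : ‖τ‖ < δ / (‖u‖ + 1) :=
      lt_of_pow_lt_pow_left₀ 2 hη.le (hτ'.trans_lt h3)
    rw [lt_div_iff₀ (by positivity)] at h5
    nlinarith [norm_nonneg τ, norm_nonneg u]

/-- A parametrization of the conic `α y z + β x z + γ x y = 0`. -/
def conicPoint (α β γ μ : ℂ) (x : ℂ × ℂ) : Fin 3 → ℂ :=
  ![α * (μ * (x.2 * (x.1 + x.2))), β * (μ * (x.1 * (x.1 + x.2))), γ * (-(μ * (x.1 * x.2)))]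

/-- After division of the coordinates by `α`, `β`, `γ`, the equation says that their reciprocals add
up to zero where these exist; `x.1`, `x.2`, `-(x.1 + x.2)` are such reciprocals up to a factor. The
case `X + Y = 0` forces `X = Y = 0`, which is covered by the parameter `(1, -1)`. -/
theorem exists_conicPoint {α β γ : ℂ} (hα : α ≠ 0) (hβ : β ≠ 0) (hγ : γ ≠ 0) {w : Fin 3 → ℂ}
    (hw : triangleForm α β γ w = 0) : ∃ μ x, w = conicPoint α β γ μ x := by
  rw [triangleForm_apply] at hw
  obtain ⟨X, hX⟩ : ∃ X, w 0 = α * X := ⟨w 0 / α, by field_simp⟩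
  obtain ⟨Y, hY⟩ : ∃ Y, w 1 = β * Y := ⟨w 1 / β, by field_simp⟩
  obtain ⟨Z, hZ⟩ : ∃ Z, w 2 = γ * Z := ⟨w 2 / γ, by field_simp⟩
  have hXYZ : Y * Z + X * Z + X * Y = 0 := by
    rw [hX, hY, hZ] at hw
    have : α * β * γ * (Y * Z + X * Z + X * Y) = 0 := by linear_combination hw
    simpa [hα, hβ, hγ] using this
  by_cases h : X + Y = 0
  · have hX0 : X = 0 := by
      have : X ^ 2 = 0 := by linear_combination (Z + X) * h - hXYZ
      simpa using this
    have hY0 : Y = 0 := by simpa [hX0] using h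
    refine ⟨Z, (1, -1), ?_⟩
    ext i
    fin_cases i <;> simp [conicPoint, hX, hY, hZ, hX0, hY0]
  · refine ⟨(X + Y)⁻¹, (Y, X), ?_⟩
    have h' : Y + X ≠ 0 := by rwa [add_comm]
    ext i
    fin_cases i <;> simp only [conicPoint, Fin.zero_eta, Fin.mk_one, Fin.reduceFinMk,
      Matrix.cons_val, hX, hY, hZ]
    · rw [add_comm Y X]; field_simp
    · rw [add_comm Y X]; field_simp
    · field_simp
      linear_combination hXYZ

/-- The parameters of the three further points on the curve. -/
def specialParameter : Fin 3 → ℂ × ℂ := ![(0, 1), (1, 0), (1, -1)]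

/-- The triples of coordinates of three further points on a rational normal curve through the
`N` vertices of the coordinate simplex. -/
def generalTriples (N : ℕ) : Set (Fin N → (Fin 3 → ℂ)) :=
  {w | ∃ (α β γ : ℂ) (μ : Fin N → ℂ) (x : Fin N → ℂ × ℂ), α ≠ 0 ∧ β ≠ 0 ∧ γ ≠ 0 ∧
    (∀ a, μ a ≠ 0 ∧ (x a).1 ≠ 0 ∧ (x a).2 ≠ 0 ∧ (x a).1 + (x a).2 ≠ 0) ∧
    (∀ a b, a ≠ b → (x a).1 * (x b).2 - (x a).2 * (x b).1 ≠ 0) ∧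
    ∀ a, w a = conicPoint α β γ (μ a) (x a)}

theorem conicPoint_mem_closure_generalTriples {N : ℕ} {α β γ : ℂ} (hα : α ≠ 0) (hβ : β ≠ 0)
    (hγ : γ ≠ 0) (μ : Fin N → ℂ) (x : Fin N → ℂ × ℂ) :
    (fun a => conicPoint α β γ (μ a) (x a)) ∈ closure (generalTriples N) := by
  set μ' : ℂ → Fin N → ℂ := fun ε a => μ a + 1 * ε with hμ'
  -- The different directions `(1, a + 1)` make every polynomial in `ε` that must not vanish
  -- nonzero: the determinant of the `a`-th and `b`-th parameters has `ε ^ 2` coefficient `b - a`,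
  -- and the coordinate sum has `ε` coefficient `a + 2`.
  set x' : ℂ → Fin N → ℂ × ℂ :=
    fun ε a => ((x a).1 + 1 * ε, (x a).2 + ((a : ℕ) + 1 : ℂ) * ε) with hx'
  have hcont : Continuous fun (ε : ℂ) (a : Fin N) => conicPoint α β γ (μ' ε a) (x' ε a) := by
    refine continuous_pi fun a => continuous_pi fun i => ?_
    fin_cases i <;> simp [conicPoint, hμ', hx'] <;> fun_prop
  have hlim := (hcont.tendsto 0).mono_left (nhdsWithin_le_nhds (s := {0}ᶜ))
  have h0 : (fun a => conicPoint α β γ (μ' 0 a) (x' 0 a)) =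
      fun a => conicPoint α β γ (μ a) (x a) := by
    simp [hμ', hx']
  rw [h0] at hlim
  refine mem_closure_of_tendsto hlim ?_
  have h1 : ∀ᶠ ε in 𝓝[≠] (0 : ℂ), ∀ a, μ' ε a ≠ 0 ∧ (x' ε a).1 ≠ 0 ∧ (x' ε a).2 ≠ 0 ∧
      (x' ε a).1 + (x' ε a).2 ≠ 0 := by
    refine Filter.eventually_all.2 fun a => ?_
    have e1 : ((a : ℕ) + 1 : ℂ) ≠ 0 := by exact_mod_cast (a : ℕ).succ_ne_zero
    have e2 : ((a : ℕ) + 2 : ℂ) ≠ 0 := by exact_mod_cast (by omega : (a : ℕ) + 2 ≠ 0)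
    filter_upwards [eventually_linear_ne_zero (μ a) one_ne_zero,
      eventually_linear_ne_zero (x a).1 one_ne_zero, eventually_linear_ne_zero (x a).2 e1,
      eventually_linear_ne_zero ((x a).1 + (x a).2) e2] with ε h1 h2 h3 h4
    refine ⟨h1, h2, h3, fun h => h4 ?_⟩
    simp only [hx'] at h
    linear_combination h
  have h2 : ∀ᶠ ε in 𝓝[≠] (0 : ℂ), ∀ a b, a ≠ b →
      (x' ε a).1 * (x' ε b).2 - (x' ε a).2 * (x' ε b).1 ≠ 0 := by
    refine Filter.eventually_all.2 fun a => Filter.eventually_all.2 fun b => ?_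
    by_cases hab : a = b
    · simp [hab]
    have e : ((b : ℕ) - (a : ℕ) : ℂ) ≠ 0 := by
      rw [sub_ne_zero]
      exact_mod_cast fun h : (b : ℕ) = (a : ℕ) => hab (Fin.ext h.symm)
    filter_upwards [eventually_quadratic_ne_zero ((x a).1 * (x b).2 - (x a).2 * (x b).1)
      ((x a).1 * ((b : ℕ) + 1) + (x b).2 - (x a).2 - ((a : ℕ) + 1) * (x b).1) e] with ε h1 _ h
    apply h1
    simp only [hx'] at h
    linear_combination h
  filter_upwards [h1, h2] with ε h3 h4
  exact ⟨α, β, γ, μ' ε, x' ε, hα, hβ, hγ, h3, h4, fun a => rfl⟩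

/-- Two approximations in succession: first the conic is perturbed to one with nonzero coefficients
and the points are moved onto it, then the parameters on that conic are made generic. -/
theorem mem_closure_generalTriples {N : ℕ} {α β γ : ℂ} (h0 : ¬ (α = 0 ∧ β = 0 ∧ γ = 0))
    {w : Fin N → (Fin 3 → ℂ)} (hw : ∀ a, triangleForm α β γ (w a) = 0) :
    w ∈ closure (generalTriples N) := by
  rw [← closure_closure, Metric.mem_closure_iff]
  intro δ hδ
  have h1 := Filter.eventually_all.2 fun a =>
    eventually_exists_near_triangleForm h0 (hw a) (half_pos hδ)
  obtain ⟨ε, h2, h3, h4, h5⟩ := (h1.and ((eventually_linear_ne_zero α one_ne_zero).and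
    ((eventually_linear_ne_zero β one_ne_zero).and
      (eventually_linear_ne_zero γ one_ne_zero)))).exists
  rw [one_mul] at h3 h4 h5
  choose w' hw' hd using h2
  choose μ x hμx using fun a => exists_conicPoint h3 h4 h5 (hw' a)
  refine ⟨w', ?_, lt_of_le_of_lt ((dist_pi_le_iff (half_pos hδ).le).2 fun a => (hd a).le)
    (half_lt_self hδ)⟩
  rw [funext hμx]
  exact conicPoint_mem_closure_generalTriples h3 h4 h5 μ x

/-- The parameters of the three further points. -/
theorem exists_special_parameter {ι : Type*} {α β γ : ℂ} (hα : α ≠ 0) (hβ : β ≠ 0) (hγ : γ ≠ 0)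
    {μ : ι → ℂ} {x : ι → ℂ × ℂ}
    (h : ∀ a, μ a ≠ 0 ∧ (x a).1 ≠ 0 ∧ (x a).2 ≠ 0 ∧ (x a).1 + (x a).2 ≠ 0) (m : Fin 3) :
    ∃ s : ℂ, s ≠ 0 ∧ (∀ a, μ a * ((x a).1 * (x a).2 * ((x a).1 + (x a).2)) =
      s * conicPoint α β γ (μ a) (x a) m * ((specialParameter m).1 * (x a).2 -
        (specialParameter m).2 * (x a).1)) ∧
      ∀ a, (specialParameter m).1 * (x a).2 - (specialParameter m).2 * (x a).1 ≠ 0 := by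
  have h8 : ∀ a, (x a).2 + (x a).1 ≠ 0 := fun a h' => (h a).2.2.2 (by linear_combination h')
  -- With `c = μ x.1 x.2 (x.1 + x.2)`, the coordinates of the conic point are `α c / x.1`, `β c /
  -- x.2` and `-γ c / (x.1 + x.2)`. Up to sign the denominators are the pairings of `x` with the
  -- three special parameters.
  fin_cases m
  · refine ⟨-α⁻¹, by simpa using hα, fun a => ?_, fun a => ?_⟩
    · simp [conicPoint, specialParameter]
      field_simp
    · simpa [specialParameter] using (h a).2.1
  · refine ⟨β⁻¹, by simpa using hβ, fun a => ?_, fun a => ?_⟩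
    · simp [conicPoint, specialParameter]
      field_simp
    · simpa [specialParameter] using (h a).2.2.1
  · refine ⟨-γ⁻¹, by simpa using hγ, fun a => ?_, fun a => ?_⟩
    · simp [conicPoint, specialParameter]
      field_simp
      ring
    · simpa [specialParameter] using h8 a

theorem specialParameter_ne {m l : Fin 3} (h : m ≠ l) :
    (specialParameter m).1 * (specialParameter l).2 -
      (specialParameter m).2 * (specialParameter l).1 ≠ 0 := by
  fin_cases m <;> fin_cases l <;> simp [specialParameter] at h ⊢

/-- The vectors of a basis, together with three vectors which are given by their coordinates. -/
def extendBasis {N n : ℕ} {V : Type*} [AddCommGroup V] [Module ℂ V]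
    (e : Fin N ⊕ Fin 3 ≃ Fin n) (E : Fin N → V) (w : Fin N → (Fin 3 → ℂ)) : Fin n → V :=
  fun b => Sum.elim E (fun m => ∑ a, w a m • E a) (e.symm b)

theorem extendBasis_mem {d n : ℕ} (hd : 1 ≤ d) (e : Fin (d + 1) ⊕ Fin 3 ≃ Fin n)
    (E : Module.Basis (Fin (d + 1)) ℂ (Fin (d + 1) → ℂ)) {w : Fin (d + 1) → (Fin 3 → ℂ)}
    (hw : w ∈ generalTriples (d + 1)) :
    extendBasis e E w ∈ {u | ∃ hu : ∀ a, u a ≠ 0,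
      (fun a => Projectivization.mk ℂ (u a) (hu a)) ∈ {P : Fin n → PSpace d |
        Function.Injective P ∧ ∃ R, IsRationalNormalCurve R ∧ ∀ i, P i ∈ R}} := by
  obtain ⟨α, β, γ, μ, x, hα, hβ, hγ, h1, h2, h3⟩ := hw
  have hn : 2 ≤ n := by
    have := Fintype.card_congr e
    simp at this
    omega
  -- With these weights the Lagrange curve passes through the basis vectors at the parameters `x a`
  -- and through the three further points at the special parameters.
  set c : Fin (d + 1) → ℂ := fun a => μ a * ((x a).1 * (x a).2 * ((x a).1 + (x a).2)) with hc
  have hc0 : ∀ a, c a ≠ 0 := fun a => by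
    obtain ⟨h4, h5, h6, h7⟩ := h1 a
    simp [hc, h4, h5, h6, h7]
  obtain ⟨g, hg⟩ := exists_linearEquiv_monomialVec E x h2 c hc0
  have hκ : ∀ i : Fin (d + 1) ⊕ Fin 3, ∃ κ : ℂ,
      g (monomialVec d (Sum.elim x specialParameter i)) =
        κ • Sum.elim E (fun m => ∑ a, w a m • E a) i := by
    rintro (a | m)
    · exact ⟨_, (hg _).trans (lagrangeVec_node x c E a)⟩
    · obtain ⟨s, -, hs, -⟩ := exists_special_parameter hα hβ hγ h1 m
      refine ⟨(∏ b, ((specialParameter m).1 * (x b).2 - (specialParameter m).2 * (x b).1)) * s,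
        (hg _).trans ((lagrangeVec_eq_smul x c E _ _ hs).trans ?_)⟩
      simp only [Sum.elim_inr, h3, mul_smul, ← Finset.smul_sum]
  choose κ hκ using hκ
  refine mem_of_parameters hn g hd (fun b => Sum.elim x specialParameter (e.symm b)) ?_ _
    (fun b => κ (e.symm b)) fun b => hκ _
  intro a b hab
  have hab' : e.symm a ≠ e.symm b := fun h => hab (e.symm.injective h)
  generalize e.symm a = i at hab' ⊢
  generalize e.symm b = j at hab' ⊢
  rcases i with a | m <;> rcases j with b | l
  · exact h2 a b fun h => hab' (by rw [h])
  · obtain ⟨s, -, -, h4⟩ := exists_special_parameter hα hβ hγ h1 l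
    exact fun h => h4 a (by simp at h; linear_combination -h)
  · obtain ⟨s, -, -, h4⟩ := exists_special_parameter hα hβ hγ h1 m
    exact h4 b
  · exact specialParameter_ne fun h => hab' (by rw [h])

/-- A configuration with the Gale dual on a conic is in the Veronese compactification. -/
theorem extendBasis_mem_veroneseCompactification {d n : ℕ} (hd : 1 ≤ d)
    (e : Fin (d + 1) ⊕ Fin 3 ≃ Fin n) (E : Module.Basis (Fin (d + 1)) ℂ (Fin (d + 1) → ℂ))
    {α β γ : ℂ} (h0 : ¬ (α = 0 ∧ β = 0 ∧ γ = 0)) {w : Fin (d + 1) → (Fin 3 → ℂ)}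
    (hw : ∀ a, triangleForm α β γ (w a) = 0) (hv : ∀ a, extendBasis e E w a ≠ 0) :
    (fun a => Projectivization.mk ℂ (extendBasis e E w a) (hv a)) ∈
      veroneseCompactification d n := by
  refine mem_veroneseCompactification_of_mem_closure _ hv ?_
  refine map_mem_closure (f := extendBasis e E) ?_ (mem_closure_generalTriples h0 hw)
    fun w' hw' => extendBasis_mem hd e E hw'
  refine continuous_pi fun b => ?_
  simp only [extendBasis]
  generalize e.symm b = i
  rcases i with a | m
  · exact continuous_const
  · simp only [Sum.elim_inr]
    fun_prop

/-! ### Forms as functions -/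

/-- Composition with `ψ`, as a homomorphism of algebras of functions. -/
def pullback {X Y : Type*} (ψ : X → Y) : (Y → ℂ) →ₐ[ℂ] (X → ℂ) :=
  AlgHom.pi fun x => Pi.evalAlgHom ℂ _ (ψ x)

@[simp]
theorem pullback_apply {X Y : Type*} (ψ : X → Y) (f : Y → ℂ) (x : X) :
    pullback ψ f x = f (ψ x) := rfl

/-- The linear forms on `V`, as functions. The forms of degree `m` are the members of
`linFun V ^ m`. -/
def linFun (V : Type*) [AddCommGroup V] [Module ℂ V] : Submodule ℂ (V → ℂ) :=
  LinearMap.range (LinearMap.ltoFun ℂ V ℂ ℂ)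

section

variable {V W : Type*} [AddCommGroup V] [Module ℂ V] [AddCommGroup W] [Module ℂ W]

theorem dual_mem_linFun (φ : Module.Dual ℂ V) : (φ : V → ℂ) ∈ linFun V := ⟨φ, rfl⟩

theorem apply_smul_of_mem_linFun_pow {m : ℕ} {f : V → ℂ} (hf : f ∈ linFun V ^ m) (c : ℂ) (v : V) :
    f (c • v) = c ^ m * f v := by
  induction m generalizing f with
  | zero =>
    rw [pow_zero, Submodule.mem_one] at hf
    obtain ⟨r, rfl⟩ := hf
    simp
  | succ m ih =>
    rw [pow_succ] at hf
    induction hf using Submodule.mul_induction_on' with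
    | mem_mul_mem f hf g hg =>
      obtain ⟨φ, rfl⟩ := hg
      simp only [Pi.mul_apply, ih hf, LinearMap.ltoFun_apply, map_smul, smul_eq_mul]
      ring
    | add f _ g _ hf hg =>
      rw [Pi.add_apply, Pi.add_apply, hf, hg, mul_add]

theorem pullback_mem_linFun_pow (π : W →ₗ[ℂ] V) {m : ℕ} {f : V → ℂ} (hf : f ∈ linFun V ^ m) :
    pullback π f ∈ linFun W ^ m := by
  have h1 : (linFun V).map (pullback π).toLinearMap ≤ linFun W := by
    rintro _ ⟨_, ⟨φ, rfl⟩, rfl⟩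
    exact ⟨φ ∘ₗ π, rfl⟩
  have h2 : pullback π f ∈ (linFun V ^ m).map (pullback π).toLinearMap := ⟨f, hf, rfl⟩
  rw [Submodule.map_pow] at h2
  exact (pow_le_pow_left' h1 m) h2

theorem exists_mem_linFun_pow_ne_zero {v : V} (hv : v ≠ 0) (m : ℕ) :
    ∃ f ∈ linFun V ^ m, f v ≠ 0 := by
  obtain ⟨φ, hφ⟩ : ∃ φ : Module.Dual ℂ V, φ v ≠ 0 := by
    by_contra! h
    exact hv ((Module.forall_dual_apply_eq_zero_iff ℂ v).1 h)
  exact ⟨(φ : V → ℂ) ^ m, Submodule.pow_mem_pow _ (dual_mem_linFun φ) m, pow_ne_zero m hφ⟩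

/-- The dimension of the space of the restrictions of the forms of degree `m` along `ψ`. -/
def hilb {X : Type*} (ψ : X → V) (m : ℕ) : ℕ :=
  Module.finrank ℂ ((linFun V ^ m).map (pullback ψ).toLinearMap)

theorem hilb_eq_pow {X : Type*} (ψ : X → V) (m : ℕ) :
    hilb ψ m = Module.finrank ℂ ↥((linFun V).map (pullback ψ).toLinearMap ^ m) := by
  rw [hilb, Submodule.map_pow]

instance finite_linFun_pow [Module.Finite ℂ V] (m : ℕ) : Module.Finite ℂ ↥(linFun V ^ m) := by
  have h : (linFun V).FG := by
    rw [linFun, LinearMap.range_eq_map]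
    exact (Module.Finite.fg_top (R := ℂ) (M := Module.Dual ℂ V)).map _
  exact Module.Finite.iff_fg.2 (h.pow m)

/-- The forms of degree `m` which vanish along `ψ`. -/
def vanishing {X : Type*} (ψ : X → V) (m : ℕ) : Submodule ℂ ↥(linFun V ^ m) :=
  LinearMap.ker ((pullback ψ).toLinearMap.domRestrict (linFun V ^ m))

theorem mem_vanishing {X : Type*} {ψ : X → V} {m : ℕ} {f : ↥(linFun V ^ m)} :
    f ∈ vanishing ψ m ↔ ∀ x, f.1 (ψ x) = 0 := by
  rw [vanishing, LinearMap.mem_ker]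
  exact funext_iff

theorem hilb_add_finrank_vanishing [Module.Finite ℂ V] {X : Type*} (ψ : X → V) (m : ℕ) :
    hilb ψ m + Module.finrank ℂ (vanishing ψ m) = Module.finrank ℂ ↥(linFun V ^ m) := by
  rw [← LinearMap.finrank_range_add_finrank_ker
    ((pullback ψ).toLinearMap.domRestrict (linFun V ^ m)), hilb, vanishing]
  rw [LinearMap.domRestrict, LinearMap.range_comp, Submodule.range_subtype]

theorem hilb_congr [Module.Finite ℂ V] {X Y : Type*} {ψ : X → V} {χ : Y → V} {m : ℕ}
    (h : ∀ f ∈ linFun V ^ m, (∀ x, f (ψ x) = 0) ↔ ∀ y, f (χ y) = 0) : hilb ψ m = hilb χ m := by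
  have h1 : vanishing ψ m = vanishing χ m := by
    ext f
    rw [mem_vanishing, mem_vanishing]
    exact h f.1 f.2
  have h2 := hilb_add_finrank_vanishing ψ m
  have h3 := hilb_add_finrank_vanishing χ m
  rw [h1] at h2
  omega

/-- The Hilbert function of a union of two sets, contained in linear subspaces which meet in the
line spanned by a common vector. -/
theorem hilb_union [Module.Finite ℂ V] {K₁ K₂ : Set V} {L₁ L₂ : Submodule ℂ V} {p : V} (hp : p ≠ 0)
    (h₁ : K₁ ⊆ L₁) (h₂ : K₂ ⊆ L₂) (hp₁ : p ∈ K₁) (hp₂ : p ∈ K₂) (hL : L₁ ⊓ L₂ ≤ ℂ ∙ p) (m : ℕ) :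
    hilb (Subtype.val : ↥(K₁ ∪ K₂) → V) m + 1 =
      hilb (Subtype.val : K₁ → V) m + hilb (Subtype.val : K₂ → V) m := by
  have hinf : vanishing (Subtype.val : ↥(K₁ ∪ K₂) → V) m =
      vanishing (Subtype.val : K₁ → V) m ⊓ vanishing (Subtype.val : K₂ → V) m := by
    ext f
    simp only [Submodule.mem_inf, mem_vanishing, Subtype.forall, Set.mem_union, or_imp, forall_and]
  -- A linear map which is the identity on `L₁` and collapses `L₂` to the common line: the
  -- projection to `L₁` along a complement containing a complement of `L₁ ⊓ L₂` in `L₂`.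
  obtain ⟨π, hπ₁, hπ₂⟩ : ∃ π : V →ₗ[ℂ] V, (∀ v ∈ L₁, π v = v) ∧ ∀ v ∈ L₂, π v ∈ ℂ ∙ p := by
    obtain ⟨M, hM⟩ := Submodule.exists_isCompl (L₁ ⊓ L₂)
    obtain ⟨N, hN1, hN2⟩ : ∃ N, L₂ ⊓ M ≤ N ∧ IsCompl L₁ N := by
      have hd : Disjoint L₁ (L₂ ⊓ M) := by
        rw [disjoint_iff, ← inf_assoc]
        exact hM.inf_eq_bot
      obtain ⟨N, hN⟩ := hd.symm.exists_isCompl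
      exact ⟨N, hN.1, hN.2.symm⟩
    refine ⟨L₁.projection N hN2, fun v hv =>
      Submodule.projection_apply_of_mem_left hN2 hv, fun v hv => ?_⟩
    have h1 := (L₁ ⊓ L₂).projection_apply_mem hM v
    have h2 := Submodule.sub_projection_mem hM v
    have h3 : v = (L₁ ⊓ L₂).projection M hM v + (v - (L₁ ⊓ L₂).projection M hM v) := by abel
    rw [h3, map_add, Submodule.projection_apply_of_mem_left hN2 h1.1,
      (Submodule.projection_apply_eq_zero_iff hN2).2
      (hN1 ⟨Submodule.sub_mem _ hv h1.2, h2⟩), add_zero]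
    exact hL h1
  have hsup : vanishing (Subtype.val : K₁ → V) m ⊔ vanishing (Subtype.val : K₂ → V) m =
      vanishing (fun _ : Unit => p) m := by
    refine le_antisymm (sup_le ?_ ?_) fun f hf => ?_
    · intro f hf
      rw [mem_vanishing] at hf ⊢
      exact fun _ => hf ⟨p, hp₁⟩
    · intro f hf
      rw [mem_vanishing] at hf ⊢
      exact fun _ => hf ⟨p, hp₂⟩
    · rw [mem_vanishing] at hf
      have hf := hf ()
      set g : ↥(linFun V ^ m) := ⟨pullback π f.1, pullback_mem_linFun_pow π f.2⟩ with hg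
      -- If `f` vanishes at `p`, then `f - f ∘ π` vanishes on `K₁` and `f ∘ π` on `K₂`. So the sum
      -- of the two vanishing spaces has codimension one, which is the `1` in the formula.
      have : f = (f - g) + g := by abel
      rw [this]
      refine Submodule.add_mem_sup (mem_vanishing.2 fun x => ?_) (mem_vanishing.2 fun x => ?_)
      · simp [hg, hπ₁ x.1 (h₁ x.2)]
      · obtain ⟨c, hc⟩ := Submodule.mem_span_singleton.1 (hπ₂ x.1 (h₂ x.2))
        simp only [hg, pullback_apply]
        rw [← hc, apply_smul_of_mem_linFun_pow f.2, hf, mul_zero]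
  have hone : hilb (fun _ : Unit => p) m = 1 := by
    obtain ⟨f, hf, hfp⟩ := exists_mem_linFun_pow_ne_zero hp m
    have : (linFun V ^ m).map (pullback fun _ : Unit => p).toLinearMap = ⊤ := by
      refine top_le_iff.1 fun g _ => ⟨(g () / f p) • f, Submodule.smul_mem _ _ hf, ?_⟩
      ext x
      simp [hfp]
    rw [hilb, this, finrank_top, Module.finrank_fintype_fun_eq_card, Fintype.card_unit]
  have e0 := hilb_add_finrank_vanishing (Subtype.val : ↥(K₁ ∪ K₂) → V) m
  have e1 := hilb_add_finrank_vanishing (Subtype.val : K₁ → V) m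
  have e2 := hilb_add_finrank_vanishing (Subtype.val : K₂ → V) m
  have e3 := hilb_add_finrank_vanishing (fun _ : Unit => p) m
  have e4 := Submodule.finrank_sup_add_finrank_inf_eq (vanishing (Subtype.val : K₁ → V) m)
    (vanishing (Subtype.val : K₂ → V) m)
  rw [hsup, ← hinf] at e4
  omega

end

/-! ### Binary forms -/

/-- In a product of `k + 1` factors, either some factor is taken from `Y` or all are from `Z`. This
bounds the dimension of binary forms and later isolates the pure power in `IsSeparated.sup_span`. -/
theorem sup_pow_succ_le {A : Type*} [CommRing A] [Algebra ℂ A] (Y Z : Submodule ℂ A) (k : ℕ) :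
    (Y ⊔ Z) ^ (k + 1) ≤ Y * (Y ⊔ Z) ^ k ⊔ Z ^ (k + 1) := by
  induction k with
  | zero => simp
  | succ k ih =>
    rw [pow_succ' (Y ⊔ Z) (k + 1), Submodule.sup_mul]
    refine sup_le le_sup_left ?_
    refine (mul_le_mul' le_rfl ih).trans ?_
    rw [Submodule.mul_sup, ← pow_succ']
    refine sup_le_sup_right ?_ _
    rw [mul_left_comm, pow_succ']
    exact mul_le_mul' le_rfl (mul_le_mul' le_sup_right le_rfl)

/-- The linear forms in two variables, as functions. -/
def binaryForms : Submodule ℂ (ℂ × ℂ → ℂ) := (ℂ ∙ Prod.fst) ⊔ (ℂ ∙ Prod.snd)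

theorem binaryForms_le : binaryForms ≤ linFun (ℂ × ℂ) := by
  rw [binaryForms, sup_le_iff, Submodule.span_singleton_le_iff_mem,
    Submodule.span_singleton_le_iff_mem]
  exact ⟨⟨LinearMap.fst ℂ ℂ ℂ, rfl⟩, ⟨LinearMap.snd ℂ ℂ ℂ, rfl⟩⟩

theorem fg_binaryForms_pow (k : ℕ) : (binaryForms ^ k).FG :=
  ((Submodule.fg_span_singleton _).sup (Submodule.fg_span_singleton _)).pow k

instance finite_binaryForms_pow (k : ℕ) : Module.Finite ℂ ↥(binaryForms ^ k) :=
  Module.Finite.iff_fg.2 (fg_binaryForms_pow k)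

theorem finrank_binaryForms_pow_le (k : ℕ) : Module.finrank ℂ ↥(binaryForms ^ k) ≤ k + 1 := by
  induction k with
  | zero =>
    rw [pow_zero, Submodule.one_eq_span]
    exact (finrank_span_le_card _).trans (by simp)
  | succ k ih =>
    have h1 := sup_pow_succ_le (ℂ ∙ (Prod.fst : ℂ × ℂ → ℂ)) (ℂ ∙ (Prod.snd : ℂ × ℂ → ℂ)) k
    change binaryForms ^ (k + 1) ≤ _ * binaryForms ^ k ⊔ _ at h1
    have h2 : (ℂ ∙ (Prod.fst : ℂ × ℂ → ℂ)) * binaryForms ^ k =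
        (binaryForms ^ k).map (LinearMap.mulLeft ℂ Prod.fst) := by
      ext f
      simp [Submodule.mem_span_singleton_mul]
    have h3 : (ℂ ∙ (Prod.snd : ℂ × ℂ → ℂ)) ^ (k + 1) = ℂ ∙ (Prod.snd ^ (k + 1)) := by
      rw [Submodule.span_pow, Set.singleton_pow]
    rw [h2, h3] at h1
    have : Module.Finite ℂ ↥((binaryForms ^ k).map (LinearMap.mulLeft ℂ Prod.fst)) :=
      Module.Finite.map _ _
    refine (Submodule.finrank_mono h1).trans ((Submodule.finrank_add_le_finrank_add_finrank _ _).trans ?_)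
    exact Nat.add_le_add ((Submodule.finrank_map_le _ _).trans ih) 
      ((finrank_span_le_card _).trans (by simp))

theorem linear_mem_binaryForms (x : ℂ × ℂ) :
    (fun y : ℂ × ℂ => y.1 * x.2 - y.2 * x.1) ∈ binaryForms := by
  have : (fun y : ℂ × ℂ => y.1 * x.2 - y.2 * x.1) = x.2 • Prod.fst + (-x.1) • Prod.snd := by
    ext y
    simp
    ring
  rw [this]
  exact Submodule.add_mem_sup (Submodule.smul_mem _ _ (Submodule.mem_span_singleton_self _))
    (Submodule.smul_mem _ _ (Submodule.mem_span_singleton_self _))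

theorem prod_mem_pow {A ι : Type*} [CommRing A] [Algebra ℂ A] {Y : Submodule ℂ A} (s : Finset ι)
    {f : ι → A} (hf : ∀ i ∈ s, f i ∈ Y) : ∏ i ∈ s, f i ∈ Y ^ s.card := by
  classical
  induction s using Finset.induction_on with
  | empty => simp [Submodule.one_le.1 le_rfl]
  | insert a s ha ih =>
    rw [Finset.prod_insert ha, Finset.card_insert_of_notMem ha, pow_succ']
    exact Submodule.mul_mem_mul (hf a (by simp)) (ih fun i hi => hf i (by simp [hi]))

/-- The members of the Lagrange basis. -/
def lagrangeFun {ι : Type*} [Fintype ι] [DecidableEq ι] (x : ι → ℂ × ℂ) (c : ι → ℂ) (a : ι) :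
    ℂ × ℂ → ℂ :=
  fun y => c a * ∏ b ∈ Finset.univ.erase a, (y.1 * (x b).2 - y.2 * (x b).1)

/-- Evaluation at the nodes shows independence, and the upper bound on the dimension of binary forms
does the rest. -/
theorem span_lagrangeFun {ι : Type*} [Fintype ι] [DecidableEq ι] {n : ℕ}
    (hn : Fintype.card ι = n + 1) (x : ι → ℂ × ℂ)
    (hx : ∀ a b, a ≠ b → (x a).1 * (x b).2 - (x a).2 * (x b).1 ≠ 0) (c : ι → ℂ)
    (hc : ∀ a, c a ≠ 0) : Submodule.span ℂ (Set.range (lagrangeFun x c)) = binaryForms ^ n ∧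
      Module.finrank ℂ ↥(binaryForms ^ n) = n + 1 := by
  have hle : Submodule.span ℂ (Set.range (lagrangeFun x c)) ≤ binaryForms ^ n := by
    rw [Submodule.span_le]
    rintro _ ⟨a, rfl⟩
    have h1 := prod_mem_pow (Finset.univ.erase a) fun b _ => linear_mem_binaryForms (x b)
    rw [Finset.card_erase_of_mem (Finset.mem_univ a), Finset.card_univ, hn,
      Nat.add_sub_cancel] at h1
    have e : lagrangeFun x c a =
        c a • ∏ b ∈ Finset.univ.erase a, fun y : ℂ × ℂ => y.1 * (x b).2 - y.2 * (x b).1 := by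
      ext y
      simp [lagrangeFun]
    rw [e]
    exact Submodule.smul_mem _ (c a) h1
  have hli : LinearIndependent ℂ (lagrangeFun x c) := by
    rw [Fintype.linearIndependent_iff]
    intro r hr a
    have h1 := congr_fun hr (x a)
    simp only [Finset.sum_apply, Pi.smul_apply, smul_eq_mul, Pi.zero_apply] at h1
    rw [Finset.sum_eq_single a] at h1
    · refine (mul_eq_zero.1 h1).resolve_right (mul_ne_zero (hc a) (Finset.prod_ne_zero_iff.2
        fun b hb => hx a b (Finset.ne_of_mem_erase hb).symm))
    · intro b _ hb
      rw [lagrangeFun, Finset.prod_eq_zero (i := a) (by simpa using hb.symm) (by ring), mul_zero,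
        mul_zero]
    · simp
  have h1 := finrank_span_eq_card hli
  have h2 := Submodule.finrank_mono hle
  have h3 := finrank_binaryForms_pow_le n
  exact ⟨Submodule.eq_of_le_of_finrank_le hle (by omega), by omega⟩

theorem finrank_binaryForms_pow (k : ℕ) : Module.finrank ℂ ↥(binaryForms ^ k) = k + 1 := by
  refine (span_lagrangeFun (ι := Fin (k + 1)) (by simp) (fun a => (1, (a : ℕ))) (fun a b hab => ?_)
    (fun _ => 1) fun _ => one_ne_zero).2
  simp only [one_mul, mul_one, ne_eq, sub_eq_zero]
  exact_mod_cast fun h : (b : ℕ) = (a : ℕ) => hab (Fin.ext h.symm)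

/-! ### Cones over connected curves of minimal degree -/

/-- `K` is the cone, without the vertex, over a connected set which spans the linear subspace `L`
and has the Hilbert function of a rational normal curve in `L`. -/
structure IsMinimalCone {d : ℕ} (L : Submodule ℂ (Fin (d + 1) → ℂ)) (K : Set (Fin (d + 1) → ℂ)) :
    Prop where
  ne_zero : ∀ v ∈ K, v ≠ 0
  smul_mem : ∀ c : ℂ, c ≠ 0 → ∀ v ∈ K, c • v ∈ K
  span_eq : Submodule.span ℂ K = L
  isConnected : @IsConnected _ (zariski d) {p : PSpace d | p.rep ∈ K}
  hilb_eq : ∀ m, hilb (Subtype.val : K → (Fin (d + 1) → ℂ)) m + m = Module.finrank ℂ L * m + 1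

theorem eval_smul_of_isHomogeneous {σ : Type*} {f : MvPolynomial σ ℂ} {m : ℕ}
    (hf : f.IsHomogeneous m) (c : ℂ) (v : σ → ℂ) :
    MvPolynomial.eval (c • v) f = c ^ m * MvPolynomial.eval v f := by
  rw [MvPolynomial.eval_eq, MvPolynomial.eval_eq, Finset.mul_sum]
  refine Finset.sum_congr rfl fun x hx => ?_
  simp only [Pi.smul_apply, smul_eq_mul, mul_pow, Finset.prod_mul_distrib,
    Finset.prod_pow_eq_pow_sum]
  rw [← hf.degree_eq_sum_deg_support hx]
  ring

theorem continuous_mk_zariski (d : ℕ) :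
    @Continuous {v : Fin (d + 1) → ℂ // v ≠ 0} (PSpace d) _ (zariski d) fun v =>
      Projectivization.mk ℂ v.1 v.2 := by
  rw [continuous_generateFrom_iff]
  rintro _ ⟨e, f, hf, rfl⟩
  have : (fun (v : {v : Fin (d + 1) → ℂ // v ≠ 0}) => Projectivization.mk ℂ v.1 v.2) ⁻¹'
      {p : PSpace d | MvPolynomial.eval p.rep f ≠ 0} = {v | MvPolynomial.eval v.1 f ≠ 0} := by
    ext ⟨v, hv⟩
    simp only [Set.mem_preimage, Set.mem_ofPred_eq]
    obtain ⟨κ, hκ⟩ := Projectivization.exists_smul_eq_mk_rep ℂ v hv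
    rw [← hκ, Units.smul_def, eval_smul_of_isHomogeneous hf, mul_ne_zero_iff, and_iff_right]
    exact pow_ne_zero _ κ.ne_zero
  rw [this]
  exact isOpen_ne_fun ((MvPolynomial.continuous_eval f).comp continuous_subtype_val)
    continuous_const

theorem rep_mem_iff {d : ℕ} {K : Set (Fin (d + 1) → ℂ)}
    (hK : ∀ c : ℂ, c ≠ 0 → ∀ v ∈ K, c • v ∈ K) {v : Fin (d + 1) → ℂ} (hv : v ≠ 0) :
    (Projectivization.mk ℂ v hv).rep ∈ K ↔ v ∈ K := by
  obtain ⟨κ, hκ⟩ := Projectivization.exists_smul_eq_mk_rep ℂ v hv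
  rw [← hκ]
  refine ⟨fun h => ?_, fun h => hK _ κ.ne_zero _ h⟩
  have := hK _ κ⁻¹.ne_zero _ h
  rwa [← Units.smul_def, inv_smul_smul] at this

theorem lagrangeVec_eq_sum {ι V : Type*} [Fintype ι] [DecidableEq ι] [AddCommGroup V] [Module ℂ V]
    (x : ι → ℂ × ℂ) (c : ι → ℂ) (e : ι → V) (y : ℂ × ℂ) :
    lagrangeVec x c e y = ∑ a, lagrangeFun x c a y • e a := rfl

theorem lagrangeVec_ne_zero {ι V : Type*} [Fintype ι] [DecidableEq ι] [Nonempty ι] [AddCommGroup V]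
    [Module ℂ V] {x : ι → ℂ × ℂ} (hx : ∀ a b, a ≠ b → (x a).1 * (x b).2 - (x a).2 * (x b).1 ≠ 0)
    {c : ι → ℂ} (hc : ∀ a, c a ≠ 0) {e : ι → V} (he : LinearIndependent ℂ e)
    {y : ℂ × ℂ} (hy : y ≠ 0) : lagrangeVec x c e y ≠ 0 := by
  intro h0
  have h1 : ∀ a, ∏ b ∈ Finset.univ.erase a, (y.1 * (x b).2 - y.2 * (x b).1) = 0 := fun a =>
    (mul_eq_zero.1 (Fintype.linearIndependent_iff.1 he _ h0 a)).resolve_left (hc a)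
  obtain ⟨a⟩ := ‹Nonempty ι›
  obtain ⟨b, -, hb⟩ := Finset.prod_eq_zero_iff.1 (h1 a)
  obtain ⟨b', hb', hb2⟩ := Finset.prod_eq_zero_iff.1 (h1 b)
  have hne := hx b b' (Finset.ne_of_mem_erase hb').symm
  apply hy
  have e1 : y.1 * ((x b).1 * (x b').2 - (x b).2 * (x b').1) = 0 := by
    linear_combination (x b).1 * hb2 - (x b').1 * hb
  have e2 : y.2 * ((x b).1 * (x b').2 - (x b).2 * (x b').1) = 0 := by
    linear_combination (x b).2 * hb2 - (x b').2 * hb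
  exact Prod.ext ((mul_eq_zero.1 e1).resolve_right hne) ((mul_eq_zero.1 e2).resolve_right hne)

/-- The cone over a rational normal curve. -/
theorem isMinimalCone_lagrangeVec {d : ℕ} {ι : Type*} [Fintype ι] [DecidableEq ι] [Nonempty ι]
    {x : ι → ℂ × ℂ} (hx : ∀ a b, a ≠ b → (x a).1 * (x b).2 - (x a).2 * (x b).1 ≠ 0)
    (hx0 : ∀ a, x a ≠ 0) {c : ι → ℂ} (hc : ∀ a, c a ≠ 0) {e : ι → (Fin (d + 1) → ℂ)}
    (he : LinearIndependent ℂ e) :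
    IsMinimalCone (Submodule.span ℂ (Set.range e))
      {v | ∃ (r : ℂ) (y : ℂ × ℂ), r ≠ 0 ∧ y ≠ 0 ∧ v = r • lagrangeVec x c e y} := by
  have hne : ∀ {y : ℂ × ℂ}, y ≠ 0 → lagrangeVec x c e y ≠ 0 := fun hy =>
    lagrangeVec_ne_zero hx hc he hy
  have hsmul : ∀ s : ℂ, s ≠ 0 → ∀ v ∈ {v | ∃ (r : ℂ) (y : ℂ × ℂ), r ≠ 0 ∧ y ≠ 0 ∧
      v = r • lagrangeVec x c e y}, s • v ∈ {v | ∃ (r : ℂ) (y : ℂ × ℂ), r ≠ 0 ∧ y ≠ 0 ∧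
      v = r • lagrangeVec x c e y} := by
    rintro s hs _ ⟨r, y, hr, hy, rfl⟩
    exact ⟨s * r, y, mul_ne_zero hs hr, hy, by rw [smul_smul]⟩
  refine ⟨?_, hsmul, ?_, ?_, fun m => ?_⟩
  · rintro _ ⟨r, y, hr, hy, rfl⟩
    exact smul_ne_zero hr (hne hy)
  · refine le_antisymm (Submodule.span_le.2 ?_) (Submodule.span_le.2 ?_)
    · rintro _ ⟨r, y, hr, hy, rfl⟩
      exact Submodule.smul_mem _ _ (Submodule.sum_mem _ fun a _ =>
        Submodule.smul_mem _ _ (Submodule.subset_span ⟨a, rfl⟩))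
    · rintro _ ⟨a, rfl⟩
      have h0 : c a * ∏ b ∈ Finset.univ.erase a, ((x a).1 * (x b).2 - (x a).2 * (x b).1) ≠ 0 :=
        mul_ne_zero (hc a) (Finset.prod_ne_zero_iff.2 fun b hb =>
          hx a b (Finset.ne_of_mem_erase hb).symm)
      refine Submodule.subset_span ⟨_, x a, inv_ne_zero h0, hx0 a, ?_⟩
      rw [lagrangeVec_node, smul_smul, inv_mul_cancel₀ h0, one_smul]
  -- Zariski connectedness follows from Euclidean connectedness of the punctured plane of
  -- parameters.
  · have hconn : IsConnected (Set.univ : Set {y : ℂ × ℂ // y ≠ 0}) := by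
      have h1 : IsConnected ({0}ᶜ : Set (ℂ × ℂ)) := by
        refine isConnected_compl_singleton_of_one_lt_rank ?_ 0
        rw [rank_prod', Complex.rank_real_complex]
        norm_num
      have : ConnectedSpace {y : ℂ × ℂ // y ≠ 0} := Subtype.connectedSpace h1
      exact isConnected_univ
    have hcont : Continuous fun y : {y : ℂ × ℂ // y ≠ 0} =>
        (⟨lagrangeVec x c e y.1, hne y.2⟩ : {v : Fin (d + 1) → ℂ // v ≠ 0}) := by
      refine Continuous.subtype_mk ?_ _
      unfold lagrangeVec
      fun_prop
    let := zariski d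
    have := hconn.image _ ((continuous_mk_zariski d).comp hcont).continuousOn
    convert this using 1
    ext p
    constructor
    · rintro ⟨r, y, hr, hy, hp⟩
      refine ⟨⟨y, hy⟩, trivial, ?_⟩
      rw [← Projectivization.mk_rep p]
      simp only [Function.comp]
      rw [Projectivization.mk_eq_mk_iff']
      exact ⟨r⁻¹, by rw [hp, smul_smul, inv_mul_cancel₀ hr, one_smul]⟩
    · rintro ⟨⟨y, hy⟩, -, rfl⟩
      exact (rep_mem_iff hsmul (hne hy)).2 ⟨1, y, one_ne_zero, hy, (one_smul _ _).symm⟩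
  -- Linear forms restrict onto all binary forms of degree `n`, so forms of degree `m` restrict onto
  -- those of degree `n * m`, a space of dimension `n * m + 1`.
  · obtain ⟨n, hn⟩ : ∃ n, Fintype.card ι = n + 1 :=
      Nat.exists_eq_succ_of_ne_zero Fintype.card_ne_zero
    have h2 : (linFun (Fin (d + 1) → ℂ)).map (pullback (lagrangeVec x c e)).toLinearMap =
        binaryForms ^ n := by
      rw [← (span_lagrangeFun hn x hx c hc).1]
      refine le_antisymm ?_ (Submodule.span_le.2 ?_)
      · rintro _ ⟨_, ⟨φ, rfl⟩, rfl⟩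
        have : (pullback (lagrangeVec x c e)).toLinearMap (LinearMap.ltoFun ℂ _ ℂ ℂ φ) =
            ∑ a, φ (e a) • lagrangeFun x c a := by
          ext y
          simp [lagrangeVec_eq_sum, mul_comm]
        rw [this]
        exact Submodule.sum_mem _ fun a _ => Submodule.smul_mem _ _ (Submodule.subset_span ⟨a, rfl⟩)
      · rintro _ ⟨a, rfl⟩
        obtain ⟨φ, hφ⟩ : ∃ φ : Module.Dual ℂ (Fin (d + 1) → ℂ), ∀ b, φ (e b) = if b = a then 1 else 0 := by
          obtain ⟨φ, hφ⟩ := LinearMap.exists_extend ((Module.Basis.span he).coord a)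
          refine ⟨φ, fun b => ?_⟩
          have h3 : φ (Module.Basis.span he b) =
              (Module.Basis.span he).coord a (Module.Basis.span he b) :=
            congr($hφ (Module.Basis.span he b))
          have h4 : (Module.Basis.span he b : Fin (d + 1) → ℂ) = e b := by
            rw [Module.Basis.span_apply]
          rw [← h4]
          refine h3.trans ?_
          simp [Finsupp.single_apply]
        refine ⟨φ, dual_mem_linFun φ, ?_⟩
        ext y
        simp [lagrangeVec_eq_sum, hφ]
    have h1 : hilb (Subtype.val : ↥{v | ∃ (r : ℂ) (y : ℂ × ℂ), r ≠ 0 ∧ y ≠ 0 ∧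
        v = r • lagrangeVec x c e y} → (Fin (d + 1) → ℂ)) m = hilb (lagrangeVec x c e) m := by
      refine hilb_congr fun f hf => ⟨fun h y => ?_, ?_⟩
      · have hmem : pullback (lagrangeVec x c e) f ∈ linFun (ℂ × ℂ) ^ (n * m) := by
          have h3 : pullback (lagrangeVec x c e) f ∈
              (linFun _ ^ m).map (pullback (lagrangeVec x c e)).toLinearMap := ⟨f, hf, rfl⟩
          rw [Submodule.map_pow, h2, ← pow_mul] at h3
          exact pow_le_pow_left' binaryForms_le _ h3
        -- The cone omits the parameter zero. There the value is `0 ^ (n * m)` times that at `(1,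
        -- 0)`, which is correct also when `n * m = 0`.
        by_cases hy : y = 0
        · have h3 := apply_smul_of_mem_linFun_pow hmem 0 (1, 0)
          have h4 : f (lagrangeVec x c e (1, 0)) = 0 :=
            h ⟨_, 1, (1, 0), one_ne_zero, by simp, (one_smul _ _).symm⟩
          rw [zero_smul, pullback_apply, pullback_apply, h4, mul_zero] at h3
          rw [hy, h3]
        · exact h ⟨_, 1, y, one_ne_zero, hy, (one_smul _ _).symm⟩
      · rintro h ⟨_, r, y, hr, hy, rfl⟩
        rw [apply_smul_of_mem_linFun_pow hf, h, mul_zero]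
    rw [h1, hilb_eq_pow, h2, ← pow_mul, finrank_binaryForms_pow, finrank_span_eq_card he, hn]
    ring

theorem IsMinimalCone.subset {d : ℕ} {L : Submodule ℂ (Fin (d + 1) → ℂ)}
    {K : Set (Fin (d + 1) → ℂ)} (h : IsMinimalCone L K) : K ⊆ L :=
  h.span_eq ▸ Submodule.subset_span

/-- Two cones over curves of minimal degree in linear subspaces which meet in a common point of the
curves. -/
theorem IsMinimalCone.union {d : ℕ} {L₁ L₂ : Submodule ℂ (Fin (d + 1) → ℂ)}
    {K₁ K₂ : Set (Fin (d + 1) → ℂ)} (h₁ : IsMinimalCone L₁ K₁) (h₂ : IsMinimalCone L₂ K₂)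
    {p : Fin (d + 1) → ℂ} (hp₁ : p ∈ K₁) (hp₂ : p ∈ K₂) (hL : L₁ ⊓ L₂ ≤ ℂ ∙ p) :
    IsMinimalCone (L₁ ⊔ L₂) (K₁ ∪ K₂) := by
  have hp := h₁.ne_zero p hp₁
  refine ⟨?_, ?_, ?_, ?_, fun m => ?_⟩
  · rintro v (hv | hv)
    exacts [h₁.ne_zero v hv, h₂.ne_zero v hv]
  · rintro c hc v (hv | hv)
    exacts [Or.inl (h₁.smul_mem c hc v hv), Or.inr (h₂.smul_mem c hc v hv)]
  · rw [Submodule.span_union, h₁.span_eq, h₂.span_eq]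
  · let := zariski d
    exact h₁.isConnected.union ⟨Projectivization.mk ℂ p hp, (rep_mem_iff h₁.smul_mem hp).2 hp₁,
      (rep_mem_iff h₂.smul_mem hp).2 hp₂⟩ h₂.isConnected
  · have e1 := hilb_union hp h₁.subset h₂.subset hp₁ hp₂ hL m
    have e2 := h₁.hilb_eq m
    have e3 := h₂.hilb_eq m
    have e4 := Submodule.finrank_sup_add_finrank_inf_eq L₁ L₂
    have e5 : L₁ ⊓ L₂ = ℂ ∙ p := le_antisymm hL (by
      rw [Submodule.span_singleton_le_iff_mem]
      exact ⟨h₁.subset hp₁, h₂.subset hp₂⟩)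
    rw [e5, finrank_span_singleton hp] at e4
    have e6 : (Module.finrank ℂ ↥(L₁ ⊔ L₂) + 1) * m =
        (Module.finrank ℂ L₁ + Module.finrank ℂ L₂) * m := by rw [e4]
    rw [add_mul, add_mul] at e6
    omega

theorem exists_isMinimalCone_point {d : ℕ} {p : Fin (d + 1) → ℂ} (hp : p ≠ 0) :
    ∃ K, IsMinimalCone (ℂ ∙ p) K ∧ p ∈ K := by
  have he : LinearIndependent ℂ (fun _ : Unit => p) :=
    linearIndependent_unique_iff.2 hp
  have h := isMinimalCone_lagrangeVec (x := fun _ : Unit => (1, 0)) (c := fun _ => 1)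
    (fun a b hab => (hab rfl).elim) (by simp) (by simp) he
  rw [Set.range_const] at h
  exact ⟨_, h, 1, (1, 0), one_ne_zero, by simp, by simp [lagrangeVec]⟩

/-- A Lagrange curve with two nodes; the weights `1` and `-1` make its value at `(s, t)` equal to `s
• p + t • q`. -/
theorem exists_isMinimalCone_line {d : ℕ} {p q : Fin (d + 1) → ℂ}
    (hpq : LinearIndependent ℂ ![p, q]) :
    ∃ K, IsMinimalCone (Submodule.span ℂ {p, q}) K ∧
      ∀ s t : ℂ, (s, t) ≠ 0 → s • p + t • q ∈ K := by
  have h := isMinimalCone_lagrangeVec (x := ![(1, 0), (0, 1)]) (c := ![1, -1])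
    (fun a b hab => by fin_cases a <;> fin_cases b <;> simp at hab ⊢)
    (fun a => by fin_cases a <;> simp) (fun a => by fin_cases a <;> simp) hpq
  rw [Matrix.range_cons_cons_empty] at h
  refine ⟨_, h, fun s t hst => ⟨1, (s, t), one_ne_zero, hst, ?_⟩⟩
  have h0 : (Finset.univ.erase 0 : Finset (Fin 2)) = {1} := by decide
  have h1 : (Finset.univ.erase 1 : Finset (Fin 2)) = {0} := by decide
  simp [lagrangeVec, h0, h1]

/-- Attaching a line to a curve of minimal degree. -/
theorem IsMinimalCone.attach_line {d : ℕ} {L : Submodule ℂ (Fin (d + 1) → ℂ)}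
    {K : Set (Fin (d + 1) → ℂ)} (h : IsMinimalCone L K) {p q : Fin (d + 1) → ℂ} (hp : p ∈ K)
    (hq : q ∉ L) : ∃ K', IsMinimalCone (L ⊔ ℂ ∙ q) K' ∧ K ⊆ K' ∧
      ∀ s t : ℂ, (s, t) ≠ 0 → s • p + t • q ∈ K' := by
  have hpL := h.subset hp
  have hp0 := h.ne_zero p hp
  have hpq : LinearIndependent ℂ ![p, q] := by
    rw [LinearIndependent.pair_iff' hp0]
    rintro a rfl
    exact hq (L.smul_mem a hpL)
  obtain ⟨K', hK', hmem⟩ := exists_isMinimalCone_line hpq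
  have h1 := h.union hK' hp (p := p) (by simpa using hmem 1 0 (by simp)) (by
    rintro v ⟨hv1, hv2⟩
    obtain ⟨a, b, rfl⟩ := Submodule.mem_span_pair.1 hv2
    have hb : b = 0 := by
      by_contra hb
      apply hq
      have := L.smul_mem b⁻¹ (L.sub_mem hv1 (L.smul_mem a hpL))
      rwa [add_sub_cancel_left, smul_smul, inv_mul_cancel₀ hb, one_smul] at this
    rw [hb, zero_smul, add_zero]
    exact Submodule.smul_mem _ _ (Submodule.mem_span_singleton_self p))
  have h2 : L ⊔ Submodule.span ℂ {p, q} = L ⊔ ℂ ∙ q := by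
    rw [Submodule.span_insert, ← sup_assoc,
      sup_eq_left.2 ((Submodule.span_singleton_le_iff_mem p L).2 hpL)]
  rw [h2] at h1
  exact ⟨_, h1, Set.subset_union_left, fun s t hst => Or.inr (hmem s t hst)⟩

/-! ### Curves of minimal degree through degenerate configurations -/

theorem span_insert_ne {ι V : Type*} [DecidableEq ι] [AddCommGroup V] [Module ℂ V] (e : ι → V)
    (b : ι) : Submodule.span ℂ (Set.range fun i : {i // i ≠ b} => e i) ⊔ ℂ ∙ e b =
      Submodule.span ℂ (Set.range e) := by
  rw [← Submodule.span_union]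
  congr 1
  ext v
  constructor
  · rintro (⟨i, rfl⟩ | rfl)
    exacts [⟨i, rfl⟩, ⟨b, rfl⟩]
  · rintro ⟨i, rfl⟩
    by_cases hi : i = b
    · exact Or.inr (by rw [hi]; rfl)
    · exact Or.inl ⟨⟨i, hi⟩, rfl⟩

theorem notMem_span_ne {ι V : Type*} [AddCommGroup V] [Module ℂ V] {e : ι → V}
    (he : LinearIndependent ℂ e) (b : ι) :
    e b ∉ Submodule.span ℂ (Set.range fun i : {i // i ≠ b} => e i) := by
  have := he.notMem_span_image (s := {i | i ≠ b}) (x := b) (by simp)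
  rwa [Set.image_eq_range] at this

theorem sum_eq_sum_ne_add {ι V : Type*} [Fintype ι] [DecidableEq ι] [AddCommGroup V] [Module ℂ V]
    (f : ι → V) (b : ι) : ∑ i, f i = ∑ i : {i // i ≠ b}, f i + f b := by
  rw [← Finset.sum_erase_add _ _ (Finset.mem_univ b)]
  congr 1
  exact Finset.sum_subtype _ (by simp) f

/-- A degenerate parameter would leave at most one nonzero coordinate, contrary to `h2`; equal
ratios of parameters would make two points proportional, contrary to `h1`. -/
theorem exists_conicPoint_pairwise {ι : Type*} {w : ι → (Fin 3 → ℂ)}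
    (hw : ∀ a, triangleForm 1 1 1 (w a) = 0) (h1 : ∀ a b, a ≠ b → ∀ κ : ℂ, w b ≠ κ • w a)
    (h2 : ∀ a m, ∃ l, l ≠ m ∧ w a l ≠ 0) :
    ∃ (μ : ι → ℂ) (x : ι → ℂ × ℂ),
      (∀ a, μ a ≠ 0 ∧ (x a).1 ≠ 0 ∧ (x a).2 ≠ 0 ∧ (x a).1 + (x a).2 ≠ 0) ∧
      (∀ a b, a ≠ b → (x a).1 * (x b).2 - (x a).2 * (x b).1 ≠ 0) ∧
      ∀ a, w a = conicPoint 1 1 1 (μ a) (x a) := by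
  choose μ x hμx using fun a => exists_conicPoint one_ne_zero one_ne_zero one_ne_zero (hw a)
  have h3 : ∀ a, μ a ≠ 0 ∧ (x a).1 ≠ 0 ∧ (x a).2 ≠ 0 ∧ (x a).1 + (x a).2 ≠ 0 := by
    intro a
    have key : ∀ m, (∀ l, l ≠ m → conicPoint 1 1 1 (μ a) (x a) l = 0) → False := fun m hm => by
      obtain ⟨l, hl, hl'⟩ := h2 a m
      exact hl' (by rw [hμx]; exact hm l hl)
    refine ⟨fun h => key 0 fun l hl => ?_, fun h => key 0 fun l hl => ?_, fun h => key 1 fun l hl => ?_,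
      fun h => key 2 fun l hl => ?_⟩
    all_goals fin_cases l <;> first | exact absurd rfl hl | simp [conicPoint, h]
  refine ⟨μ, x, h3, fun a b hab h => ?_, hμx⟩
  obtain ⟨h4, h5, h6, h7⟩ := h3 a
  refine h1 a b hab (μ b * (x b).1 ^ 2 / (μ a * (x a).1 ^ 2)) ?_
  have h8 : (x b).2 = (x a).2 * (x b).1 / (x a).1 := by
    field_simp
    linear_combination h
  rw [hμx a, hμx b]
  ext l
  fin_cases l <;> simp [conicPoint, h8] <;> field_simp

theorem linearIndependent_shear {ι V : Type*} [Fintype ι] [DecidableEq ι] [AddCommGroup V]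
    [Module ℂ V] {e : ι → V} (he : LinearIndependent ℂ e) (b : ι) {c : ι → ℂ} (hc : c b = 0) :
    LinearIndependent ℂ fun i => e i + c i • e b := by
  rw [Fintype.linearIndependent_iff] at he ⊢
  intro r hr
  have h1 : ∑ i, (r i + if i = b then ∑ j, r j * c j else 0) • e i = 0 := by
    rw [← hr]
    simp only [add_smul, smul_add, Finset.sum_add_distrib, ite_smul, zero_smul, smul_smul,
      Finset.sum_ite_eq', Finset.mem_univ, if_true, Finset.sum_smul]
  have h2 := he _ h1
  have h3 : ∀ i, i ≠ b → r i = 0 := fun i hi => by simpa [hi] using h2 i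
  intro i
  by_cases hi : i = b
  · subst hi
    have h4 := h2 i
    rw [if_pos rfl, Finset.sum_eq_zero, add_zero] at h4
    · exact h4
    · intro j _
      by_cases hj : j = i
      · rw [hj, hc, mul_zero]
      · rw [h3 j hj, zero_mul]
  · exact h3 i hi

theorem span_shear {ι V : Type*} [Fintype ι] [DecidableEq ι] [AddCommGroup V]
    [Module ℂ V] {e : ι → V} (he : LinearIndependent ℂ e) (b : ι) {c : ι → ℂ} (hc : c b = 0) :
    Submodule.span ℂ (Set.range fun i => e i + c i • e b) = Submodule.span ℂ (Set.range e) := by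
  have : FiniteDimensional ℂ (Submodule.span ℂ (Set.range e)) :=
    FiniteDimensional.span_of_finite ℂ (Set.finite_range e)
  refine Submodule.eq_of_le_of_finrank_eq (Submodule.span_le.2 ?_) ?_
  · rintro _ ⟨i, rfl⟩
    exact Submodule.add_mem _ (Submodule.subset_span ⟨i, rfl⟩)
      (Submodule.smul_mem _ _ (Submodule.subset_span ⟨b, rfl⟩))
  · rw [finrank_span_eq_card he, finrank_span_eq_card (linearIndependent_shear he b hc)]

/-- There is a curve of minimal degree through the vertices of a simplex and three further points
whose coordinates satisfy `y z + x z + x y = 0` (where zero vectors are ignored). -/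
theorem exists_isMinimalCone_of_triangleForm {d : ℕ} (n : ℕ) :
    ∀ (ι : Type) [Fintype ι] [DecidableEq ι], Fintype.card ι = n + 1 →
    ∀ (e : ι → (Fin (d + 1) → ℂ)), LinearIndependent ℂ e →
    ∀ (w : ι → (Fin 3 → ℂ)), (∀ a, triangleForm 1 1 1 (w a) = 0) →
    ∃ K, IsMinimalCone (Submodule.span ℂ (Set.range e)) K ∧ (∀ a, e a ∈ K) ∧
      ∀ m, ∑ a, w a m • e a ≠ 0 → ∑ a, w a m • e a ∈ K := by
  induction n with
  | zero =>
    intro ι _ _ hι e he w hw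
    obtain ⟨a, ha⟩ := Fintype.card_eq_one_iff.1 hι
    have : Unique ι := ⟨⟨a⟩, ha⟩
    obtain ⟨K, hK, haK⟩ := exists_isMinimalCone_point (he.ne_zero a)
    have hr : Set.range e = {e a} := by
      ext v
      constructor
      · rintro ⟨b, rfl⟩
        rw [ha b]
        rfl
      · rintro rfl
        exact ⟨a, rfl⟩
    rw [hr]
    refine ⟨K, hK, fun b => by rwa [ha b], fun m hm => ?_⟩
    rw [Fintype.sum_unique, Subsingleton.elim default a] at hm ⊢
    exact hK.smul_mem _ (fun h => hm (by rw [h, zero_smul])) _ haK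
  | succ n ih =>
    intro ι _ _ hι e he w hw
    have hcard : ∀ b : ι, Fintype.card {i // i ≠ b} = n + 1 := fun b => by
      rw [Fintype.card_subtype_compl, hι, Fintype.card_subtype_eq]
      omega
    -- If `w b = κ • w a`, the three further points involve `e a` and `e b` only through `e a + κ •
    -- e b`. The smaller problem is solved with this vector in place of `e a`, and the line joining
    -- it to `e b`, which contains `e a`, is attached.
    by_cases h1 : ∃ a b, a ≠ b ∧ ∃ κ : ℂ, w b = κ • w a
    · obtain ⟨a, b, hab, κ, hκ⟩ := h1
      set c : ι → ℂ := Pi.single a κ with hc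
      have hcb : c b = 0 := by simp [hc, hab.symm]
      have he' := linearIndependent_shear he b hcb
      obtain ⟨K, hK, heK, hwK⟩ := ih {i // i ≠ b} (hcard b) (fun i => e i + c i • e b)
        (he'.comp _ Subtype.val_injective) (fun i => w i) fun i => hw i
      have hq := notMem_span_ne he' b
      have hspan := span_insert_ne (fun i => e i + c i • e b) b
      rw [span_shear he b hcb] at hspan
      simp only [hcb, zero_smul, add_zero] at hq hspan
      obtain ⟨K', hK', hKK', hline⟩ := hK.attach_line (heK ⟨a, hab⟩) hq
      rw [hspan] at hK'
      refine ⟨K', hK', fun i => ?_, fun m hm => ?_⟩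
      · by_cases hi : i = b
        · subst hi
          simpa using hline 0 1 (by simp)
        · by_cases hia : i = a
          · subst hia
            have := hline 1 (-κ) (by simp)
            simpa [hc] using this
          · have := hKK' (heK ⟨i, hi⟩)
            simpa [hc, hia] using this
      · have hsum : ∑ i, w i m • e i = ∑ i : {i // i ≠ b}, w i m • (e i + c i • e b) := by
          rw [sum_eq_sum_ne_add _ b]
          simp only [smul_add, Finset.sum_add_distrib, smul_smul, ← Finset.sum_smul]
          congr 2
          rw [Finset.sum_eq_single ⟨a, hab⟩]
          · simp [hc, hκ, mul_comm]
          · intro i _ hi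
            have : (i : ι) ≠ a := fun h => hi (Subtype.ext h)
            simp [hc, this]
          · simp
        rw [hsum] at hm ⊢
        exact hKK' (hwK m hm)
    push Not at h1
    -- If at most the `m`-th coordinate of `w a` is nonzero, only the `m`-th point can involve `e
    -- a`. The line from `e a` to the projection of that point is attached; if the projection is
    -- zero, any point of the smaller curve will do.
    by_cases h2 : ∃ a m, ∀ l, l ≠ m → w a l = 0
    · obtain ⟨a, m, ham⟩ := h2
      obtain ⟨K, hK, heK, hwK⟩ := ih {i // i ≠ a} (hcard a) (fun i => e i)
        (he.comp _ Subtype.val_injective) (fun i => w i) fun i => hw i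
      have hq := notMem_span_ne he a
      obtain ⟨p, hp, s, hs⟩ : ∃ p ∈ K, ∃ s : ℂ, ∑ i : {i // i ≠ a}, w i m • e i = s • p := by
        by_cases h0 : ∑ i : {i // i ≠ a}, w i m • e i = 0
        · obtain ⟨i⟩ : Nonempty {i // i ≠ a} := Fintype.card_pos_iff.1 (by rw [hcard a]; omega)
          exact ⟨_, heK i, 0, by rw [h0, zero_smul]⟩
        · exact ⟨_, hwK m h0, 1, (one_smul _ _).symm⟩
      obtain ⟨K', hK', hKK', hline⟩ := hK.attach_line hp hq
      rw [span_insert_ne] at hK'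
      refine ⟨K', hK', fun i => ?_, fun l hl => ?_⟩
      · by_cases hi : i = a
        · subst hi
          simpa using hline 0 1 (by simp)
        · exact hKK' (heK ⟨i, hi⟩)
      · rw [sum_eq_sum_ne_add _ a] at hl ⊢
        by_cases hlm : l = m
        · subst hlm
          rw [hs] at hl ⊢
          refine hline _ _ fun h => hl ?_
          rw [Prod.mk_eq_zero] at h
          rw [h.1, h.2, zero_smul, zero_smul, add_zero]
        · rw [ham l hlm, zero_smul, add_zero] at hl ⊢
          exact hKK' (hwK l hl)
    push Not at h2
    -- In the remaining case the curve is an honest rational normal curve.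
    obtain ⟨μ, x, hμx, hx, hwx⟩ := exists_conicPoint_pairwise hw h1 h2
    set c : ι → ℂ := fun a => μ a * ((x a).1 * (x a).2 * ((x a).1 + (x a).2)) with hc
    have hc0 : ∀ a, c a ≠ 0 := fun a => by
      obtain ⟨h4, h5, h6, h7⟩ := hμx a
      simp [hc, h4, h5, h6, h7]
    have : Nonempty ι := Fintype.card_pos_iff.1 (by omega)
    have hK := isMinimalCone_lagrangeVec hx (fun a h => (hμx a).2.1 (by rw [h]; rfl)) hc0 he
    refine ⟨_, hK, fun a => ?_, fun m _ => ?_⟩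
    · have h0 : c a * ∏ b ∈ Finset.univ.erase a, ((x a).1 * (x b).2 - (x a).2 * (x b).1) ≠ 0 :=
        mul_ne_zero (hc0 a) (Finset.prod_ne_zero_iff.2 fun b hb =>
          hx a b (Finset.ne_of_mem_erase hb).symm)
      refine ⟨_, x a, inv_ne_zero h0, fun h => (hμx a).2.1 (by rw [h]; rfl), ?_⟩
      rw [lagrangeVec_node, smul_smul, inv_mul_cancel₀ h0, one_smul]
    · obtain ⟨s, hs, hys, h0⟩ := exists_special_parameter one_ne_zero one_ne_zero one_ne_zero
        hμx m
      have h0' := mul_ne_zero (Finset.prod_ne_zero_iff.2 fun b (_ : b ∈ Finset.univ) => h0 b) hs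
      refine ⟨_, specialParameter m, inv_ne_zero h0', fun h => ?_, ?_⟩
      · obtain ⟨a⟩ := this
        apply h0 a
        rw [h]
        simp
      · rw [lagrangeVec_eq_smul x c e _ (fun a => s * w a m) (fun a => by rw [hwx]; exact hys a)]
        simp only [mul_smul, ← Finset.smul_sum]
        rw [smul_smul (∏ b, _), smul_smul, inv_mul_cancel₀ h0', one_smul]

/-- There is a curve of minimal degree through the vertices of a simplex and two further points. -/
theorem exists_isMinimalCone_two {d : ℕ} {ι : Type} [Fintype ι] [DecidableEq ι] [Nonempty ι]
    {e : ι → (Fin (d + 1) → ℂ)} (he : LinearIndependent ℂ e) (x y : ι → ℂ) :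
    ∃ K, IsMinimalCone (Submodule.span ℂ (Set.range e)) K ∧ (∀ a, e a ∈ K) ∧
      (∑ a, x a • e a ≠ 0 → ∑ a, x a • e a ∈ K) ∧
      (∑ a, y a • e a ≠ 0 → ∑ a, y a • e a ∈ K) := by
  -- A third coordinate `-(x * r y) / (x + r y)` puts the triples on the smooth conic. The factor
  -- `r` is chosen such that the denominator vanishes only where both coordinates do.
  obtain ⟨r, hr⟩ := Infinite.exists_notMem_finset
    (insert 0 (Finset.univ.image fun a => -x a / y a))
  simp only [Finset.mem_insert, Finset.mem_image, Finset.mem_univ, true_and, not_or,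
    not_exists] at hr
  obtain ⟨hr0, hr⟩ := hr
  have h1 : ∀ a, x a + r * y a = 0 → x a = 0 ∧ y a = 0 := by
    intro a ha
    have hy : y a = 0 := by
      by_contra hy
      apply hr a
      field_simp
      linear_combination -ha
    rw [hy, mul_zero, add_zero] at ha
    exact ⟨ha, hy⟩
  obtain ⟨n, hn⟩ := Nat.exists_eq_succ_of_ne_zero (Fintype.card_ne_zero (α := ι))
  obtain ⟨K, hK, heK, hwK⟩ := exists_isMinimalCone_of_triangleForm n ι hn e he
    (fun a => ![x a, r * y a, -(x a * (r * y a)) / (x a + r * y a)]) (by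
      intro a
      rw [triangleForm_apply]
      by_cases h0 : x a + r * y a = 0
      · simp [h1 a h0]
      · simp
        field_simp
        ring)
  refine ⟨K, hK, heK, fun h => by simpa using hwK 0 (by simpa using h), fun h => ?_⟩
  have h2 : ∑ a, (r * y a) • e a = r • ∑ a, y a • e a := by
    simp only [mul_smul, Finset.smul_sum]
  have h3 := hwK 1
  simp only [Matrix.cons_val_one, Matrix.cons_val_zero, h2] at h3
  have h4 := hK.smul_mem r⁻¹ (inv_ne_zero hr0) _ (h3 (smul_ne_zero hr0 h))
  rwa [smul_smul, inv_mul_cancel₀ hr0, one_smul] at h4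

/-- There is a curve of minimal degree through the vertices of a simplex and three further points
whose coordinates lie on a pair of lines, one of which is a coordinate axis. -/
theorem exists_isMinimalCone_of_pair {d : ℕ} {ι : Type} [Fintype ι] [DecidableEq ι] [Nonempty ι]
    {e : ι → (Fin (d + 1) → ℂ)} (he : LinearIndependent ℂ e) (x y z : ι → ℂ) {α β : ℂ}
    (h0 : ¬ (α = 0 ∧ β = 0)) (h : ∀ a, z a * (α * y a + β * x a) = 0) :
    ∃ K, IsMinimalCone (Submodule.span ℂ (Set.range e)) K ∧ (∀ a, e a ∈ K) ∧
      (∑ a, x a • e a ≠ 0 → ∑ a, x a • e a ∈ K) ∧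
      (∑ a, y a • e a ≠ 0 → ∑ a, y a • e a ∈ K) ∧
      (∑ a, z a • e a ≠ 0 → ∑ a, z a • e a ∈ K) := by
  classical
  by_cases hZ : ∑ a, z a • e a = 0
  · obtain ⟨K, hK, h1, h2, h3⟩ := exists_isMinimalCone_two he x y
    exact ⟨K, hK, h1, h2, h3, fun h => (h hZ).elim⟩
  -- Where `z a ≠ 0`, the other two coordinates satisfy a linear equation whose solutions are the
  -- multiples of `(α, -β)`.
  have hμ : ∀ a, ∃ μ, z a ≠ 0 → x a = μ * α ∧ y a = -(μ * β) := by
    intro a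
    by_cases hz : z a = 0
    · exact ⟨0, fun h => (h hz).elim⟩
    have h1 := (mul_eq_zero.1 (h a)).resolve_left hz
    by_cases hα : α = 0
    · have hβ : β ≠ 0 := fun hβ => h0 ⟨hα, hβ⟩
      refine ⟨-y a / β, fun _ => ?_⟩
      rw [hα, zero_mul, zero_add, mul_eq_zero, or_iff_right hβ] at h1
      rw [hα, h1]
      constructor
      · simp
      · field_simp
    · refine ⟨x a / α, fun _ => ⟨by field_simp, ?_⟩⟩
      field_simp
      linear_combination h1
  choose μ hμ using hμ
  have hB : Nonempty {a // z a ≠ 0} := by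
    by_contra hB
    exact hZ (Finset.sum_eq_zero fun a _ => by
      rw [show z a = 0 from by_contra fun h => hB ⟨⟨a, h⟩⟩, zero_smul])
  have hsplit : ∀ u : ι → ℂ, ∑ a, u a • e a =
      ∑ a : {a // z a = 0}, u a • e a + ∑ a : {a // z a ≠ 0}, u a • e a := fun u =>
    (Fintype.sum_subtype_add_sum_subtype (fun a => z a = 0) fun a => u a • e a).symm
  have heB : LinearIndependent ℂ fun a : {a // z a ≠ 0} => e a :=
    he.comp _ Subtype.val_injective
  have heA : LinearIndependent ℂ fun a : {a // z a = 0} => e a :=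
    he.comp _ Subtype.val_injective
  -- The third point lies in the span of the `e a` with `z a ≠ 0`, and there the components of the
  -- other two are multiples of one vector. The curve is glued at a point `f` spanning this vector
  -- from one curve in that span and one in the span of `f` and the remaining `e a`; if the vector
  -- is zero, `f` is arbitrary.
  obtain ⟨KB, hKB, heKB, hfK, hzK⟩ := exists_isMinimalCone_two heB (fun a => μ a) fun a => z a
  obtain ⟨f, hf, s, hs⟩ : ∃ f ∈ KB, ∃ s : ℂ, ∑ a : {a // z a ≠ 0}, μ a • e a = s • f := by
    by_cases h1 : ∑ a : {a // z a ≠ 0}, μ a • e a = 0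
    · obtain ⟨b⟩ := hB
      exact ⟨_, heKB b, 0, by rw [h1, zero_smul]⟩
    · exact ⟨_, hfK h1, 1, (one_smul _ _).symm⟩
  have hf0 := hKB.ne_zero f hf
  have hfB := hKB.subset hf
  have hdisj : Disjoint (Submodule.span ℂ (Set.range fun a : {a // z a = 0} => e a))
      (Submodule.span ℂ (Set.range fun a : {a // z a ≠ 0} => e a)) := by
    have := he.disjoint_span_image (s := {a | z a = 0}) (t := {a | z a ≠ 0})
      (Set.disjoint_left.2 fun a h1 h2 => h2 h1)
    rwa [Set.image_eq_range, Set.image_eq_range] at this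
  have he' := heA.option fun h1 => hf0 (Submodule.disjoint_def.1 hdisj f h1 hfB)
  set e' : Option {a // z a = 0} → (Fin (d + 1) → ℂ) :=
    fun o => Option.casesOn' o f fun a : {a // z a = 0} => e a
  obtain ⟨KA, hKA, heKA, hxK, hyK⟩ := exists_isMinimalCone_two he'
    (fun o => Option.casesOn' o (α * s) fun a : {a // z a = 0} => x a)
    (fun o => Option.casesOn' o (-(β * s)) fun a : {a // z a = 0} => y a)
  have hrange : Submodule.span ℂ (Set.range e') =
      (ℂ ∙ f) ⊔ Submodule.span ℂ (Set.range fun a : {a // z a = 0} => e a) := by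
    rw [← Submodule.span_union]
    congr 1
    ext v
    constructor
    · rintro ⟨_ | a, rfl⟩
      exacts [Or.inl rfl, Or.inr ⟨a, rfl⟩]
    · rintro (rfl | ⟨a, rfl⟩)
      exacts [⟨none, rfl⟩, ⟨some a, rfl⟩]
  have hK := hKA.union hKB (heKA none) hf (by
    rw [hrange, sup_inf_assoc_of_le _ ((Submodule.span_singleton_le_iff_mem _ _).2 hfB),
      hdisj.eq_bot, sup_bot_eq]
    exact le_rfl)
  have hspan : Submodule.span ℂ (Set.range e') ⊔
      Submodule.span ℂ (Set.range fun a : {a // z a ≠ 0} => e a) =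
        Submodule.span ℂ (Set.range e) := by
    rw [hrange, sup_comm (ℂ ∙ f), sup_assoc,
      sup_eq_right.2 ((Submodule.span_singleton_le_iff_mem _ _).2 hfB), ← Submodule.span_union]
    congr 1
    ext v
    constructor
    · rintro (⟨a, rfl⟩ | ⟨a, rfl⟩)
      exacts [⟨a, rfl⟩, ⟨a, rfl⟩]
    · rintro ⟨a, rfl⟩
      by_cases ha : z a = 0
      exacts [Or.inl ⟨⟨a, ha⟩, rfl⟩, Or.inr ⟨⟨a, ha⟩, rfl⟩]
  rw [hspan] at hK
  have hx : ∑ a, x a • e a = ∑ o, (Option.casesOn' o (α * s) fun a : {a // z a = 0} => x a :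
      ℂ) • e' o := by
    rw [hsplit, Fintype.sum_option]
    refine (add_comm _ _).trans ?_
    congr 1
    simp only [Option.casesOn'_none, e', mul_smul, ← hs, Finset.smul_sum]
    refine Finset.sum_congr rfl fun a _ => ?_
    rw [(hμ a a.2).1, smul_smul, mul_comm]
  have hy : ∑ a, y a • e a = ∑ o, (Option.casesOn' o (-(β * s)) fun a : {a // z a = 0} => y a :
      ℂ) • e' o := by
    rw [hsplit, Fintype.sum_option]
    refine (add_comm _ _).trans ?_
    congr 1
    simp only [Option.casesOn'_none, e', mul_smul, neg_smul, ← hs, Finset.smul_sum,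
      ← Finset.sum_neg_distrib]
    refine Finset.sum_congr rfl fun a _ => ?_
    rw [(hμ a a.2).2, neg_smul, smul_smul, mul_comm]
  have hz : ∑ a, z a • e a = ∑ a : {a // z a ≠ 0}, z a • e a := by
    rw [hsplit, Finset.sum_eq_zero, zero_add]
    exact fun a _ => by rw [a.2, zero_smul]
  refine ⟨_, hK, fun a => ?_, fun h1 => Or.inl ?_, fun h1 => Or.inl ?_, fun h1 => Or.inr ?_⟩
  · by_cases ha : z a = 0
    exacts [Or.inl (heKA (some ⟨a, ha⟩)), Or.inr (heKB ⟨a, ha⟩)]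
  · rw [hx] at h1 ⊢
    exact hxK h1
  · rw [hy] at h1 ⊢
    exact hyK h1
  · rw [hz] at h1 ⊢
    exact hzK h1

/-- There is a curve of minimal degree through the vertices of a simplex and three further points
whose coordinates lie on a conic through the vertices of the standard triangle. -/
theorem exists_isMinimalCone {d : ℕ} {ι : Type} [Fintype ι] [DecidableEq ι] [Nonempty ι]
    {e : ι → (Fin (d + 1) → ℂ)} (he : LinearIndependent ℂ e) {α β γ : ℂ}
    (h0 : ¬ (α = 0 ∧ β = 0 ∧ γ = 0)) {w : ι → (Fin 3 → ℂ)}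
    (hw : ∀ a, triangleForm α β γ (w a) = 0) :
    ∃ K, IsMinimalCone (Submodule.span ℂ (Set.range e)) K ∧ (∀ a, e a ∈ K) ∧
      ∀ m, ∑ a, w a m • e a ≠ 0 → ∑ a, w a m • e a ∈ K := by
  simp only [triangleForm_apply] at hw
  by_cases hα : α = 0
  · obtain ⟨K, hK, h1, h2, h3, h4⟩ := exists_isMinimalCone_of_pair he (fun a => w a 1)
      (fun a => w a 2) (fun a => w a 0) (α := β) (β := γ) (fun h => h0 ⟨hα, h⟩)
      fun a => by linear_combination hw a - (w a 1 * w a 2) * hα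
    exact ⟨K, hK, h1, fun m => by fin_cases m; exacts [h4, h2, h3]⟩
  by_cases hβ : β = 0
  · obtain ⟨K, hK, h1, h2, h3, h4⟩ := exists_isMinimalCone_of_pair he (fun a => w a 0)
      (fun a => w a 2) (fun a => w a 1) (α := α) (β := γ) (fun h => hα h.1)
      fun a => by linear_combination hw a - (w a 0 * w a 2) * hβ
    exact ⟨K, hK, h1, fun m => by fin_cases m; exacts [h2, h4, h3]⟩
  by_cases hγ : γ = 0
  · obtain ⟨K, hK, h1, h2, h3, h4⟩ := exists_isMinimalCone_of_pair he (fun a => w a 0)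
      (fun a => w a 1) (fun a => w a 2) (α := α) (β := β) (fun h => hα h.1)
      fun a => by linear_combination hw a - (w a 0 * w a 1) * hγ
    exact ⟨K, hK, h1, fun m => by fin_cases m; exacts [h2, h3, h4]⟩
  obtain ⟨n, hn⟩ := Nat.exists_eq_succ_of_ne_zero (Fintype.card_ne_zero (α := ι))
  -- Rescaling the coordinates brings a smooth conic to the form with coefficients `1`, `1`, `1`.
  set r : Fin 3 → ℂ := ![α⁻¹, β⁻¹, γ⁻¹] with hr
  have hr0 : ∀ m, r m ≠ 0 := by
    intro m
    fin_cases m <;> simp [hr, hα, hβ, hγ]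
  obtain ⟨K, hK, heK, hwK⟩ := exists_isMinimalCone_of_triangleForm n ι hn e he
    (fun a m => r m * w a m) (by
      intro a
      rw [triangleForm_apply]
      simp [hr]
      field_simp
      linear_combination hw a)
  refine ⟨K, hK, heK, fun m hm => ?_⟩
  have h2 : ∑ a, (r m * w a m) • e a = r m • ∑ a, w a m • e a := by
    simp only [mul_smul, Finset.smul_sum]
  have h3 := hwK m
  rw [h2] at h3
  have h4 := hK.smul_mem (r m)⁻¹ (inv_ne_zero (hr0 m)) _ (h3 (smul_ne_zero (hr0 m) hm))
  rwa [smul_smul, inv_mul_cancel₀ (hr0 m), one_smul] at h4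

/-! ### Hilbert functions -/

/-- Evaluation of polynomials along a family of vectors. -/
def evalAlong {X : Type*} {N : ℕ} (ψ : X → (Fin N → ℂ)) : MvPolynomial (Fin N) ℂ →ₐ[ℂ] (X → ℂ) :=
  MvPolynomial.aeval fun i x => ψ x i

theorem evalAlong_apply {X : Type*} {N : ℕ} (ψ : X → (Fin N → ℂ)) (F : MvPolynomial (Fin N) ℂ)
    (x : X) : evalAlong ψ F x = MvPolynomial.eval (ψ x) F := by
  have h : (Pi.evalAlgHom ℂ (fun _ : X => ℂ) x).comp (evalAlong ψ) =
      MvPolynomial.aeval (ψ x) := by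
    ext i
    simp [evalAlong]
  have := DFunLike.congr_fun h F
  simpa using this

/-- Links the Hilbert function defined by homogeneous polynomials to the powers of the space of
linear functions. -/
theorem map_evalAlong {X : Type*} {N : ℕ} (ψ : X → (Fin N → ℂ)) (m : ℕ) :
    (MvPolynomial.homogeneousSubmodule (Fin N) ℂ m).map (evalAlong ψ).toLinearMap =
      (linFun (Fin N → ℂ) ^ m).map (pullback ψ).toLinearMap := by
  rw [← MvPolynomial.homogeneousSubmodule_one_pow, Submodule.map_pow, Submodule.map_pow]
  congr 1
  rw [MvPolynomial.homogeneousSubmodule_one_eq_span_X, Submodule.map_span]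
  refine le_antisymm (Submodule.span_le.2 ?_) ?_
  · rintro _ ⟨_, ⟨i, rfl⟩, rfl⟩
    refine ⟨_, ⟨LinearMap.proj i, rfl⟩, ?_⟩
    ext x
    simp [evalAlong]
  · rintro _ ⟨_, ⟨φ, rfl⟩, rfl⟩
    have : (pullback ψ).toLinearMap (LinearMap.ltoFun ℂ (Fin N → ℂ) ℂ ℂ φ) =
        ∑ i, φ (Pi.single i 1) • (evalAlong ψ).toLinearMap (MvPolynomial.X i) := by
      ext x
      simp only [AlgHom.toLinearMap_apply, pullback_apply, LinearMap.ltoFun_apply,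
        Finset.sum_apply, Pi.smul_apply, evalAlong_apply, MvPolynomial.eval_X, smul_eq_mul]
      conv_lhs => rw [← Finset.univ_sum_single (ψ x)]
      rw [map_sum]
      refine Finset.sum_congr rfl fun i _ => ?_
      rw [mul_comm, ← smul_eq_mul, ← map_smul, ← Pi.single_smul, smul_eq_mul, mul_one]
    rw [this]
    exact Submodule.sum_mem _ fun i _ => Submodule.smul_mem _ _
      (Submodule.subset_span ⟨_, ⟨i, rfl⟩, rfl⟩)

theorem exists_isHomogeneous_of_mem_linFun_pow {N m : ℕ} {f : (Fin N → ℂ) → ℂ}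
    (hf : f ∈ linFun (Fin N → ℂ) ^ m) :
    ∃ F : MvPolynomial (Fin N) ℂ, F.IsHomogeneous m ∧ ∀ v, f v = MvPolynomial.eval v F := by
  have h : f ∈ (linFun (Fin N → ℂ) ^ m).map (pullback id).toLinearMap := ⟨f, hf, rfl⟩
  rw [← map_evalAlong] at h
  obtain ⟨F, hF, rfl⟩ := h
  exact ⟨F, hF, fun v => evalAlong_apply _ F v⟩

theorem hilbertFunction_eq_hilb {d : ℕ} (C : Set (PSpace d)) (m : ℕ) :
    hilbertFunction C m = hilb (fun p : C => p.1.rep) m := by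
  have h : vanishingForms C m = LinearMap.ker ((evalAlong fun p : C => p.1.rep).toLinearMap ∘ₗ
      (MvPolynomial.homogeneousSubmodule (Fin (d + 1)) ℂ m).subtype) := by
    ext F
    simp only [vanishingForms, Submodule.mem_iInf, LinearMap.mem_ker, LinearMap.comp_apply,
      Submodule.subtype_apply, AlgHom.toLinearMap_apply]
    rw [funext_iff, Subtype.forall]
    refine forall₂_congr fun p hp => ?_
    rw [evalAlong_apply, ← MvPolynomial.coe_aeval_eq_eval]
    rfl
  rw [hilbertFunction, h, (LinearMap.quotKerEquivRange _).finrank_eq, LinearMap.range_comp,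
    Submodule.range_subtype, map_evalAlong, hilb]

theorem IsMinimalCone.mk_mem_closure {d : ℕ} {L : Submodule ℂ (Fin (d + 1) → ℂ)}
    {K : Set (Fin (d + 1) → ℂ)} (hK : IsMinimalCone L K) {v : Fin (d + 1) → ℂ} (hv : v ∈ K)
    (hv0 : v ≠ 0) :
    Projectivization.mk ℂ v hv0 ∈ closure[zariski d] {p : PSpace d | p.rep ∈ K} := by
  let := zariski d
  exact subset_closure ((rep_mem_iff hK.smul_mem hv0).2 hv)

/-- Zero loci of forms are closed and do not depend on representatives, so passing to the closure
changes neither the vanishing forms nor the Hilbert function. -/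
theorem IsMinimalCone.forall_mem_closure_iff {d m : ℕ} {L : Submodule ℂ (Fin (d + 1) → ℂ)}
    {K : Set (Fin (d + 1) → ℂ)} (hK : IsMinimalCone L K) {f : (Fin (d + 1) → ℂ) → ℂ}
    (hf : f ∈ linFun (Fin (d + 1) → ℂ) ^ m) :
    (∀ p ∈ closure[zariski d] {p : PSpace d | p.rep ∈ K}, f p.rep = 0) ↔ ∀ v ∈ K, f v = 0 := by
  constructor
  · intro h v hv
    have hv0 := hK.ne_zero v hv
    obtain ⟨κ, hκ⟩ := Projectivization.exists_smul_eq_mk_rep ℂ v hv0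
    have h1 := h _ (hK.mk_mem_closure hv hv0)
    rw [← hκ, Units.smul_def, apply_smul_of_mem_linFun_pow hf] at h1
    exact (mul_eq_zero.1 h1).resolve_left (pow_ne_zero _ κ.ne_zero)
  · intro h
    obtain ⟨F, hF, hfF⟩ := exists_isHomogeneous_of_mem_linFun_pow hf
    let := zariski d
    have hclosed : IsClosed {p : PSpace d | f p.rep = 0} := by
      rw [← isOpen_compl_iff]
      refine TopologicalSpace.isOpen_generateFrom_of_mem ⟨m, F, hF, ?_⟩
      ext p
      simp [hfF]
    exact closure_minimal (fun p hp => h _ hp) hclosed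

/-- The closure of a connected curve of minimal degree is a quasi-Veronese curve. -/
theorem IsMinimalCone.isQuasiVeronese {d : ℕ} {K : Set (Fin (d + 1) → ℂ)}
    (hK : IsMinimalCone ⊤ K) : IsQuasiVeronese (closure[zariski d] {p : PSpace d | p.rep ∈ K}) := by
  refine ⟨?_, ?_, ?_, 1, Filter.Eventually.of_forall fun m => ?_⟩
  · let := zariski d
    exact isClosed_closure
  · let := zariski d
    exact hK.isConnected.closure
  · rintro ⟨φ, hφ, h⟩
    have h1 := (hK.forall_mem_closure_iff (m := 1) (f := φ)
      (by rw [pow_one]; exact dual_mem_linFun φ)).1 h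
    have h2 : (⊤ : Submodule ℂ (Fin (d + 1) → ℂ)) ≤ LinearMap.ker φ := by
      rw [← hK.span_eq, Submodule.span_le]
      exact fun v hv => h1 v hv
    exact hφ (LinearMap.ext fun v => h2 (Submodule.mem_top (x := v)))
  · have h1 := hK.hilb_eq m
    rw [hilbertFunction_eq_hilb, hilb_congr (χ := (Subtype.val : K → (Fin (d + 1) → ℂ))) fun f hf => by
      simpa only [Subtype.forall] using hK.forall_mem_closure_iff hf]
    rw [finrank_top, Module.finrank_fin_fun] at h1
    have : (d + 1) * m = d * m + m := by ring
    rw [this] at h1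
    have h2 : hilb (Subtype.val : K → (Fin (d + 1) → ℂ)) m = d * m + 1 := by omega
    rw [h2]
    push_cast
    ring

/-- A configuration with the Gale dual on a conic lies on a quasi-Veronese curve. -/
theorem exists_isQuasiVeronese_extendBasis {d n : ℕ} (e : Fin (d + 1) ⊕ Fin 3 ≃ Fin n)
    (E : Module.Basis (Fin (d + 1)) ℂ (Fin (d + 1) → ℂ)) {α β γ : ℂ}
    (h0 : ¬ (α = 0 ∧ β = 0 ∧ γ = 0)) {w : Fin (d + 1) → (Fin 3 → ℂ)}
    (hw : ∀ a, triangleForm α β γ (w a) = 0) (hv : ∀ a, extendBasis e E w a ≠ 0) :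
    ∃ C : Set (PSpace d), IsQuasiVeronese C ∧
      ∀ a, Projectivization.mk ℂ (extendBasis e E w a) (hv a) ∈ C := by
  obtain ⟨K, hK, h1, h2⟩ := exists_isMinimalCone E.linearIndependent h0 hw
  rw [E.span_eq] at hK
  refine ⟨_, hK.isQuasiVeronese, fun a => hK.mk_mem_closure ?_ _⟩
  have h3 := hv a
  rw [extendBasis] at h3 ⊢
  generalize e.symm a = i at h3 ⊢
  rcases i with b | m
  exacts [h1 b, h2 m h3]

/-! ### Graded algebras of functions -/

section

variable {Ω : Type*}

/-- The set `X` consists of points where not all members of `T` vanish, and its characteristic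
function preserves the powers of `T` with large exponent. If `T` consists of the linear forms on
the cone over a projective curve, the `X` are unions of components of the curve which do not meet
the other ones. -/
structure IsSeparated (T : Submodule ℂ (Ω → ℂ)) (X : Set Ω) : Prop where
  nonempty : X.Nonempty
  exists_ne_zero : ∀ ω ∈ X, ∃ f ∈ T, f ω ≠ 0
  exists_mul_mem : ∃ N : ℕ, ∀ f ∈ T ^ N, X.indicator 1 * f ∈ T ^ N

theorem mul_mem_mul_of_forall {A : Type*} [CommRing A] [Algebra ℂ A] {S S' T : Submodule ℂ A}
    {u : A} (h : ∀ f ∈ S, u * f ∈ S') {f : A} (hf : f ∈ S * T) : u * f ∈ S' * T := by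
  induction hf using Submodule.mul_induction_on' with
  | mem_mul_mem f hf g hg => exact mul_assoc u f g ▸ Submodule.mul_mem_mul (h f hf) hg
  | add f _ g _ hf hg => exact mul_add u f g ▸ Submodule.add_mem _ hf hg

theorem mul_mem_pow_of_le {A : Type*} [CommRing A] [Algebra ℂ A] {T : Submodule ℂ A} {u : A}
    {N n : ℕ} (hN : ∀ f ∈ T ^ N, u * f ∈ T ^ N) (hn : N ≤ n) {f : A} (hf : f ∈ T ^ n) :
    u * f ∈ T ^ n := by
  obtain ⟨j, rfl⟩ := Nat.exists_eq_add_of_le hn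
  rw [pow_add] at hf ⊢
  exact mul_mem_mul_of_forall hN hf

theorem exists_eq_sum_of_mem_mul_span {A : Type*} [CommRing A] [Algebra ℂ A] {H : Submodule ℂ A}
    {n : ℕ} {s : Fin n → A} {f : A} (hf : f ∈ H * Submodule.span ℂ (Set.range s)) :
    ∃ h : Fin n → A, (∀ b, h b ∈ H) ∧ f = ∑ b, h b * s b := by
  induction hf using Submodule.mul_induction_on' with
  | mem_mul_mem h hh e he =>
    obtain ⟨c, rfl⟩ := (Submodule.mem_span_range_iff_exists_fun ℂ).1 he
    refine ⟨fun b => c b • h, fun b => Submodule.smul_mem _ _ hh, ?_⟩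
    rw [Finset.mul_sum]
    exact Finset.sum_congr rfl fun b _ => by rw [mul_smul_comm, smul_mul_assoc]
  | add f _ g _ hf hg =>
    obtain ⟨h, hh, rfl⟩ := hf
    obtain ⟨h', hh', rfl⟩ := hg
    refine ⟨fun b => h b + h' b, fun b => Submodule.add_mem _ (hh b) (hh' b), ?_⟩
    simp only [add_mul, Finset.sum_add_distrib]

theorem det_mem_pow {A : Type*} [CommRing A] [Algebra ℂ A] {S : Submodule ℂ A} {n : ℕ}
    {M : Matrix (Fin n) (Fin n) A} (h : ∀ a b, M a b ∈ S) : M.det ∈ S ^ n := by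
  rw [Matrix.det_apply]
  refine Submodule.sum_mem _ fun σ _ => ?_
  have h1 := prod_mem_pow Finset.univ (f := fun i => M (σ i) i) fun i _ => h _ _
  rw [Finset.card_univ, Fintype.card_fin] at h1
  rw [Units.smul_def]
  exact zsmul_mem h1 _

theorem det_mul_eq_zero {A : Type*} [CommRing A] {n : ℕ} {M : Matrix (Fin n) (Fin n) A}
    {s : Fin n → A} (h : ∀ a, ∑ b, M a b * s b = 0) (a : Fin n) : M.det * s a = 0 := by
  have h1 : M.mulVec s = 0 := funext h
  have h2 : M.adjugate.mulVec (M.mulVec s) = 0 := by rw [h1, Matrix.mulVec_zero]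
  rw [Matrix.mulVec_mulVec, Matrix.adjugate_mul, Matrix.smul_mulVec, Matrix.one_mulVec] at h2
  exact congr_fun h2 a

theorem eq_zero_of_mem_mul {Y S : Submodule ℂ (Ω → ℂ)} {p : Ω} (hY : ∀ y ∈ Y, y p = 0)
    {f : Ω → ℂ} (hf : f ∈ Y * S) : f p = 0 := by
  induction hf using Submodule.mul_induction_on' with
  | mem_mul_mem f hf g hg => rw [Pi.mul_apply, hY f hf, zero_mul]
  | add f _ g _ hf hg => rw [Pi.add_apply, hf, hg, add_zero]

/-- If every form which does not vanish at `p` is somewhere nonzero on `X`, then `X` contributes to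
the growth of the Hilbert function. -/
theorem exists_mul_notMem {Y T : Submodule ℂ (Ω → ℂ)} {z : Ω → ℂ} (hYT : Y ≤ T) (hz : z ∈ T)
    (hfg : Y.FG) {p : Ω} (hYp : ∀ y ∈ Y, y p = 0) (hzp : z p ≠ 0) {X : Set Ω} {k : ℕ}
    (hX : ∀ ω ∈ X, ∃ f ∈ Y, f ω ≠ 0) (hk : ∀ f ∈ Y ^ k, X.indicator 1 * f ∈ Y ^ k)
    (hacc : ∀ M : ℕ, ∀ g ∈ T ^ M, g p ≠ 0 → ∃ ω ∈ X, g ω ≠ 0) (l : ℕ) :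
    ∃ e ∈ Y ^ k, (∀ ω, ω ∉ X → e ω = 0) ∧ z ^ (l + 1) * e ∉ Y ^ (k + 1) * T ^ l := by
  -- The determinant trick: otherwise multiplication by `z ^ (l + 1)` maps the space `E` of members
  -- of `Y ^ k` cut off to `X` into `(Y * T ^ l) * E`, so a determinant with entries in `T ^ (l +
  -- 1)` annihilates `E`.
  by_contra! h
  set E : Submodule ℂ (Ω → ℂ) := (Y ^ k).map (LinearMap.mulLeft ℂ (X.indicator 1)) with hE
  obtain ⟨n, s, hs⟩ := Submodule.fg_iff_exists_fin_generating_family.1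
    ((hfg.pow k).map (LinearMap.mulLeft ℂ (X.indicator (1 : Ω → ℂ))))
  rw [← hE] at hs
  have hsE : ∀ a, s a ∈ E := fun a => hs ▸ Submodule.subset_span ⟨a, rfl⟩
  have hE0 : ∀ e ∈ E, ∀ ω, ω ∉ X → e ω = 0 := by
    rintro _ ⟨f, -, rfl⟩ ω hω
    simp [hω]
  have hEY : E ≤ Y ^ k := by
    rintro _ ⟨f, hf, rfl⟩
    exact hk f hf
  have h1 : ∀ a, z ^ (l + 1) * s a ∈ (Y * T ^ l) * Submodule.span ℂ (Set.range s) := by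
    intro a
    have h2 := h (s a) (hEY (hsE a)) (hE0 _ (hsE a))
    have h3 : X.indicator 1 * (z ^ (l + 1) * s a) = z ^ (l + 1) * s a := by
      ext ω
      by_cases hω : ω ∈ X
      · simp [hω]
      · simp [hω, hE0 _ (hsE a) ω hω]
    rw [pow_succ, mul_assoc] at h2
    have h4 := mul_mem_mul_of_forall (S' := E) (u := X.indicator 1) (fun f hf => ⟨f, hf, rfl⟩) h2
    rw [h3, mul_comm E, ← hs] at h4
    exact h4
  choose H hH hHs using fun a => exists_eq_sum_of_mem_mul_span (h1 a)
  set M : Matrix (Fin n) (Fin n) (Ω → ℂ) := Matrix.of fun a b =>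
    (if a = b then z ^ (l + 1) else 0) - H a b with hM
  have hMs : ∀ a, ∑ b, M a b * s b = 0 := by
    intro a
    simp only [hM, Matrix.of_apply, sub_mul, Finset.sum_sub_distrib, ite_mul, zero_mul,
      Finset.sum_ite_eq, Finset.mem_univ, if_true, ← hHs, sub_self]
  have hMT : ∀ a b, M a b ∈ T ^ (l + 1) := by
    intro a b
    refine Submodule.sub_mem _ ?_ ?_
    · split_ifs
      exacts [Submodule.pow_mem_pow _ hz _, Submodule.zero_mem _]
    · rw [pow_succ']
      exact mul_le_mul' hYT le_rfl (hH a b)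
  have hdet : M.det ∈ T ^ ((l + 1) * n) := by
    rw [pow_mul]
    exact det_mem_pow hMT
  -- The correction terms have a factor in `Y`, so they vanish at `p`, where the matrix becomes the
  -- scalar `z p ^ (l + 1)`.
  have hdetp : M.det p ≠ 0 := by
    have h5 := RingHom.map_det (Pi.evalRingHom (fun _ : Ω => ℂ) p) M
    have h6 : (Pi.evalRingHom (fun _ : Ω => ℂ) p).mapMatrix M =
        Matrix.diagonal fun _ => z p ^ (l + 1) := by
      ext a b
      have h7 := eq_zero_of_mem_mul hYp (hH a b)
      by_cases hab : a = b
      · simp [hM, hab, hab ▸ h7]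
      · simp [hM, hab, h7]
    rw [h6, Matrix.det_diagonal] at h5
    rw [show M.det p = _ from h5]
    exact Finset.prod_ne_zero_iff.2 fun _ _ => pow_ne_zero _ hzp
  -- Hence the determinant is nonzero at some point of `X`, where a suitable `y ^ k` is nonzero too;
  -- but it annihilates `y ^ k` cut off to `X`.
  obtain ⟨ω, hω, hωdet⟩ := hacc _ _ hdet hdetp
  obtain ⟨y, hy, hyω⟩ := hX ω hω
  have h8 : X.indicator 1 * y ^ k ∈ Submodule.span ℂ (Set.range s) :=
    hs ▸ ⟨y ^ k, Submodule.pow_mem_pow _ hy k, rfl⟩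
  obtain ⟨c, hc⟩ := (Submodule.mem_span_range_iff_exists_fun ℂ).1 h8
  have h9 : M.det * (X.indicator 1 * y ^ k) = 0 := by
    rw [← hc, Finset.mul_sum]
    exact Finset.sum_eq_zero fun a _ => by rw [mul_smul_comm, det_mul_eq_zero hMs, smul_zero]
  have h10 := congr_fun h9 ω
  simp [hω, hωdet, hyω] at h10

theorem finrank_add_card_le {A ι : Type*} [AddCommGroup A] [Module ℂ A] [Fintype ι]
    {W V : Submodule ℂ A} [Module.Finite ℂ V] {u : ι → A} (hWV : W ≤ V) (huV : ∀ i, u i ∈ V)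
    (key : ∀ c : ι → ℂ, ∑ i, c i • u i ∈ W → ∀ i, c i = 0) :
    Module.finrank ℂ W + Fintype.card ι ≤ Module.finrank ℂ V := by
  have hli : LinearIndependent ℂ u := Fintype.linearIndependent_iff.2 fun c hc =>
    key c (by rw [hc]; exact Submodule.zero_mem _)
  have hinf : W ⊓ Submodule.span ℂ (Set.range u) = ⊥ := by
    rw [Submodule.eq_bot_iff]
    rintro f ⟨h1, h2⟩
    obtain ⟨c, rfl⟩ := (Submodule.mem_span_range_iff_exists_fun ℂ).1 h2
    exact Finset.sum_eq_zero fun i _ => by rw [key c h1 i, zero_smul]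
  have hspan : Submodule.span ℂ (Set.range u) ≤ V := by
    rw [Submodule.span_le]
    rintro _ ⟨i, rfl⟩
    exact huV i
  have : Module.Finite ℂ W := Submodule.finiteDimensional_of_le hWV
  have : Module.Finite ℂ ↥(Submodule.span ℂ (Set.range u)) :=
    Module.Finite.span_of_finite ℂ (Set.finite_range u)
  have h4 := Submodule.finrank_sup_add_finrank_inf_eq W (Submodule.span ℂ (Set.range u))
  rw [hinf, finrank_bot, finrank_span_eq_card hli] at h4
  have h5 := Submodule.finrank_mono (sup_le hWV hspan)
  omega

/-- Every `X i` supplies a new function supported on it. Multiplication by the characteristic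
functions separates these, so they are independent modulo the smaller space. -/
theorem finrank_mul_pow_add_card_le {Y T : Submodule ℂ (Ω → ℂ)} {z : Ω → ℂ} (hYT : Y ≤ T)
    (hz : z ∈ T) (hfg : Y.FG) (hfg' : T.FG) {p : Ω} (hYp : ∀ y ∈ Y, y p = 0) (hzp : z p ≠ 0)
    {ι : Type*} [Fintype ι] {X : ι → Set Ω} (hdisj : Pairwise (Function.onFun Disjoint X)) {k : ℕ}
    (hX : ∀ i, ∀ ω ∈ X i, ∃ f ∈ Y, f ω ≠ 0)
    (hk : ∀ i, ∀ f ∈ Y ^ k, (X i).indicator 1 * f ∈ Y ^ k)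
    (hacc : ∀ i, ∀ M : ℕ, ∀ g ∈ T ^ M, g p ≠ 0 → ∃ ω ∈ X i, g ω ≠ 0) (l : ℕ) :
    Module.finrank ℂ ↥(Y ^ (k + 1) * T ^ l) + Fintype.card ι ≤
      Module.finrank ℂ ↥(Y ^ k * T ^ (l + 1)) := by
  choose e he heX hez using fun i =>
    exists_mul_notMem hYT hz hfg hYp hzp (hX i) (hk i) (hacc i) l
  set u : ι → (Ω → ℂ) := fun i => z ^ (l + 1) * e i with hu
  have key : ∀ c : ι → ℂ, ∑ i, c i • u i ∈ Y ^ (k + 1) * T ^ l → ∀ i, c i = 0 := by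
    intro c hc j
    have h1 : (X j).indicator 1 * ∑ i, c i • u i ∈ Y ^ (k + 1) * T ^ l :=
      mul_mem_mul_of_forall (fun f hf => mul_mem_pow_of_le (hk j) (Nat.le_succ k) hf) hc
    have h2 : (X j).indicator 1 * ∑ i, c i • u i = c j • u j := by
      rw [Finset.mul_sum, Finset.sum_eq_single j]
      · ext ω
        by_cases hω : ω ∈ X j
        · simp [hω]
        · simp [hω, hu, heX j ω hω]
      · intro i _ hij
        ext ω
        by_cases hω : ω ∈ X j
        · simp [hu, heX i ω fun h => Set.disjoint_left.1 (hdisj hij) h hω]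
        · simp [hω]
      · simp
    rw [h2] at h1
    by_contra hcj
    have h3 := Submodule.smul_mem _ (c j)⁻¹ h1
    rw [smul_smul, inv_mul_cancel₀ hcj, one_smul] at h3
    exact hez j h3
  have : Module.Finite ℂ ↥(Y ^ k * T ^ (l + 1)) :=
    Module.Finite.iff_fg.2 ((hfg.pow _).mul (hfg'.pow _))
  refine finrank_add_card_le ?_ (fun i => ?_) key
  · rw [pow_succ, pow_succ' T, mul_assoc]
    exact mul_le_mul' le_rfl (mul_le_mul' hYT le_rfl)
  · rw [mul_comm (Y ^ k)]
    exact Submodule.mul_mem_mul (Submodule.pow_mem_pow _ hz _) (he i)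

/-- The growth of the Hilbert function on adding a linear form which does not vanish at a point
where the others do. -/
theorem exists_finrank_pow_add_le {Y T : Submodule ℂ (Ω → ℂ)} {z : Ω → ℂ} (hYT : Y ≤ T)
    (hz : z ∈ T) (hfg : Y.FG) (hfg' : T.FG) {p : Ω} (hYp : ∀ y ∈ Y, y p = 0) (hzp : z p ≠ 0)
    {ι : Type*} [Fintype ι] {X : ι → Set Ω} (hdisj : Pairwise (Function.onFun Disjoint X))
    (hX : ∀ i, IsSeparated Y (X i))
    (hacc : ∀ i, ∀ M : ℕ, ∀ g ∈ T ^ M, g p ≠ 0 → ∃ ω ∈ X i, g ω ≠ 0) :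
    ∃ c : ℕ, ∀ m, Module.finrank ℂ ↥(Y ^ m) + Fintype.card ι * m ≤
      Module.finrank ℂ ↥(T ^ m) + c := by
  choose N hN using fun i => (hX i).exists_mul_mem
  set K := ∑ i, N i with hK
  have hNK : ∀ i, N i ≤ K := fun i => Finset.single_le_sum (fun _ _ => Nat.zero_le _)
    (Finset.mem_univ i)
  have hfin : ∀ m, Module.Finite ℂ ↥(T ^ m) := fun m => Module.Finite.iff_fg.2 (hfg'.pow m)
  -- One climbs from `Y ^ (k + l)` to `Y ^ k * T ^ l`, trading a factor in `Y` for one in `T`, with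
  -- a gain of `Fintype.card ι` each time. The exponent of `Y` stays at least `K`, where all
  -- characteristic functions act.
  have h1 : ∀ l k, K ≤ k → Module.finrank ℂ ↥(Y ^ (k + l)) + Fintype.card ι * l ≤
      Module.finrank ℂ ↥(Y ^ k * T ^ l) := by
    intro l
    induction l with
    | zero =>
      intro k _
      rw [pow_zero, mul_one, add_zero, mul_zero, add_zero]
    | succ l ih =>
      intro k hk
      have h2 := ih (k + 1) (hk.trans (Nat.le_succ k))
      have h3 := finrank_mul_pow_add_card_le hYT hz hfg hfg' hYp hzp hdisj
        (fun i => (hX i).exists_ne_zero)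
        (fun i f hf => mul_mem_pow_of_le (hN i) ((hNK i).trans hk) hf) hacc l
      rw [show k + (l + 1) = k + 1 + l by ring, mul_add, mul_one]
      omega
  refine ⟨Fintype.card ι * K, fun m => ?_⟩
  rcases le_total K m with hm | hm
  · obtain ⟨l, rfl⟩ := Nat.exists_eq_add_of_le hm
    have h2 := h1 l K le_rfl
    have h3 : Y ^ K * T ^ l ≤ T ^ (K + l) := by
      rw [pow_add]
      exact mul_le_mul' (pow_le_pow_left' hYT K) le_rfl
    have h4 := Submodule.finrank_mono h3
    rw [mul_add]
    omega
  · have h3 := Submodule.finrank_mono (pow_le_pow_left' hYT m)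
    have h4 := Nat.mul_le_mul_left (Fintype.card ι) hm
    omega

end

theorem map_mulLeft_mul {A : Type*} [CommRing A] [Algebra ℂ A] (u : A) (S S' : Submodule ℂ A) :
    S.map (LinearMap.mulLeft ℂ u) * S' = (S * S').map (LinearMap.mulLeft ℂ u) := by
  apply le_antisymm
  · rw [Submodule.mul_le]
    rintro _ ⟨a, ha, rfl⟩ b hb
    exact ⟨a * b, Submodule.mul_mem_mul ha hb, (mul_assoc _ _ _).symm⟩
  · rintro _ ⟨a, ha, rfl⟩
    exact mul_mem_mul_of_forall (S' := S.map (LinearMap.mulLeft ℂ u))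
      (fun f hf => ⟨f, hf, rfl⟩) ha

section

variable {Ω : Type*}

/-- If a form which does not vanish at `p` vanishes on `X`, then `X` stays separated on adding a
linear form which does not vanish at `p`. -/
theorem IsSeparated.sup_span {Y T : Submodule ℂ (Ω → ℂ)} {z : Ω → ℂ} (hT : T = Y ⊔ ℂ ∙ z)
    {p : Ω} (hYp : ∀ y ∈ Y, y p = 0) {X : Set Ω} (hX : IsSeparated Y X) {M : ℕ}
    {g : Ω → ℂ} (hg : g ∈ T ^ M) (hgp : g p ≠ 0) (hgX : ∀ ω ∈ X, g ω = 0) : IsSeparated T X := by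
  have hYT : Y ≤ T := hT ▸ le_sup_left
  obtain ⟨ω₀, hω₀⟩ := hX.nonempty
  refine ⟨hX.nonempty, fun ω hω => ?_, ?_⟩
  · obtain ⟨f, hf, hfω⟩ := hX.exists_ne_zero ω hω
    exact ⟨f, hYT hf, hfω⟩
  obtain ⟨N, hN⟩ := hX.exists_mul_mem
  obtain _ | M := M
  · rw [pow_zero, Submodule.mem_one] at hg
    obtain ⟨c, rfl⟩ := hg
    exact (hgp (hgX ω₀ hω₀)).elim
  have hzT : z ∈ T := hT ▸ Submodule.mem_sup_right (Submodule.mem_span_singleton_self z)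
  -- As `g` is nonzero at `p` and members of `Y * T ^ M` vanish there, `g` involves `z ^ (M + 1)`.
  -- Since `g` vanishes on `X`, this power agrees on `X` with a member of `Y * T ^ M`.
  have hsplit : T ^ (M + 1) ≤ Y * T ^ M ⊔ ℂ ∙ (z ^ (M + 1)) := by
    have := sup_pow_succ_le Y (ℂ ∙ z) M
    rwa [← hT, Submodule.span_pow, Set.singleton_pow] at this
  obtain ⟨h, hh, _, hc, rfl⟩ := Submodule.mem_sup.1 (hsplit hg)
  obtain ⟨c, rfl⟩ := Submodule.mem_span_singleton.1 hc
  have hc0 : c ≠ 0 := by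
    rintro rfl
    exact hgp (by simp [eq_zero_of_mem_mul hYp hh])
  have h1 : ∀ f ∈ T ^ (M + 1), ∃ f' ∈ Y * T ^ M, X.indicator 1 * f = X.indicator 1 * f' := by
    intro f hf
    obtain ⟨f₁, hf₁, _, hf₂, rfl⟩ := Submodule.mem_sup.1 (hsplit hf)
    obtain ⟨b, rfl⟩ := Submodule.mem_span_singleton.1 hf₂
    refine ⟨f₁ - (b / c) • h, Submodule.sub_mem _ hf₁ (Submodule.smul_mem _ _ hh), ?_⟩
    ext ω
    by_cases hω : ω ∈ X
    · have := hgX ω hω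
      simp only [Pi.add_apply, Pi.smul_apply, smul_eq_mul] at this
      simp only [Pi.mul_apply, Set.indicator_of_mem hω, Pi.one_apply, one_mul, Pi.add_apply,
        Pi.smul_apply, smul_eq_mul, Pi.sub_apply]
      field_simp
      linear_combination b * this
    · simp [hω]
  -- Iteration: on `X`, all of `T ^ (k + M)` is represented by `Y ^ k * T ^ M`. For `k = N` the
  -- factor in `Y ^ N` absorbs the characteristic function.
  have h2 : ∀ k, ∀ f ∈ T ^ (k + M), X.indicator 1 * f ∈
      (Y ^ k * T ^ M).map (LinearMap.mulLeft ℂ (X.indicator 1)) := by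
    intro k
    induction k with
    | zero =>
      intro f hf
      rw [zero_add] at hf
      rw [pow_zero, one_mul]
      exact ⟨f, hf, rfl⟩
    | succ k ih =>
      intro f hf
      have h3 : T ^ (k + 1 + M) = T ^ (M + 1) * T ^ k := by rw [← pow_add]; congr 1; ring
      have h4 : Y * T ^ M * T ^ k = T ^ (k + M) * Y := by rw [pow_add]; ring
      have h5 : Y ^ (k + 1) * T ^ M = Y ^ k * T ^ M * Y := by ring
      rw [h3] at hf
      have h6 := mul_mem_mul_of_forall (S' := (Y * T ^ M).map
        (LinearMap.mulLeft ℂ (X.indicator 1))) (u := X.indicator 1) (fun f hf => by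
          obtain ⟨f', hf', h'⟩ := h1 f hf
          exact ⟨f', hf', h'.symm⟩) hf
      rw [map_mulLeft_mul, h4] at h6
      rw [h5, ← map_mulLeft_mul]
      obtain ⟨f', hf', h'⟩ := h6
      rw [← h']
      exact mul_mem_mul_of_forall ih hf'
  refine ⟨N + M, fun f hf => ?_⟩
  obtain ⟨f', hf', h'⟩ := h2 N f hf
  rw [← h', pow_add]
  exact mul_le_mul' (pow_le_pow_left' hYT N) le_rfl (mul_mem_mul_of_forall hN hf')

theorem eq_zero_of_mem_pow_succ {T : Submodule ℂ (Ω → ℂ)} {ω : Ω} (h : ∀ f ∈ T, f ω = 0) {n : ℕ}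
    {f : Ω → ℂ} (hf : f ∈ T ^ (n + 1)) : f ω = 0 := by
  rw [pow_succ'] at hf
  exact eq_zero_of_mem_mul h hf

/-- The complement of a finite family of separated sets is separated. -/
theorem isSeparated_compl {T : Submodule ℂ (Ω → ℂ)} {ι : Type*} [Fintype ι] {X : ι → Set Ω}
    (hdisj : Pairwise (Function.onFun Disjoint X)) (hX : ∀ i, IsSeparated T (X i))
    (hne : {ω | (∃ f ∈ T, f ω ≠ 0) ∧ ∀ i, ω ∉ X i}.Nonempty) :
    IsSeparated T {ω | (∃ f ∈ T, f ω ≠ 0) ∧ ∀ i, ω ∉ X i} := by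
  refine ⟨hne, fun ω hω => hω.1, ?_⟩
  choose N hN using fun i => (hX i).exists_mul_mem
  have hNK : ∀ i, N i ≤ (∑ i, N i) + 1 := fun i => (Finset.single_le_sum
    (fun _ _ => Nat.zero_le _) (Finset.mem_univ i)).trans (Nat.le_succ _)
  refine ⟨(∑ i, N i) + 1, fun f hf => ?_⟩
  have h1 : {ω | (∃ f ∈ T, f ω ≠ 0) ∧ ∀ i, ω ∉ X i}.indicator 1 * f =
      f - ∑ i, (X i).indicator 1 * f := by
    ext ω
    simp only [Pi.mul_apply, Pi.sub_apply, Finset.sum_apply]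
    by_cases hω : ∃ i, ω ∈ X i
    · obtain ⟨i, hi⟩ := hω
      rw [Finset.sum_eq_single i]
      · rw [Set.indicator_of_notMem fun h => h.2 i hi, Set.indicator_of_mem hi]
        simp
      · intro j _ hij
        rw [Set.indicator_of_notMem fun h => Set.disjoint_left.1 (hdisj hij) h hi, zero_mul]
      · simp
    · push Not at hω
      rw [Finset.sum_eq_zero fun i _ => by rw [Set.indicator_of_notMem (hω i), zero_mul]]
      by_cases h2 : ∃ f ∈ T, f ω ≠ 0
      · have h3 : ω ∈ {ω | (∃ f ∈ T, f ω ≠ 0) ∧ ∀ i, ω ∉ X i} := ⟨h2, hω⟩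
        rw [Set.indicator_of_mem h3, Pi.one_apply, one_mul, sub_zero]
      · push Not at h2
        rw [eq_zero_of_mem_pow_succ h2 hf]
        simp
  rw [h1]
  exact Submodule.sub_mem _ hf (Submodule.sum_mem _ fun i _ => mul_mem_pow_of_le (hN i) (hNK i) hf)

/-- Projection of a connected curve from some of its points: the growth of the Hilbert function
drops by the number of the points, and by one for every separated set but one. -/
theorem exists_finrank_pow_add_le_of_chain {T : ℕ → Submodule ℂ (Ω → ℂ)} {z : ℕ → (Ω → ℂ)}
    {p : ℕ → Ω} {k : ℕ} (hT : ∀ r < k, T r = T (r + 1) ⊔ ℂ ∙ z r)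
    (hTp : ∀ r < k, ∀ y ∈ T (r + 1), y (p r) = 0) (hzp : ∀ r < k, z r (p r) ≠ 0)
    (hfg : ∀ r, (T r).FG) (hconn : ∀ X, IsSeparated (T 0) X → X = Set.univ) {r : ℕ} (hr : r ≤ k) :
    ∀ {ι : Type} [Fintype ι] {X : ι → Set Ω}, Pairwise (Function.onFun Disjoint X) →
      (∀ i, IsSeparated (T r) (X i)) →
      ∃ c : ℕ, ∀ m, Module.finrank ℂ ↥(T r ^ m) + (r + Fintype.card ι) * m ≤
        Module.finrank ℂ ↥(T 0 ^ m) + m + c := by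
  induction r with
  | zero =>
    intro ι _ X hdisj hX
    have hcard : Fintype.card ι ≤ 1 := by
      rw [Fintype.card_le_one_iff]
      intro i j
      by_contra hij
      have h1 := hdisj hij
      rw [Function.onFun, hconn _ (hX i), hconn _ (hX j)] at h1
      obtain ⟨ω, -⟩ := (hX i).nonempty
      exact Set.disjoint_left.1 h1 (Set.mem_univ ω) (Set.mem_univ ω)
    refine ⟨0, fun m => ?_⟩
    have := Nat.mul_le_mul_right m hcard
    rw [zero_add]
    omega
  | succ r ih =>
    intro ι _ X hdisj hX
    classical
    -- `acc i` says that the centre `p r` lies in the closure of `X i`. These sets contribute to the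
    -- drop of the Hilbert function; the others are already separated before the projection.
    set acc : ι → Prop := fun i => ∀ M : ℕ, ∀ g ∈ T r ^ M, g (p r) ≠ 0 → ∃ ω ∈ X i, g ω ≠ 0
    have hT' := hT r hr
    have hYT : T (r + 1) ≤ T r := hT' ▸ le_sup_left
    have hz : z r ∈ T r := hT' ▸ Submodule.mem_sup_right (Submodule.mem_span_singleton_self _)
    obtain ⟨c₁, hc₁⟩ := exists_finrank_pow_add_le (X := fun i : {i // acc i} => X i) hYT hz
      (hfg _) (hfg _) (hTp r hr) (hzp r hr) (fun i j hij => hdisj fun h => hij (Subtype.ext h))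
      (fun i => hX i) fun i => i.2
    have hsep : ∀ i : {i // ¬ acc i}, IsSeparated (T r) (X i) := by
      rintro ⟨i, hi⟩
      simp only [acc, not_forall, not_exists, not_and, not_not] at hi
      obtain ⟨M, g, hg, hgp, hgX⟩ := hi
      exact (hX i).sup_span hT' (hTp r hr) hg hgp hgX
    have hdisj' : Pairwise (Function.onFun Disjoint fun i : {i // ¬ acc i} => X i) :=
      fun i j hij => hdisj fun h => hij (Subtype.ext h)
    have hp : ∀ i, p r ∉ X i := by
      intro i hi
      obtain ⟨f, hf, hfp⟩ := (hX i).exists_ne_zero _ hi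
      exact hfp (hTp r hr f hf)
    -- The complement contains the centre, so it is one more separated set before the projection.
    -- This extra set pays for the step from `r` to `r + 1`.
    have hcompl := isSeparated_compl hdisj' hsep ⟨p r, ⟨_, hz, hzp r hr⟩, fun i => hp i⟩
    obtain ⟨c₂, hc₂⟩ := ih (Nat.le_of_succ_le hr) (ι := Option {i // ¬ acc i})
      (X := fun o => Option.casesOn' o {ω | (∃ f ∈ T r, f ω ≠ 0) ∧ ∀ i : {i // ¬ acc i}, ω ∉ X i}
        fun i => X i) (by
        rintro (_ | i) (_ | j) hij
        · exact (hij rfl).elim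
        · exact Set.disjoint_left.2 fun ω h1 h2 => h1.2 j h2
        · exact Set.disjoint_left.2 fun ω h1 h2 => h2.2 i h1
        · exact hdisj' fun h => hij (congrArg some h)) (by
        rintro (_ | i)
        exacts [hcompl, hsep i])
    refine ⟨c₁ + c₂, fun m => ?_⟩
    have h1 := hc₁ m
    have h2 := hc₂ m
    have h3 := Fintype.card_subtype_compl acc
    have h4 := Fintype.card_subtype_le acc
    rw [Fintype.card_option] at h2
    have h5 : r + 1 + Fintype.card ι = (r + (Fintype.card {i // ¬ acc i} + 1)) +
        Fintype.card {i // acc i} := by omega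
    rw [h5, add_mul]
    omega

end

/-- On a connected projective variety there are no nontrivial separated sets. -/
theorem IsSeparated.eq_univ {d : ℕ} {C : Set (PSpace d)} (hC : @IsConnected _ (zariski d) C)
    {X : Set C} (hX : IsSeparated ((linFun (Fin (d + 1) → ℂ)).map
      (pullback fun p : C => p.1.rep).toLinearMap) X) : X = Set.univ := by
  set T := (linFun (Fin (d + 1) → ℂ)).map (pullback fun p : C => p.1.rep).toLinearMap with hT
  let := zariski d
  -- If the characteristic function of `Z` acts on forms of degree `N`, then `Z` is a union of
  -- nonvanishing loci, so relatively open. This holds for `X` and for its complement.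
  have key : ∀ Z : Set C, (∃ N, ∀ f ∈ T ^ N, Z.indicator 1 * f ∈ T ^ N) →
      ∃ U : Set (PSpace d), IsOpen U ∧ ∀ p : C, p.1 ∈ U ↔ p ∈ Z := by
    rintro Z ⟨N, hN⟩
    refine ⟨⋃₀ {U | (∃ F : MvPolynomial (Fin (d + 1)) ℂ, F.IsHomogeneous N ∧
      U = {p : PSpace d | MvPolynomial.eval p.rep F ≠ 0}) ∧ ∀ p : C, p.1 ∈ U → p ∈ Z},
      isOpen_sUnion fun U hU => ?_, fun p => ⟨?_, fun hp => ?_⟩⟩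
    · obtain ⟨⟨F, hF, rfl⟩, -⟩ := hU
      exact TopologicalSpace.isOpen_generateFrom_of_mem ⟨N, F, hF, rfl⟩
    · rintro ⟨U, ⟨-, hU⟩, hp⟩
      exact hU p hp
    · obtain ⟨f, hf, hfp⟩ := exists_mem_linFun_pow_ne_zero p.1.rep_nonzero N
      have h1 : pullback (fun p : C => p.1.rep) f ∈ T ^ N := by
        rw [hT, ← Submodule.map_pow]
        exact ⟨f, hf, rfl⟩
      have h2 := hN _ h1
      rw [hT, ← Submodule.map_pow, ← map_evalAlong] at h2
      obtain ⟨F, hF, hFf⟩ := h2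
      have h3 : ∀ q : C, MvPolynomial.eval q.1.rep F = Z.indicator 1 q * f q.1.rep := fun q => by
        rw [← evalAlong_apply (fun p : C => p.1.rep) F q]
        exact congr_fun hFf q
      refine ⟨_, ⟨⟨F, hF, rfl⟩, fun q hq => ?_⟩, ?_⟩
      · by_contra hqZ
        rw [Set.mem_ofPred_eq, h3, Set.indicator_of_notMem hqZ, zero_mul] at hq
        exact hq rfl
      · rw [Set.mem_ofPred_eq, h3, Set.indicator_of_mem hp]
        simpa using hfp
  obtain ⟨U, hU, hUX⟩ := key X hX.exists_mul_mem
  obtain ⟨U', hU', hUX'⟩ := key Xᶜ (by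
    obtain ⟨N, hN⟩ := hX.exists_mul_mem
    refine ⟨N, fun f hf => ?_⟩
    have : Xᶜ.indicator 1 * f = f - X.indicator 1 * f := by
      rw [Set.indicator_compl]
      ring
    rw [this]
    exact Submodule.sub_mem _ hf (hN f hf))
  by_contra hne
  obtain ⟨q, hq⟩ := (Set.ne_univ_iff_exists_notMem X).1 hne
  obtain ⟨p, hp⟩ := hX.nonempty
  obtain ⟨s, hs, hs1, hs2⟩ := hC.isPreconnected U U' hU hU' (fun r hr => by
    by_cases h : (⟨r, hr⟩ : C) ∈ X
    · exact Or.inl ((hUX ⟨r, hr⟩).2 h)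
    · exact Or.inr ((hUX' ⟨r, hr⟩).2 h)) ⟨p, p.2, (hUX p).2 hp⟩ ⟨q, q.2, (hUX' q).2 hq⟩
  exact (hUX' ⟨s, hs⟩).1 hs2 ((hUX ⟨s, hs⟩).1 hs1)

/-! ### Homogeneous polynomials -/

open MvPolynomial in
/-- The components of highest degree of two polynomials with a homogeneous product. -/
theorem eq_homogeneousComponent_mul {σ : Type*} {p q : MvPolynomial σ ℂ} {n : ℕ} (hp : p ≠ 0)
    (hq : q ≠ 0) (h : (p * q).IsHomogeneous n) :
    p * q = homogeneousComponent p.totalDegree p * homogeneousComponent q.totalDegree q ∧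
      n = p.totalDegree + q.totalDegree := by
  have hn : n = p.totalDegree + q.totalDegree := by
    rw [← totalDegree_mul_of_isDomain hp hq, h.totalDegree (mul_ne_zero hp hq)]
  refine ⟨?_, hn⟩
  set P := homogeneousComponent p.totalDegree p
  set Q := homogeneousComponent q.totalDegree q
  have hP : P.IsHomogeneous p.totalDegree := homogeneousComponent_isHomogeneous _ _
  have hQ : Q.IsHomogeneous q.totalDegree := homogeneousComponent_isHomogeneous _ _
  have hlow : ∀ r : MvPolynomial σ ℂ, r ≠ homogeneousComponent r.totalDegree r →
      (r - homogeneousComponent r.totalDegree r).totalDegree < r.totalDegree := by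
    intro r hr
    have h0 : r - homogeneousComponent r.totalDegree r ≠ 0 := sub_ne_zero.2 hr
    refine lt_of_le_of_ne ((totalDegree_sub _ _).trans (max_le le_rfl
      (homogeneousComponent_isHomogeneous _ _).totalDegree_le)) fun heq => ?_
    obtain ⟨s, hs, hs'⟩ := Finset.exists_mem_eq_sup _ (support_nonempty.2 h0) fun s => s.sum fun _ e => e
    rw [← totalDegree, heq] at hs'
    rw [mem_support_iff, coeff_sub, coeff_homogeneousComponent, if_pos, sub_self] at hs
    · exact hs rfl
    · rw [hs', Finsupp.degree]
      rfl
  -- Everything but the product of the top components has degree below `n`.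
  have h1 : p * q = P * Q + ((p - P) * Q + p * (q - Q)) := by ring
  have h2 : ∀ r : MvPolynomial σ ℂ, r = 0 ∨ r.totalDegree < n → homogeneousComponent n r = 0 := by
    rintro r (rfl | hr)
    exacts [map_zero _, homogeneousComponent_eq_zero _ _ hr]
  have h3 : homogeneousComponent n ((p - P) * Q) = 0 := by
    apply h2
    by_cases hpP : p = P
    · exact Or.inl (by rw [← hpP, sub_self, zero_mul])
    · have h4 : (p - P).totalDegree < p.totalDegree := hlow p hpP
      have h5 := totalDegree_mul (p - P) Q
      have h6 := hQ.totalDegree_le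
      exact Or.inr (by omega)
  have h4 : homogeneousComponent n (p * (q - Q)) = 0 := by
    apply h2
    by_cases hqQ : q = Q
    · exact Or.inl (by rw [← hqQ, sub_self, mul_zero])
    · have h4 : (q - Q).totalDegree < q.totalDegree := hlow q hqQ
      have h5 := totalDegree_mul p (q - Q)
      exact Or.inr (by omega)
  have h5 := congrArg (homogeneousComponent n) h1
  rw [map_add, map_add, h3, h4, homogeneousComponent_eq_self h, homogeneousComponent_eq_self
    (hn ▸ hP.mul hQ), add_zero, add_zero] at h5
  exact h5

theorem isHomogeneous_of_mul {σ : Type*} {p q : MvPolynomial σ ℂ} {n : ℕ} (hp : p ≠ 0)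
    (hq : q ≠ 0) (h : (p * q).IsHomogeneous n) (hpn : p.IsHomogeneous p.totalDegree) :
    q.IsHomogeneous q.totalDegree ∧ n = p.totalDegree + q.totalDegree := by
  obtain ⟨h1, hn⟩ := eq_homogeneousComponent_mul hp hq h
  rw [MvPolynomial.homogeneousComponent_eq_self hpn] at h1
  refine ⟨?_, hn⟩
  have h2 := MvPolynomial.homogeneousComponent_isHomogeneous q.totalDegree q
  rwa [← mul_left_cancel₀ hp h1] at h2

theorem exists_isHomogeneous_of_dvd {σ : Type*} {F G : MvPolynomial σ ℂ} {a b : ℕ}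
    (hF : F.IsHomogeneous a) (hG : G.IsHomogeneous b) (hG0 : G ≠ 0) (h : F ∣ G) :
    ∃ U : MvPolynomial σ ℂ, ∃ c, U.IsHomogeneous c ∧ b = a + c ∧ G = F * U := by
  obtain ⟨U, rfl⟩ := h
  have hF0 := left_ne_zero_of_mul hG0
  have hU0 := right_ne_zero_of_mul hG0
  have h1 := hF.totalDegree hF0
  obtain ⟨h2, h3⟩ := isHomogeneous_of_mul hF0 hU0 hG (by rwa [h1])
  exact ⟨U, _, h2, by rw [h3, h1], rfl⟩

/-- Splitting off a homogeneous greatest common divisor. -/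
theorem exists_isRelPrime_of_isHomogeneous {σ : Type*} (a : ℕ) :
    ∀ (F G : MvPolynomial σ ℂ) (b : ℕ), F ≠ 0 → G ≠ 0 → F.IsHomogeneous a → G.IsHomogeneous b →
    ∃ (D F' G' : MvPolynomial σ ℂ) (c a' b' : ℕ), F = D * F' ∧ G = D * G' ∧ IsRelPrime F' G' ∧
      D.IsHomogeneous c ∧ F'.IsHomogeneous a' ∧ G'.IsHomogeneous b' ∧ a = c + a' := by
  induction a using Nat.strong_induction_on with
  | _ a ih =>
  intro F G b hF0 hG0 hF hG
  by_cases hrel : IsRelPrime F G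
  · exact ⟨1, F, G, 0, a, b, (one_mul _).symm, (one_mul _).symm, hrel,
      MvPolynomial.isHomogeneous_one _ _, hF, hG, (zero_add a).symm⟩
  simp only [IsRelPrime, not_forall] at hrel
  obtain ⟨E, ⟨u, rfl⟩, ⟨w, rfl⟩, hE⟩ := hrel
  have hE0 := left_ne_zero_of_mul hF0
  have hu0 := right_ne_zero_of_mul hF0
  have hw0 := right_ne_zero_of_mul hG0
  -- A common factor need not be given as homogeneous, but its top component also divides both forms
  -- and has positive degree, so splitting it off lowers the degree of `F`.
  obtain ⟨h1, h2⟩ := eq_homogeneousComponent_mul hE0 hu0 hF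
  obtain ⟨h3, -⟩ := eq_homogeneousComponent_mul hE0 hw0 hG
  have hdeg : E.totalDegree ≠ 0 := by
    intro h0
    apply hE
    rw [MvPolynomial.totalDegree_eq_zero_iff_eq_C.1 h0] at hE0 ⊢
    exact (isUnit_iff_ne_zero.2 fun h => hE0 (by rw [h, map_zero])).map MvPolynomial.C
  have hE' := MvPolynomial.homogeneousComponent_isHomogeneous E.totalDegree E
  have hu' := MvPolynomial.homogeneousComponent_isHomogeneous u.totalDegree u
  have hw' := MvPolynomial.homogeneousComponent_isHomogeneous w.totalDegree w
  rw [h1] at hF0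
  rw [h3] at hG0
  obtain ⟨D, F', G', c, a', b', h4, h5, h6, h7, h8, h9, h10⟩ := ih u.totalDegree (by omega) _ _ _
    (right_ne_zero_of_mul hF0) (right_ne_zero_of_mul hG0) hu' hw'
  refine ⟨_, F', G', _, a', b', ?_, ?_, h6, hE'.mul h7, h8, h9, by omega⟩
  · rw [h1, mul_assoc, ← h4]
  · rw [h3, mul_assoc, ← h5]

instance finite_homogeneousSubmodule {n m : ℕ} :
    Module.Finite ℂ (MvPolynomial.homogeneousSubmodule (Fin n) ℂ m) :=
  Module.Finite.iff_fg.2 (MvPolynomial.homogeneousSubmodule_fg _ _ m)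

/-- The dimension of the space of ternary forms. -/
theorem two_mul_finrank_homogeneousSubmodule (m : ℕ) :
    2 * Module.finrank ℂ (MvPolynomial.homogeneousSubmodule (Fin 3) ℂ m) = (m + 1) * (m + 2) := by
  have hmem : ∀ s : Fin 3 →₀ ℕ, s ∈ Finset.univ.finsuppAntidiag m ↔ s.degree = m := by
    intro s
    rw [Finset.mem_finsuppAntidiag, Finsupp.degree_eq_sum]
    simp
  have hspan : MvPolynomial.homogeneousSubmodule (Fin 3) ℂ m = Submodule.span ℂ (Set.range
      fun s : (Finset.univ : Finset (Fin 3)).finsuppAntidiag m =>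
        MvPolynomial.basisMonomials (Fin 3) ℂ s) := by
    refine le_antisymm (fun F hF => ?_) (Submodule.span_le.2 ?_)
    · rw [MvPolynomial.as_sum F]
      refine Submodule.sum_mem _ fun s hs => ?_
      have h1 : MvPolynomial.monomial s (F.coeff s) =
          F.coeff s • MvPolynomial.basisMonomials (Fin 3) ℂ s := by
        rw [MvPolynomial.coe_basisMonomials, MvPolynomial.smul_monomial, smul_eq_mul, mul_one]
      rw [h1]
      refine Submodule.smul_mem _ _ (Submodule.subset_span ⟨⟨s, (hmem s).2 ?_⟩, rfl⟩)
      by_contra h2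
      exact MvPolynomial.mem_support_iff.1 hs (hF.coeff_eq_zero h2)
    · rintro _ ⟨s, rfl⟩
      rw [MvPolynomial.coe_basisMonomials]
      exact MvPolynomial.isHomogeneous_monomial _ ((hmem s).1 s.2)
  have hli : LinearIndependent ℂ fun s : (Finset.univ : Finset (Fin 3)).finsuppAntidiag m =>
      MvPolynomial.basisMonomials (Fin 3) ℂ s :=
    (MvPolynomial.basisMonomials (Fin 3) ℂ).linearIndependent.comp _ Subtype.val_injective
  rw [hspan, finrank_span_eq_card hli, Fintype.card_coe, Finset.card_finsuppAntidiag_nat_eq_choose,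
    Finset.card_univ, Fintype.card_fin, show 3 + m - 1 = 2 + m by omega, ← Nat.choose_symm_add,
    Nat.choose_two_right, Nat.mul_div_cancel']
  · rw [show 2 + m - 1 = m + 1 by omega]
    ring
  · rw [show 2 + m - 1 = m + 1 by omega, show 2 + m = m + 1 + 1 by omega, mul_comm]
    exact (Nat.even_mul_succ_self _).two_dvd

/-! ### Conditions imposed by points, and intersections of plane curves. -/

theorem eval_eq_zero_of_isHomogeneous {σ : Type*} {F : MvPolynomial σ ℂ} {m : ℕ}
    (hF : F.IsHomogeneous m) (hm : m ≠ 0) : MvPolynomial.eval 0 F = 0 := by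
  have := eval_smul_of_isHomogeneous hF 0 0
  rwa [smul_zero, zero_pow hm, zero_mul] at this

/-- Separating a point from finitely many other points by a form. -/
theorem exists_isHomogeneous_eval_ne_zero {N : ℕ} (t : Finset (ℙ ℂ (Fin N → ℂ)))
    {P : ℙ ℂ (Fin N → ℂ)} (hP : P ∉ t) {m : ℕ} (hm : t.card ≤ m) :
    ∃ H : MvPolynomial (Fin N) ℂ, H.IsHomogeneous m ∧ MvPolynomial.eval P.rep H ≠ 0 ∧
      ∀ u ∈ t, MvPolynomial.eval u.rep H = 0 := by
  classical
  induction t using Finset.induction_on generalizing m with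
  | empty =>
    obtain ⟨f, hf, hfP⟩ := exists_mem_linFun_pow_ne_zero P.rep_nonzero m
    obtain ⟨H, hH, hHf⟩ := exists_isHomogeneous_of_mem_linFun_pow hf
    exact ⟨H, hH, by rwa [← hHf], by simp⟩
  | insert u t hu ih =>
    rw [Finset.mem_insert, not_or] at hP
    rw [Finset.card_insert_of_notMem hu] at hm
    obtain ⟨m, rfl⟩ : ∃ j, m = j + 1 := ⟨m - 1, by omega⟩
    obtain ⟨H, hH, hHP, hHt⟩ := ih hP.2 (m := m) (by omega)
    have h1 : P.rep ∉ ℂ ∙ u.rep := by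
      intro h
      obtain ⟨c, hc⟩ := Submodule.mem_span_singleton.1 h
      apply hP.1
      rw [← P.mk_rep, ← u.mk_rep, Projectivization.mk_eq_mk_iff']
      exact ⟨c, hc⟩
    obtain ⟨φ, hφP, hφ⟩ := Submodule.exists_le_ker_of_notMem h1
    obtain ⟨L, hL, hLφ⟩ := exists_isHomogeneous_of_mem_linFun_pow (m := 1) (f := φ)
      (by rw [pow_one]; exact dual_mem_linFun φ)
    refine ⟨H * L, hH.mul hL, ?_, fun w hw => ?_⟩
    · rw [map_mul, ← hLφ]
      exact mul_ne_zero hHP hφP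
    · rw [map_mul]
      rcases Finset.mem_insert.1 hw with rfl | hw
      · rw [← hLφ, show φ w.rep = 0 from hφ (Submodule.mem_span_singleton_self _), mul_zero]
      · rw [hHt w hw, zero_mul]

theorem finrank_map_mulLeft {σ : Type*} {F : MvPolynomial σ ℂ} (hF : F ≠ 0)
    (S : Submodule ℂ (MvPolynomial σ ℂ)) :
    Module.finrank ℂ (S.map (LinearMap.mulLeft ℂ F)) = Module.finrank ℂ S :=
  (Submodule.equivMapOfInjective _ (fun _ _ h => mul_left_cancel₀ hF h) S).finrank_eq.symm

/-- Two plane curves without common components meet in finitely many points. -/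
theorem finite_of_isRelPrime {F G : MvPolynomial (Fin 3) ℂ} {a b : ℕ} (hF0 : F ≠ 0) (hG0 : G ≠ 0)
    (hF : F.IsHomogeneous a) (hG : G.IsHomogeneous b) (hFG : IsRelPrime F G) :
    {P : ℙ ℂ (Fin 3 → ℂ) | MvPolynomial.eval P.rep F = 0 ∧
      MvPolynomial.eval P.rep G = 0}.Finite := by
  classical
  by_contra hinf
  -- A weak Bézout bound: in degree `n + a + b` the combinations of `F` and `G` have codimension at
  -- most `a * b`, by the dimension formula for ternary forms, whereas `a * b + 1` common zeros
  -- would impose that many independent conditions.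
  obtain ⟨t, ht, htcard⟩ := Set.Infinite.exists_subset_card_eq hinf (a * b + 1)
  set n := a * b + 1 with hn
  set S : ℕ → Submodule ℂ (MvPolynomial (Fin 3) ℂ) :=
    fun m => MvPolynomial.homogeneousSubmodule (Fin 3) ℂ m with hS
  have hFS : (S (n + b)).map (LinearMap.mulLeft ℂ F) ≤ S (n + a + b) := by
    rintro _ ⟨p, hp, rfl⟩
    have := hF.mul hp
    rwa [show a + (n + b) = n + a + b by ring] at this
  have hGS : (S (n + a)).map (LinearMap.mulLeft ℂ G) ≤ S (n + a + b) := by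
    rintro _ ⟨p, hp, rfl⟩
    have := hG.mul hp
    rwa [show b + (n + a) = n + a + b by ring] at this
  have hinf' : (S (n + b)).map (LinearMap.mulLeft ℂ F) ⊓ (S (n + a)).map (LinearMap.mulLeft ℂ G) ≤
      (S n).map (LinearMap.mulLeft ℂ (F * G)) := by
    rintro _ ⟨⟨p, hp, rfl⟩, ⟨q, hq, hpq⟩⟩
    simp only [LinearMap.mulLeft_apply] at hpq ⊢
    by_cases hp0 : p = 0
    · rw [hp0, mul_zero]
      exact Submodule.zero_mem _
    have h1 : G ∣ p := hFG.symm.dvd_of_dvd_mul_left ⟨q, hpq.symm⟩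
    obtain ⟨U, c, hU, hc, rfl⟩ := exists_isHomogeneous_of_dvd hG hp hp0 h1
    refine ⟨U, ?_, by simp⟩
    obtain rfl : c = n := by omega
    exact hU
  choose H hH hHP hHt using fun P : t => exists_isHomogeneous_eval_ne_zero (t.erase P.1)
    (P := P.1) (Finset.notMem_erase _ _) (m := n + a + b)
    ((Finset.card_le_card (Finset.erase_subset _ _)).trans (by omega))
  have key : ∀ c : t → ℂ, ∑ P, c P • H P ∈ (S (n + b)).map (LinearMap.mulLeft ℂ F) ⊔
      (S (n + a)).map (LinearMap.mulLeft ℂ G) → ∀ P, c P = 0 := by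
    intro c hc P
    obtain ⟨_, ⟨p, -, rfl⟩, _, ⟨q, -, rfl⟩, h1⟩ := Submodule.mem_sup.1 hc
    have h2 := congrArg (MvPolynomial.eval P.1.rep) h1
    obtain ⟨h3, h4⟩ := ht P.2
    simp only [LinearMap.mulLeft_apply, map_add, map_mul, h3, h4, zero_mul, add_zero, map_sum,
      MvPolynomial.smul_eval] at h2
    rw [Finset.sum_eq_single P] at h2
    · exact (mul_eq_zero.1 h2.symm).resolve_right (hHP P)
    · intro Q _ hQP
      rw [hHt Q P.1 (Finset.mem_erase.2 ⟨fun h => hQP (Subtype.ext h.symm), P.2⟩), mul_zero]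
    · simp
  have h1 := finrank_add_card_le (sup_le hFS hGS) hH key
  rw [Fintype.card_coe, htcard] at h1
  have h2 := Submodule.finrank_sup_add_finrank_inf_eq ((S (n + b)).map (LinearMap.mulLeft ℂ F))
    ((S (n + a)).map (LinearMap.mulLeft ℂ G))
  have h3 := Submodule.finrank_mono hinf'
  rw [finrank_map_mulLeft hF0, finrank_map_mulLeft hG0] at h2
  rw [finrank_map_mulLeft (mul_ne_zero hF0 hG0)] at h3
  have e1 := two_mul_finrank_homogeneousSubmodule n
  have e2 := two_mul_finrank_homogeneousSubmodule (n + a)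
  have e3 := two_mul_finrank_homogeneousSubmodule (n + b)
  have e4 := two_mul_finrank_homogeneousSubmodule (n + a + b)
  nlinarith

theorem exists_quadraticForm_of_isHomogeneous {F : MvPolynomial (Fin 3) ℂ} (hF : F.IsHomogeneous 2)
    (hF0 : F ≠ 0) :
    ∃ Q : QuadraticForm ℂ (Fin 3 → ℂ), Q ≠ 0 ∧ ∀ v, Q v = MvPolynomial.eval v F := by
  have h1 : ∀ g ∈ linFun (Fin 3 → ℂ) ^ 2, ∃ Q : QuadraticForm ℂ (Fin 3 → ℂ), ∀ v, Q v = g v := by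
    intro g hg
    rw [pow_two] at hg
    induction hg using Submodule.mul_induction_on' with
    | mem_mul_mem f hf g hg =>
      obtain ⟨φ, rfl⟩ := hf
      obtain ⟨χ, rfl⟩ := hg
      exact ⟨QuadraticMap.linMulLin φ χ, fun v => rfl⟩
    | add f _ g _ hf hg =>
      obtain ⟨Q, hQ⟩ := hf
      obtain ⟨Q', hQ'⟩ := hg
      exact ⟨Q + Q', fun v => by rw [add_apply, hQ, hQ', Pi.add_apply]⟩
  have h2 : evalAlong id F ∈ (linFun (Fin 3 → ℂ) ^ 2).map (pullback id).toLinearMap := by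
    rw [← map_evalAlong]
    exact ⟨F, hF, rfl⟩
  obtain ⟨g, hg, hgF⟩ := h2
  obtain ⟨Q, hQ⟩ := h1 g hg
  have h3 : ∀ v, Q v = MvPolynomial.eval v F := fun v => by
    rw [hQ]
    exact (congr_fun hgF v).trans (evalAlong_apply id F v)
  refine ⟨Q, fun h => hF0 (MvPolynomial.funext fun v => ?_), h3⟩
  rw [← h3, h, map_zero]
  rfl

theorem exists_line_through (t : Finset (ℙ ℂ (Fin 3 → ℂ))) (ht : t.card ≤ 2) :
    ∃ L : MvPolynomial (Fin 3) ℂ, L ≠ 0 ∧ L.IsHomogeneous 1 ∧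
      ∀ P ∈ t, MvPolynomial.eval P.rep L = 0 := by
  obtain ⟨φ, hφ0, hφ⟩ := exists_dual_of_span_ne_top (fun P : t => P.1.rep) (fun h => by
    have h1 := finrank_range_le_card (R := ℂ) fun P : t => P.1.rep
    rw [Set.finrank, h, finrank_top, Module.finrank_fin_fun, Fintype.card_coe] at h1
    omega)
  obtain ⟨L, hL, hLφ⟩ := exists_isHomogeneous_of_mem_linFun_pow (m := 1) (f := φ)
    (by rw [pow_one]; exact dual_mem_linFun φ)
  refine ⟨L, fun h => hφ0 (LinearMap.ext fun v => ?_), hL, fun P hP => ?_⟩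
  · rw [hLφ, h, map_zero]
    rfl
  · rw [← hLφ]
    exact hφ ⟨P, hP⟩

/-! ### Sets in the plane whose Hilbert function grows slowly. -/

section

variable {Ω : Type*}

theorem exists_eq_smul_rep {N : ℕ} {v : Fin N → ℂ} (hv : v ≠ 0) :
    ∃ (P : ℙ ℂ (Fin N → ℂ)) (c : ℂ), c ≠ 0 ∧ v = c • P.rep := by
  obtain ⟨κ, hκ⟩ := Projectivization.exists_smul_eq_mk_rep ℂ v hv
  refine ⟨Projectivization.mk ℂ v hv, (κ⁻¹ : ℂˣ), κ⁻¹.ne_zero, ?_⟩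
  rw [← hκ, ← Units.smul_def, inv_smul_smul]

theorem eq_of_smul_rep_eq {N : ℕ} {P P' : ℙ ℂ (Fin N → ℂ)} {c c' : ℂ} (hc : c ≠ 0)
    (h : c • P.rep = c' • P'.rep) : P = P' := by
  rw [← P.mk_rep, ← P'.mk_rep, Projectivization.mk_eq_mk_iff']
  refine ⟨c⁻¹ * c', ?_⟩
  rw [mul_smul, ← h, smul_smul, inv_mul_cancel₀ hc, one_smul]

/-- The set of the points of the image of `φ` in the projective space. -/
def projImage {N : ℕ} (φ : Ω → (Fin N → ℂ)) : Set (ℙ ℂ (Fin N → ℂ)) :=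
  {P | ∃ (ω : Ω) (c : ℂ), c ≠ 0 ∧ φ ω = c • P.rep}

theorem map_linFun_pow {N : ℕ} (φ : Ω → (Fin N → ℂ)) (m : ℕ) :
    (linFun (Fin N → ℂ)).map (pullback φ).toLinearMap ^ m =
      (MvPolynomial.homogeneousSubmodule (Fin N) ℂ m).map (evalAlong φ).toLinearMap := by
  rw [map_evalAlong, Submodule.map_pow]

theorem exists_mem_map_linFun_ne_zero {N : ℕ} (φ : Ω → (Fin N → ℂ)) {ω : Ω} (h : φ ω ≠ 0) :
    ∃ f ∈ (linFun (Fin N → ℂ)).map (pullback φ).toLinearMap, f ω ≠ 0 := by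
  obtain ⟨f, hf, hfω⟩ := exists_mem_linFun_pow_ne_zero h 1
  rw [pow_one] at hf
  exact ⟨_, ⟨f, hf, rfl⟩, hfω⟩

/-- The fibre over a point of the image outside of a hypersurface is separated, if the image has
only finitely many points outside of the hypersurface. -/
theorem isSeparated_fibre {N δ : ℕ} {φ : Ω → (Fin N → ℂ)} {F : MvPolynomial (Fin N) ℂ}
    (hF : F.IsHomogeneous δ) {Z : Finset (ℙ ℂ (Fin N → ℂ))}
    (hZ : ∀ P, P ∈ Z ↔ P ∈ projImage φ ∧ MvPolynomial.eval P.rep F ≠ 0)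
    {P : ℙ ℂ (Fin N → ℂ)} (hP : P ∈ Z) :
    IsSeparated ((linFun (Fin N → ℂ)).map (pullback φ).toLinearMap)
      {ω | ∃ c : ℂ, c ≠ 0 ∧ φ ω = c • P.rep} := by
  classical
  obtain ⟨ω₀, hω₀⟩ := ((hZ P).1 hP).1
  refine ⟨⟨ω₀, hω₀⟩, ?_, δ + (Z.card + 1), ?_⟩
  · rintro ω ⟨c, hc, hω⟩
    exact exists_mem_map_linFun_ne_zero φ (by rw [hω]; exact smul_ne_zero hc P.rep_nonzero)
  rw [map_linFun_pow]
  rintro _ ⟨G, hG, rfl⟩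
  -- On the image, `F * H` is nonzero only over `P`, so a multiple of it agrees with `G` cut off to
  -- the fibre. The `+ 1` keeps the degree positive, so that it vanishes also where `φ` is zero.
  obtain ⟨H, hH, hHP, hHZ⟩ := exists_isHomogeneous_eval_ne_zero (Z.erase P)
    (Finset.notMem_erase P Z) (m := Z.card + 1)
    ((Finset.card_le_card (Finset.erase_subset _ _)).trans (Nat.le_succ _))
  have hFH := hF.mul hH
  have hFHP : MvPolynomial.eval P.rep (F * H) ≠ 0 := by
    rw [map_mul]
    exact mul_ne_zero ((hZ P).1 hP).2 hHP
  refine ⟨(MvPolynomial.eval P.rep G / MvPolynomial.eval P.rep (F * H)) • (F * H),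
    Submodule.smul_mem _ _ hFH, ?_⟩
  ext ω
  simp only [AlgHom.toLinearMap_apply, evalAlong_apply, MvPolynomial.smul_eval, Pi.mul_apply]
  by_cases hω : ω ∈ {ω | ∃ c : ℂ, c ≠ 0 ∧ φ ω = c • P.rep}
  · rw [Set.indicator_of_mem hω, Pi.one_apply, one_mul]
    obtain ⟨c, hc, hω⟩ := hω
    rw [hω, eval_smul_of_isHomogeneous hFH, eval_smul_of_isHomogeneous hG]
    field_simp
  · rw [Set.indicator_of_notMem hω, zero_mul]
    suffices h : MvPolynomial.eval (φ ω) (F * H) = 0 by rw [h, mul_zero]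
    by_cases h0 : φ ω = 0
    · rw [h0]
      exact eval_eq_zero_of_isHomogeneous hFH (by omega)
    obtain ⟨P', c, hc, hP'⟩ := exists_eq_smul_rep h0
    rw [hP', eval_smul_of_isHomogeneous hFH, map_mul]
    by_cases h1 : MvPolynomial.eval P'.rep F = 0
    · rw [h1, zero_mul, mul_zero]
    · rw [hHZ P' (Finset.mem_erase.2 ⟨fun h => hω ⟨c, hc, by rw [hP', h]⟩,
        (hZ P').2 ⟨⟨ω, c, hc, hP'⟩, h1⟩⟩), mul_zero, mul_zero]

theorem disjoint_fibre {N : ℕ} {φ : Ω → (Fin N → ℂ)} {P P' : ℙ ℂ (Fin N → ℂ)} (h : P ≠ P') :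
    Disjoint {ω | ∃ c : ℂ, c ≠ 0 ∧ φ ω = c • P.rep} {ω | ∃ c : ℂ, c ≠ 0 ∧ φ ω = c • P'.rep} := by
  rw [Set.disjoint_left]
  rintro ω ⟨c, hc, h1⟩ ⟨c', -, h2⟩
  exact h (eq_of_smul_rep_eq hc (h1.symm.trans h2))

theorem eval_eq_zero_of_projImage {N m : ℕ} {φ : Ω → (Fin N → ℂ)} {G : MvPolynomial (Fin N) ℂ}
    (hG : G.IsHomogeneous m) (hm : m ≠ 0)
    (h : ∀ P ∈ projImage φ, MvPolynomial.eval P.rep G = 0) (ω : Ω) :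
    MvPolynomial.eval (φ ω) G = 0 := by
  by_cases h0 : φ ω = 0
  · rw [h0]
    exact eval_eq_zero_of_isHomogeneous hG hm
  obtain ⟨P, c, hc, hP⟩ := exists_eq_smul_rep h0
  rw [hP, eval_smul_of_isHomogeneous hG, h P ⟨ω, c, hc, hP⟩, mul_zero]

/-- The plane curve of minimal degree which contains all but finitely many points of the image of
`φ` divides every form which vanishes on the image. -/
theorem dvd_of_minimal {δ m : ℕ} {φ : Ω → (Fin 3 → ℂ)} {F : MvPolynomial (Fin 3) ℂ} (hF0 : F ≠ 0)
    (hF : F.IsHomogeneous δ)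
    (hfin : {P | P ∈ projImage φ ∧ MvPolynomial.eval P.rep F ≠ 0}.Finite)
    (hmin : ∀ (D : MvPolynomial (Fin 3) ℂ) (c : ℕ), D ≠ 0 → D.IsHomogeneous c →
      {P | P ∈ projImage φ ∧ MvPolynomial.eval P.rep D ≠ 0}.Finite → δ ≤ c)
    {G : MvPolynomial (Fin 3) ℂ} (hG0 : G ≠ 0) (hG : G.IsHomogeneous m)
    (h : ∀ ω, MvPolynomial.eval (φ ω) G = 0) : F ∣ G := by
  -- The common divisor `D` still contains all but finitely many image points, as the coprime
  -- cofactors meet in a finite set. Minimality of `δ` then makes `F'` constant.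
  obtain ⟨D, F', G', c, a', b', rfl, rfl, hrel, hD, hF', hG', hdeg⟩ :=
    exists_isRelPrime_of_isHomogeneous δ F G m hF0 hG0 hF hG
  have hD0 := left_ne_zero_of_mul hF0
  have hF'0 := right_ne_zero_of_mul hF0
  have h1 := hmin D c hD0 hD (by
    refine (hfin.union (finite_of_isRelPrime hF'0 (right_ne_zero_of_mul hG0) hF' hG'
      hrel)).subset ?_
    rintro P ⟨hP, hPD⟩
    by_cases hPF : MvPolynomial.eval P.rep F' = 0
    · refine Or.inr ⟨hPF, ?_⟩
      obtain ⟨ω, c', hc', hω⟩ := hP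
      have h2 := h ω
      rw [hω, eval_smul_of_isHomogeneous hG, map_mul] at h2
      exact (mul_eq_zero.1 ((mul_eq_zero.1 h2).resolve_left (pow_ne_zero _ hc'))).resolve_left hPD
    · refine Or.inl ⟨hP, ?_⟩
      rw [map_mul]
      exact mul_ne_zero hPD hPF)
  obtain rfl : a' = 0 := by omega
  refine mul_dvd_mul_left D ?_
  have h2 := MvPolynomial.totalDegree_eq_zero_iff_eq_C.1 (hF'.totalDegree hF'0)
  have h3 : IsUnit F' := by
    rw [h2]
    refine (isUnit_iff_ne_zero.2 fun h => hF'0 ?_).map MvPolynomial.C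
    rw [h2, h, map_zero]
  exact h3.dvd

/-- The Hilbert function of a set which lies, up to finitely many points, on a plane curve of
minimal degree `δ`. -/
theorem finrank_homogeneousSubmodule_le {δ : ℕ} {φ : Ω → (Fin 3 → ℂ)}
    {F : MvPolynomial (Fin 3) ℂ} (hF0 : F ≠ 0) (hF : F.IsHomogeneous δ)
    (hdvd : ∀ (m : ℕ) (G : MvPolynomial (Fin 3) ℂ), G ≠ 0 → G.IsHomogeneous m →
      (∀ ω, MvPolynomial.eval (φ ω) G = 0) → F ∣ G) (n : ℕ) :
    Module.finrank ℂ (MvPolynomial.homogeneousSubmodule (Fin 3) ℂ (δ + n)) ≤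
      Module.finrank ℂ ↥((linFun (Fin 3 → ℂ)).map (pullback φ).toLinearMap ^ (δ + n)) +
        Module.finrank ℂ (MvPolynomial.homogeneousSubmodule (Fin 3) ℂ n) := by
  set S := MvPolynomial.homogeneousSubmodule (Fin 3) ℂ (δ + n) with hS
  have h1 := LinearMap.finrank_range_add_finrank_ker ((evalAlong φ).toLinearMap.domRestrict S)
  rw [LinearMap.domRestrict, LinearMap.range_comp, Submodule.range_subtype, ← map_linFun_pow] at h1
  have h2 : (LinearMap.ker ((evalAlong φ).toLinearMap ∘ₗ S.subtype)).map S.subtype ≤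
      (MvPolynomial.homogeneousSubmodule (Fin 3) ℂ n).map (LinearMap.mulLeft ℂ F) := by
    rintro _ ⟨⟨G, hG⟩, hGφ, rfl⟩
    have hGφ' : ∀ ω, MvPolynomial.eval (φ ω) G = 0 := fun ω => by
      rw [← evalAlong_apply φ G ω]
      exact congr_fun hGφ ω
    by_cases hG0 : G = 0
    · subst hG0
      exact Submodule.zero_mem _
    obtain ⟨U, c, hU, hc, rfl⟩ := exists_isHomogeneous_of_dvd hF hG hG0 (hdvd _ G hG0 hG hGφ')
    obtain rfl : c = n := by omega
    exact ⟨U, hU, rfl⟩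
  have h3 := Submodule.finrank_mono h2
  rw [finrank_map_mulLeft hF0, ← (Submodule.equivMapOfInjective _ S.injective_subtype _).finrank_eq] at h3
  omega

/-- If the Hilbert function of a set in the plane grows as slowly as that of a conic, even when
separated subsets are taken into account, then the set is contained in a conic. -/
theorem exists_conic {φ : Ω → (Fin 3 → ℂ)}
    (h : ∀ {ι : Type} [Fintype ι] {X : ι → Set Ω}, Pairwise (Function.onFun Disjoint X) →
      (∀ i, IsSeparated ((linFun (Fin 3 → ℂ)).map (pullback φ).toLinearMap) (X i)) →
      ∃ c : ℕ, ∀ m, Module.finrank ℂ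
        ↥((linFun (Fin 3 → ℂ)).map (pullback φ).toLinearMap ^ m) + Fintype.card ι * m ≤
          3 * m + c) :
    ∃ Q : QuadraticForm ℂ (Fin 3 → ℂ), Q ≠ 0 ∧ ∀ ω, Q (φ ω) = 0 := by
  classical
  suffices hW : ∃ F : MvPolynomial (Fin 3) ℂ, F ≠ 0 ∧ F.IsHomogeneous 2 ∧
      ∀ P ∈ projImage φ, MvPolynomial.eval P.rep F = 0 by
    obtain ⟨F, hF0, hF, hFW⟩ := hW
    obtain ⟨Q, hQ0, hQ⟩ := exists_quadraticForm_of_isHomogeneous hF hF0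
    exact ⟨Q, hQ0, fun ω => by rw [hQ, eval_eq_zero_of_projImage hF two_ne_zero hFW]⟩
  have hex : ∃ δ, ∃ F : MvPolynomial (Fin 3) ℂ, F ≠ 0 ∧ F.IsHomogeneous δ ∧
      {P | P ∈ projImage φ ∧ MvPolynomial.eval P.rep F ≠ 0}.Finite := by
    obtain ⟨c, hc⟩ := h (ι := Empty) (X := Empty.elim) (fun i => i.elim) (fun i => i.elim)
    -- In this degree the ternary forms have dimension greater than `3 * (c + 5) + c`, so some
    -- nonzero form vanishes on the image.
    refine ⟨c + 5, ?_⟩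
    by_contra! hno
    have h1 := hc (c + 5)
    have h2 := two_mul_finrank_homogeneousSubmodule (c + 5)
    have h3 : Module.finrank ℂ ((MvPolynomial.homogeneousSubmodule (Fin 3) ℂ (c + 5)).map
        (evalAlong φ).toLinearMap) =
        Module.finrank ℂ (MvPolynomial.homogeneousSubmodule (Fin 3) ℂ (c + 5)) := by
      rw [← Submodule.range_subtype (MvPolynomial.homogeneousSubmodule (Fin 3) ℂ (c + 5)),
        ← LinearMap.range_comp, Submodule.range_subtype]
      refine LinearMap.finrank_range_of_inj ?_
      rw [← LinearMap.ker_eq_bot, Submodule.eq_bot_iff]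
      rintro ⟨G, hG⟩ hGφ
      by_contra hG0
      refine hno G (fun h => hG0 (Subtype.ext h)) hG (Set.finite_empty.subset ?_)
      rintro P ⟨⟨ω, a, ha, hω⟩, hP⟩
      have h4 : MvPolynomial.eval (φ ω) G = 0 := by
        rw [← evalAlong_apply φ G ω]
        exact congr_fun hGφ ω
      rw [hω, eval_smul_of_isHomogeneous hG] at h4
      exact hP ((mul_eq_zero.1 h4).resolve_left (pow_ne_zero _ ha))
    rw [map_linFun_pow, h3, Fintype.card_empty] at h1
    nlinarith
  obtain ⟨F, hF0, hF, hfin⟩ := Nat.find_spec hex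
  set δ := Nat.find hex with hδ
  have hmin : ∀ (D : MvPolynomial (Fin 3) ℂ) (c : ℕ), D ≠ 0 → D.IsHomogeneous c →
      {P | P ∈ projImage φ ∧ MvPolynomial.eval P.rep D ≠ 0}.Finite → δ ≤ c :=
    fun D c hD0 hD hDfin => Nat.find_min' hex ⟨D, hD0, hD, hDfin⟩
  have hrank := finrank_homogeneousSubmodule_le hF0 hF fun m G hG0 hG hGφ =>
    dvd_of_minimal hF0 hF hfin hmin hG0 hG hGφ
  obtain ⟨Z, hZ⟩ : ∃ Z : Finset (ℙ ℂ (Fin 3 → ℂ)),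
      ∀ P, P ∈ Z ↔ P ∈ projImage φ ∧ MvPolynomial.eval P.rep F ≠ 0 :=
    ⟨hfin.toFinset, fun P => by rw [Set.Finite.mem_toFinset]; rfl⟩
  have hsep : ∀ P : Z, IsSeparated ((linFun (Fin 3 → ℂ)).map (pullback φ).toLinearMap)
      {ω | ∃ c : ℂ, c ≠ 0 ∧ φ ω = c • P.1.rep} := fun P => isSeparated_fibre hF hZ P.2
  have hdisj : Pairwise (Function.onFun Disjoint fun P : Z =>
      {ω | ∃ c : ℂ, c ≠ 0 ∧ φ ω = c • P.1.rep}) :=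
    fun P P' hPP' => disjoint_fibre fun h => hPP' (Subtype.ext h)
  -- Here the image is the finite set `Z`. Its fibres are separated, so there are at most three
  -- points, which lie on two lines.
  by_cases hδ0 : δ = 0
  · have hWZ : ∀ P ∈ projImage φ, P ∈ Z := by
      intro P hP
      refine (hZ P).2 ⟨hP, fun h0 => hF0 ?_⟩
      rw [hδ0, ← MvPolynomial.totalDegree_zero_iff_isHomogeneous,
        MvPolynomial.totalDegree_eq_zero_iff_eq_C] at hF
      rw [hF, MvPolynomial.eval_C] at h0
      rw [hF, h0, map_zero]
    obtain ⟨c, hc⟩ := h hdisj hsep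
    have hcard : Z.card ≤ 3 := by
      have h1 := hc (c + 1)
      rw [Fintype.card_coe] at h1
      by_contra h2
      have h3 := Nat.mul_le_mul_right (c + 1) (show 4 ≤ Z.card by omega)
      omega
    rcases Z.eq_empty_or_nonempty with rfl | ⟨P₀, hP₀⟩
    · obtain ⟨L, hL0, hL, -⟩ := exists_line_through ∅ (by simp)
      exact ⟨L * L, mul_ne_zero hL0 hL0, hL.mul hL,
        fun P hP => (Finset.notMem_empty P (hWZ P hP)).elim⟩
    · obtain ⟨L, hL0, hL, hLZ⟩ := exists_line_through (Z.erase P₀) (by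
        rw [Finset.card_erase_of_mem hP₀]
        omega)
      obtain ⟨L', hL'0, hL', hL'Z⟩ := exists_line_through {P₀} (by simp)
      refine ⟨L * L', mul_ne_zero hL0 hL'0, hL.mul hL', fun P hP => ?_⟩
      rw [map_mul, mul_eq_zero]
      by_cases hPP₀ : P = P₀
      · exact Or.inr (hL'Z P (Finset.mem_singleton.2 hPP₀))
      · exact Or.inl (hLZ P (Finset.mem_erase.2 ⟨hPP₀, hWZ P hP⟩))
  -- For `δ > 0` the image is infinite, so the complement of the exceptional fibres is nonempty and
  -- counts as one more separated set.
  have hcompl := isSeparated_compl hdisj hsep (by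
    by_contra hne
    apply hδ0
    rw [← Nat.le_zero]
    refine hmin 1 0 one_ne_zero (MvPolynomial.isHomogeneous_one _ _) (Z.finite_toSet.subset ?_)
    rintro P ⟨⟨ω, c, hc, hω⟩, -⟩
    by_contra hPZ
    refine hne ⟨ω, exists_mem_map_linFun_ne_zero φ (by
      rw [hω]
      exact smul_ne_zero hc P.rep_nonzero), ?_⟩
    rintro ⟨P', hP'⟩ ⟨c', -, hω'⟩
    rw [eq_of_smul_rep_eq hc (hω.symm.trans hω')] at hPZ
    exact hPZ hP')
  obtain ⟨c, hc⟩ := h (ι := Option Z)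
    (X := fun o => Option.casesOn' o {ω | (∃ f ∈ (linFun (Fin 3 → ℂ)).map
      (pullback φ).toLinearMap, f ω ≠ 0) ∧ ∀ P : Z, ω ∉ {ω | ∃ c : ℂ, c ≠ 0 ∧ φ ω = c • P.1.rep}}
        fun P : Z => {ω | ∃ c : ℂ, c ≠ 0 ∧ φ ω = c • P.1.rep}) (by
    rintro (_ | P) (_ | P') hPP'
    · exact (hPP' rfl).elim
    · exact Set.disjoint_left.2 fun ω h1 h2 => h1.2 P' h2
    · exact Set.disjoint_left.2 fun ω h1 h2 => h2.2 P h1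
    · exact hdisj fun h => hPP' (congrArg some h)) (by
    rintro (_ | P)
    exacts [hcompl, hsep P])
  -- The curve of degree `δ` accounts for growth at least `δ`, the separated sets for `Z.card + 1`
  -- more, and the total is at most three. The chosen degree is large enough to outweigh the
  -- constants.
  have hcard : δ + Z.card ≤ 2 := by
    by_contra hlt
    have h1 := hc (δ + (3 * δ + c + 1))
    have h2 := hrank (3 * δ + c + 1)
    have h3 := two_mul_finrank_homogeneousSubmodule (3 * δ + c + 1)
    have h4 := two_mul_finrank_homogeneousSubmodule (δ + (3 * δ + c + 1))
    rw [Fintype.card_option, Fintype.card_coe] at h1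
    obtain ⟨n, hn⟩ : ∃ n, n = 3 * δ + c + 1 := ⟨_, rfl⟩
    rw [← hn] at h1 h2 h3 h4
    have h5 := Nat.mul_le_mul_right n (show 4 ≤ δ + Z.card + 1 by omega)
    have h6 : (δ + n + 1) * (δ + n + 2) + 2 * ((Z.card + 1) * (δ + n)) ≤
        (n + 1) * (n + 2) + 2 * (3 * (δ + n) + c) := by omega
    have h7 : 0 ≤ Z.card * δ := Nat.zero_le _
    nlinarith
  by_cases hδ1 : δ = 1
  · obtain ⟨L, hL0, hL, hLZ⟩ := exists_line_through Z (by omega)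
    rw [hδ1] at hF
    refine ⟨F * L, mul_ne_zero hF0 hL0, hF.mul hL, fun P hP => ?_⟩
    rw [map_mul, mul_eq_zero]
    by_cases hPF : MvPolynomial.eval P.rep F = 0
    · exact Or.inl hPF
    · exact Or.inr (hLZ P ((hZ P).2 ⟨hP, hPF⟩))
  · have hδ2 : δ = 2 := by omega
    have hZ0 : Z = ∅ := Finset.card_eq_zero.1 (by omega)
    rw [hδ2] at hF
    refine ⟨F, hF0, hF, fun P hP => ?_⟩
    by_contra hPF
    have := (hZ P).2 ⟨hP, hPF⟩
    rw [hZ0] at this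
    exact Finset.notMem_empty P this

end

/-! ### Points of a quasi-Veronese curve -/

theorem map_linFun_eq_span {X V ι : Type*} [AddCommGroup V] [Module ℂ V] [Fintype ι]
    (B : Module.Basis ι ℂ V) (ψ : X → V) : (linFun V).map (pullback ψ).toLinearMap =
      Submodule.span ℂ (Set.range fun i x => B.repr (ψ x) i) := by
  apply le_antisymm
  · rintro _ ⟨_, ⟨φ, rfl⟩, rfl⟩
    have h : (pullback ψ).toLinearMap (LinearMap.ltoFun ℂ V ℂ ℂ φ) =
        ∑ i, φ (B i) • fun x => B.repr (ψ x) i := by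
      ext x
      simp only [AlgHom.toLinearMap_apply, pullback_apply, LinearMap.ltoFun_apply,
        Finset.sum_apply, Pi.smul_apply]
      conv_lhs => rw [← B.sum_repr (ψ x)]
      rw [map_sum]
      exact Finset.sum_congr rfl fun i _ => by rw [map_smul, smul_eq_mul, smul_eq_mul, mul_comm]
    rw [h]
    exact Submodule.sum_mem _ fun i _ => Submodule.smul_mem _ _ (Submodule.subset_span ⟨i, rfl⟩)
  · rw [Submodule.span_le]
    rintro _ ⟨i, rfl⟩
    exact ⟨_, dual_mem_linFun (B.coord i), rfl⟩

theorem exists_basis_of_tri_ne_zero {k : ℕ} {q : Fin k → (Fin (k + 3) → ℂ)}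
    {a b c : Fin (k + 3) → ℂ} (h : tri q a b c ≠ 0) :
    ∃ B : Module.Basis (Fin 3 ⊕ Fin k) ℂ (Fin (k + 3) → ℂ), ∀ i, B (Sum.inr i) = q i := by
  have h1 : LinearIndependent ℂ
      (Matrix.of (Matrix.vecCons a (Matrix.vecCons b (Matrix.vecCons c q)))).row :=
    Matrix.linearIndependent_rows_iff_isUnit.2
      ((Matrix.isUnit_iff_isUnit_det _).2 (isUnit_iff_ne_zero.2 h))
  have h2 : Function.Injective (Sum.elim (Fin.castLE (by omega : 3 ≤ k + 3))
      fun i : Fin k => i.succ.succ.succ) :=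
    Function.Injective.sumElim (Fin.castLE_injective _) (fun l m hlm => by simpa using hlm)
      fun l m hlm => by
        have h3 := congrArg Fin.val hlm
        simp only [Fin.val_castLE, Fin.val_succ] at h3
        omega
  have h3 := h1.comp _ h2
  refine ⟨basisOfLinearIndependentOfCardEqFinrank h3 (by simp [add_comm]), fun i => ?_⟩
  rw [coe_basisOfLinearIndependentOfCardEqFinrank]
  rfl

theorem exists_tri_ne_zero {V R : Type*} [CommRing R] {T : V → V → V → R} {p : Fin 6 → V}
    (h : pascalBracket T p ≠ 0) : ∃ a b c, T a b c ≠ 0 := by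
  by_contra! h0
  exact h (by simp [pascalBracket, h0])

/-- The Hilbert function of the projection of a quasi-Veronese curve from `d - 2` of its points. -/
theorem IsQuasiVeronese.exists_finrank_add_le {k : ℕ} {C : Set (PSpace (k + 2))}
    (hC : IsQuasiVeronese C) (B : Module.Basis (Fin 3 ⊕ Fin k) ℂ (Fin (k + 2 + 1) → ℂ))
    (hB : ∀ i, Projectivization.mk ℂ (B (Sum.inr i)) (B.ne_zero _) ∈ C) {ι : Type} [Fintype ι]
    {X : ι → Set C} (hdisj : Pairwise (Function.onFun Disjoint X))
    (hX : ∀ i, IsSeparated ((linFun (Fin 3 → ℂ)).map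
      (pullback fun (ω : C) l => B.repr ω.1.rep (Sum.inl l)).toLinearMap) (X i)) :
    ∃ c : ℕ, ∀ m, Module.finrank ℂ ↥((linFun (Fin 3 → ℂ)).map
      (pullback fun (ω : C) l => B.repr ω.1.rep (Sum.inl l)).toLinearMap ^ m) +
        Fintype.card ι * m ≤ 3 * m + c := by
  classical
  set crd : Fin 3 ⊕ Fin k → (C → ℂ) := fun x ω => B.repr ω.1.rep x with hcrd
  -- `T r` is spanned by the coordinates left after projection from the first `r` vectors of J, so
  -- it runs from all linear forms to those of the plane.
  set S : ℕ → Set (Fin 3 ⊕ Fin k) := fun r => {x | ∀ i, x = Sum.inr i → r ≤ (i : ℕ)} with hS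
  set T : ℕ → Submodule ℂ (C → ℂ) := fun r => Submodule.span ℂ (crd '' S r) with hT
  obtain ⟨P₀, hP₀⟩ : C.Nonempty := by
    let := zariski (k + 2)
    exact hC.isConnected.nonempty
  -- The values of `p` and `z` for `r ≥ k` are placeholders.
  set p : ℕ → C := fun r => if h : r < k then ⟨_, hB ⟨r, h⟩⟩ else ⟨P₀, hP₀⟩ with hp
  set z : ℕ → (C → ℂ) := fun r => if h : r < k then crd (Sum.inr ⟨r, h⟩) else 0 with hz
  have hcp : ∀ r (h : r < k), ∃ κ : ℂ, κ ≠ 0 ∧ ∀ x, crd x (p r) =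
      κ * Finsupp.single (Sum.inr (⟨r, h⟩ : Fin k)) (1 : ℂ) x := by
    intro r h
    obtain ⟨κ, hκ⟩ := Projectivization.exists_smul_eq_mk_rep ℂ (B (Sum.inr ⟨r, h⟩)) (B.ne_zero _)
    refine ⟨κ, κ.ne_zero, fun x => ?_⟩
    simp only [hcrd, hp, dif_pos h]
    rw [← hκ, Units.smul_def, map_smul, B.repr_self]
    rfl
  have hSr : ∀ r (h : r < k), S r = insert (Sum.inr ⟨r, h⟩) (S (r + 1)) := by
    intro r h
    ext x
    simp only [hS, Set.mem_insert_iff, Set.mem_ofPred_eq]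
    constructor
    · intro hx
      by_cases hxr : x = Sum.inr ⟨r, h⟩
      · exact Or.inl hxr
      · refine Or.inr fun i hi => lt_of_le_of_ne (hx i hi) fun hri => hxr ?_
        rw [hi]
        exact congrArg Sum.inr (Fin.ext hri.symm)
    · rintro (rfl | hx) i hi
      · rw [← Sum.inr.inj hi]
      · exact (Nat.le_succ r).trans (hx i hi)
  have hT0 : T 0 = (linFun (Fin (k + 2 + 1) → ℂ)).map
      (pullback fun ω : C => ω.1.rep).toLinearMap := by
    rw [map_linFun_eq_span B]
    simp only [hT, hS, Nat.zero_le, implies_true]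
    rw [← Set.image_univ]
    rfl
  have hTk : T k = (linFun (Fin 3 → ℂ)).map
      (pullback fun (ω : C) l => B.repr ω.1.rep (Sum.inl l)).toLinearMap := by
    rw [map_linFun_eq_span (Pi.basisFun ℂ (Fin 3))]
    have hSk : S k = Set.range Sum.inl := by
      ext x
      rcases x with l | i
      · simp [hS]
      · simp [hS]
    simp only [hT]
    rw [hSk, ← Set.range_comp]
    rfl
  obtain ⟨c₁, hc₁⟩ := exists_finrank_pow_add_le_of_chain (T := T) (z := z) (p := p) (k := k)
    (fun r h => by
      simp only [hT, hz, dif_pos h]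
      rw [hSr r h, Set.image_insert_eq, Submodule.span_insert, sup_comm])
    (fun r h y hy => by
      obtain ⟨κ, -, hκ⟩ := hcp r h
      have hle : T (r + 1) ≤ LinearMap.ker (LinearMap.proj (p r) : (C → ℂ) →ₗ[ℂ] ℂ) := by
        rw [Submodule.span_le]
        rintro _ ⟨x, hx, rfl⟩
        change crd x (p r) = 0
        rw [hκ, Finsupp.single_apply, if_neg, mul_zero]
        rintro rfl
        exact absurd (hx _ rfl) (by simp)
      exact hle hy)
    (fun r h => by
      obtain ⟨κ, hκ0, hκ⟩ := hcp r h
      simp only [hz, dif_pos h]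
      rw [hκ, Finsupp.single_eq_same, mul_one]
      exact hκ0)
    (fun r => Submodule.fg_span ((Set.toFinite _).image _))
    (fun X hX => by
      rw [hT0] at hX
      exact hX.eq_univ hC.isConnected) le_rfl hdisj (by rwa [hTk])
  obtain ⟨c₀, hc₀⟩ := hC.hilbertPolynomial
  obtain ⟨M, hM⟩ := Filter.eventually_atTop.1 hc₀
  rw [hTk] at hc₁
  -- The growth `k + 2` of the curve, plus one for connectedness, minus `k` for the projections
  -- leaves `3`. The finite sum takes care of degrees where the Hilbert polynomial is not yet
  -- attained.
  refine ⟨c₁ + c₀.toNat + ∑ m ∈ Finset.range M, (Module.finrank ℂ ↥((linFun (Fin 3 → ℂ)).map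
      (pullback fun (ω : C) l => B.repr ω.1.rep (Sum.inl l)).toLinearMap ^ m) +
        Fintype.card ι * m), fun m => ?_⟩
  rcases lt_or_ge m M with hm | hm
  · have := Finset.single_le_sum (f := fun m => Module.finrank ℂ ↥((linFun (Fin 3 → ℂ)).map
      (pullback fun (ω : C) l => B.repr ω.1.rep (Sum.inl l)).toLinearMap ^ m) +
        Fintype.card ι * m) (fun _ _ => Nat.zero_le _) (Finset.mem_range.2 hm)
    omega
  · have h1 := hc₁ m
    have h2 := hM m hm
    rw [hilbertFunction_eq_hilb, hilb_eq_pow, ← hT0] at h2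
    push_cast at h2
    have h3 := Int.self_le_toNat c₀
    zify at h1 ⊢
    rw [h2] at h1
    have h4 : (0 : ℤ) ≤ ∑ x ∈ Finset.range M, (((Module.finrank ℂ ↥((linFun (Fin 3 → ℂ)).map
      (pullback fun (ω : C) l => B.repr ω.1.rep (Sum.inl l)).toLinearMap ^ x) : ℕ) : ℤ) +
        (Fintype.card ι : ℤ) * (x : ℤ)) := Finset.sum_nonneg fun _ _ => by positivity
    linarith

/-- The Pascal expressions vanish for points of a quasi-Veronese curve. -/
theorem IsQuasiVeronese.pascalExpr_eq_zero {k n : ℕ} {C : Set (PSpace (k + 2))}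
    (hC : IsQuasiVeronese C) {v : Fin n → (Fin (k + 2 + 1) → ℂ)} (hv : ∀ a, v a ≠ 0)
    (hvC : ∀ a, Projectivization.mk ℂ (v a) (hv a) ∈ C) (i : Fin 6 → Fin n) (j : Fin k → Fin n) :
    pascalExpr (fun l => v (i l)) (fun l => v (j l)) = 0 := by
  rw [pascalExpr_eq_zero_iff (k := k)]
  -- If the expression is nonzero, so is some bracket containing J; hence J is independent and
  -- extends to a basis, and the projection makes sense.
  by_contra h
  obtain ⟨a, b, c, habc⟩ := exists_tri_ne_zero h
  obtain ⟨B, hB⟩ := exists_basis_of_tri_ne_zero habc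
  apply h
  rw [pascalBracket_tri_basis _ B hB]
  have hBC : ∀ l, Projectivization.mk ℂ (B (Sum.inr l)) (B.ne_zero _) ∈ C := by
    intro l
    have : Projectivization.mk ℂ (B (Sum.inr l)) (B.ne_zero _) =
        Projectivization.mk ℂ (v (j l)) (hv _) := by
      congr 1
      exact hB l
    rw [this]
    exact hvC _
  obtain ⟨Q, hQ0, hQ⟩ := exists_conic fun hdisj hX => hC.exists_finrank_add_le B hBC hdisj hX
  refine ⟨Q, hQ0, fun l => ?_⟩
  obtain ⟨κ, hκ⟩ := Projectivization.exists_smul_eq_mk_rep ℂ (v (i l)) (hv _)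
  have h1 := hQ ⟨_, hvC (i l)⟩
  have h2 : (fun m => B.repr (Projectivization.mk ℂ (v (i l)) (hv _)).rep (Sum.inl m)) =
      (κ : ℂ) • fun m => B.repr (v (i l)) (Sum.inl m) := by
    rw [← hκ, Units.smul_def, map_smul]
    rfl
  simp only at h1
  rw [h2, QuadraticMap.map_smul, smul_eq_mul] at h1
  exact (mul_eq_zero.1 h1).resolve_left (mul_ne_zero κ.ne_zero κ.ne_zero)

/-! ### Configurations as a basis with three further points, and the equivalence. -/

theorem span_eq_top_of_not_onHyperplane {d n : ℕ} {v : Fin n → (Fin (d + 1) → ℂ)}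
    (hv : ∀ a, v a ≠ 0)
    (h : ¬ OnHyperplane (Set.range fun a => Projectivization.mk ℂ (v a) (hv a))) :
    Submodule.span ℂ (Set.range v) = ⊤ := by
  by_contra hspan
  obtain ⟨φ, hφ0, hφ⟩ := exists_dual_of_span_ne_top v hspan
  refine h ⟨φ, hφ0, ?_⟩
  rintro _ ⟨a, rfl⟩
  obtain ⟨κ, hκ⟩ := Projectivization.exists_smul_eq_mk_rep ℂ (v a) (hv a)
  rw [← hκ, Units.smul_def, map_smul, hφ, smul_zero]

/-- If all the Pascal expressions vanish, then the configuration consists of a basis and three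
vectors with coordinates on a conic through the vertices of the standard triangle. -/
theorem exists_extendBasis_eq {k : ℕ} {v : Fin (k + 6) → (Fin (k + 3) → ℂ)}
    (hspan : Submodule.span ℂ (Set.range v) = ⊤)
    (h : ∀ (i : Fin 6 ↪o Fin (k + 6)) (j : Fin k ↪o Fin (k + 6)), Set.range j = (Set.range i)ᶜ →
      pascalExpr (fun l => v (i l)) (fun l => v (j l)) = 0) :
    ∃ (e : Fin (k + 3) ⊕ Fin 3 ≃ Fin (k + 6))
      (E : Module.Basis (Fin (k + 3)) ℂ (Fin (k + 3) → ℂ)) (w : Fin (k + 3) → (Fin 3 → ℂ))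
      (α β γ : ℂ), ¬ (α = 0 ∧ β = 0 ∧ γ = 0) ∧ (∀ a, triangleForm α β γ (w a) = 0) ∧
        extendBasis e E w = v := by
  obtain ⟨f, hf⟩ := exists_orderEmbedding_linearIndependent v hspan
  set E := basisOfLinearIndependentOfCardEqFinrank hf (by simp) with hE
  have hEv : ∀ a, E a = v (f a) := fun a => by
    rw [hE, coe_basisOfLinearIndependentOfCardEqFinrank]
    rfl
  obtain ⟨g, hg⟩ := exists_orderEmbedding_range (m := 3) (Set.range f)ᶜ (by
    have := Set.ncard_add_ncard_compl (Set.range f)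
    rw [Set.ncard_range_of_injective f.injective, Nat.card_eq_fintype_card, Fintype.card_fin,
      Nat.card_eq_fintype_card, Fintype.card_fin] at this
    omega)
  obtain ⟨α, β, γ, h0, hw⟩ := exists_triangleForm_of_pascalExpr v h f f.injective E hEv g
    g.injective hg
  have hbij : Function.Bijective (Sum.elim f g) := by
    refine ⟨f.injective.sumElim g.injective fun a b hab => ?_, fun b => ?_⟩
    · have h1 : g b ∈ (Set.range f)ᶜ := hg ▸ ⟨b, rfl⟩
      exact h1 ⟨a, hab⟩
    · by_cases hb : b ∈ Set.range f
      · obtain ⟨a, rfl⟩ := hb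
        exact ⟨Sum.inl a, rfl⟩
      · have h1 : b ∈ Set.range g := by rwa [hg]
        obtain ⟨a, rfl⟩ := h1
        exact ⟨Sum.inr a, rfl⟩
  refine ⟨Equiv.ofBijective _ hbij, E, fun a m => E.repr (v (g m)) a, α, β, γ, h0, hw, ?_⟩
  ext1 b
  obtain ⟨i, rfl⟩ := (Equiv.ofBijective _ hbij).surjective b
  rw [extendBasis, Equiv.symm_apply_apply]
  rcases i with a | m
  · exact hEv a
  · exact E.sum_repr (v (g m))

end PascalRNC

end

theorem theorem5p1 (d : ℕ) (hd : 3 ≤ d) (P : Fin (d + 4) → PascalRNC.PSpace d)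
    (hP : ¬ PascalRNC.OnHyperplane (Set.range P))
    -- any choice of homogeneous coordinates for the points
    (v : Fin (d + 4) → (Fin (d + 1) → ℂ)) (hv : ∀ a, v a ≠ 0)
    (hPv : ∀ a, P a = Projectivization.mk ℂ (v a) (hv a)) :
    List.TFAE
      [P ∈ PascalRNC.veroneseCompactification d (d + 4),
       ∃ C : Set (PascalRNC.PSpace d), PascalRNC.IsQuasiVeronese C ∧ ∀ a, P a ∈ C,
       ∀ (i : Fin 6 ↪o Fin (d + 4)) (j : Fin (d - 2) ↪o Fin (d + 4)),
         Set.range j = (Set.range i)ᶜ →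
         PascalRNC.pascalExpr (fun k => v (i k)) (fun k => v (j k)) = 0] := by
  obtain ⟨k, rfl⟩ : ∃ k, d = k + 2 := ⟨d - 2, by omega⟩
  tfae_have 1 → 3 := fun h i j _ =>
    PascalRNC.pascalExpr_eq_zero_of_mem_veroneseCompactification P h v hv hPv i j
  tfae_have 2 → 3 := by
    rintro ⟨C, hC, hPC⟩ i j _
    exact hC.pascalExpr_eq_zero hv (fun a => hPv a ▸ hPC a) i j
  obtain rfl : P = fun a => Projectivization.mk ℂ (v a) (hv a) := funext hPv
  have hspan := PascalRNC.span_eq_top_of_not_onHyperplane hv hP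
  tfae_have 3 → 1 := by
    intro h
    obtain ⟨e, E, w, α, β, γ, h0, hw, rfl⟩ := PascalRNC.exists_extendBasis_eq hspan h
    exact PascalRNC.extendBasis_mem_veroneseCompactification (by omega) e E h0 hw hv
  tfae_have 3 → 2 := by
    intro h
    obtain ⟨e, E, w, α, β, γ, h0, hw, rfl⟩ := PascalRNC.exists_extendBasis_eq hspan h
    exact PascalRNC.exists_isQuasiVeronese_extendBasis e E h0 hw hv
  tfae_finish
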